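/- **Conventions.** We work in the non-uniform model: on inputs of a given shape an algorithm is a Boolean circuit over $\{\wedge,\vee,\neg\}$ with unbounded fan-in (one circuit for each value of the security parameter $\kappa$), and its running time is the size of the circuit (number of gates, wires and output bits). Randomized algorithms read additional independent fair coins. Depth is the largest number of $\wedge/\vee$ gates on a path from an input to the output (negations are not counted). A set of functions "consists of circuits of size $s$ and depth $h$" if each of its members is computed by a circuit of size at most $s$ and depth at most $h$. All $o,\omega,O,\tilde O$ are as $\kappa\to\infty$, and $\tilde O(g(n))$ means $O(g(n)\log^c n)$ for some constant $c$. **Encryption.** An encryption scheme consists of $\mathrm{poly}(\kappa)$-time algorithms $\mathsf{Gen},\mathsf{Enc},\mathsf{Dec}$, of which only $\mathsf{Dec}$ must be deterministic: $\mathsf{Gen}(1^\kappa)$ outputs a key $sk\in\{0,1\}^\kappa$, $\mathsf{Enc}(sk,b)$ maps a key and a bit to a ciphertext in a set $\mathcal C^{(\kappa)}$ of bit strings of a fixed length, and $\mathsf{Dec}(sk,c)$ is a bit. It is perfectly correct if $\Pr[\mathsf{Dec}(sk,\mathsf{Enc}(sk,b))=b]=1$ for $sk\leftarrow\mathsf{Gen}(1^\kappa)$,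 for all $b,\kappa$. It is $(\varepsilon,q,T)$-secure if for every $\kappa$, every randomized algorithm $A$ of running time at most $T(\kappa)$ and all $b,b'\in\{0,1\}^{q(\kappa)}$, $$\Big|\Pr[A(\mathsf{Enc}(sk,b_1),\dots,\mathsf{Enc}(sk,b_q))=1]-\Pr[A(\mathsf{Enc}(sk,b'_1),\dots,\mathsf{Enc}(sk,b'_q))=1]\Big|\le\varepsilon(\kappa),$$ where $sk\leftarrow\mathsf{Gen}(1^\kappa)$ and the encryptions are independent. **Traitor tracing.** For $n,k:\mathbb N\to\mathbb N$, an $(n,k)$-traitor-tracing scheme consists of algorithms $\mathsf{Gen},\mathsf{Enc},\mathsf{Dec}$ running in time $\mathrm{poly}(\kappa,n(\kappa))$ and $\mathsf{Trace}$ running in time $\mathrm{poly}(\kappa,n(\kappa),k(\kappa))$, all but $\mathsf{Dec}$ possibly randomized. $\mathsf{Gen}(1^\kappa)$ outputs keys $\vec{sk}=(sk_1,\dots,sk_{n(\kappa)})\in(\{0,1\}^\kappa)^{n(\kappa)}$; $\mathsf{Enc}(\vec{sk},b)$ outputs a ciphertext in a set $\mathcal C^{(\kappa)}$ of bit strings of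 a fixed length; $\mathsf{Dec}(sk_i,c)$ is a bit; every honestly generated encryption of $b$ is decrypted to $b$ by every user with probability $1$. $\mathsf{Trace}^{\mathcal P}(\vec{sk})$ submits one tuple $(c_1,\dots,c_{k(\kappa)})$ of elements of $\mathcal C^{(\kappa)}$ to its oracle $\mathcal P$, receives $k(\kappa)$ bits and returns a user $i\in[n(\kappa)]$. A randomized algorithm $\mathcal P$, which is given the keys $\vec{sk}_S=(sk_i)_{i\in S}$ and $k(\kappa)$ ciphertexts and returns bits $\hat b_1,\dots,\hat b_{k(\kappa)}$, is an *available pirate decoder* if, for some function $\eta(\kappa)=o(1/n(\kappa)^2)$, for all $\kappa$, all $\vec{sk}\in(\{0,1\}^\kappa)^{n(\kappa)}$, all $S\subseteq[n(\kappa)]$ with $|S|\ge n(\kappa)-1$ and all $c_1,\dots,c_{k(\kappa)}\in\mathcal C^{(\kappa)}$, $$\Pr\big[\exists j,\,b:\ (\forall i\in S:\ \mathsf{Dec}(sk_i,c_j)=b)\ \wedge\ \hat b_j\ne b\big]\le\eta(\kappa).$$ The scheme is *secure* if for all $S(\kappa)\subseteq[n(\kappa)]$ with $|S(\kappa)|\ge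 n(\kappa)-1$ and every available pirate decoder $\mathcal P$ running in time $\mathrm{poly}(\kappa,n(\kappa),k(\kappa))$, for $\vec{sk}\leftarrow\mathsf{Gen}(1^\kappa)$, $$\Pr\big[\mathsf{Trace}^{\mathcal P(\vec{sk}_{S(\kappa)},\cdot)}(\vec{sk})\notin S(\kappa)\big]=o(1/n(\kappa)).$$ For either kind of scheme, the decryption function family is the set of all functions $sk\mapsto\mathsf{Dec}(sk,c)$ on $\{0,1\}^\kappa$, for $c\in\mathcal C^{(\kappa)}$. **Corollary.** Let $n=n(\kappa)$ be a non-constant polynomial in $\kappa$ with values in $\mathbb N$, and let $h\in\mathbb N$. Suppose there is a perfectly correct encryption scheme whose decryption function family consists of circuits of size $\mathrm{poly}(\kappa)$ and depth $h$, and which for every integer $a>0$ is $(\varepsilon,q,n^a)$-secure for some $\varepsilon=o(1/n^2)$ and $q=\omega(n^4)$ (which may depend on $a$). Then there are a function $k=\tilde O(n^2)$ and a secure $(n,k)$-traitor-tracing scheme whose decryption function family consists of circuits of size $\tilde O(n)\cdot\mathrm{poly}(\kappa)$ and depth $h+2$. -/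

import Mathlib

open Filter Asymptotics

namespace TraitorTracing

/-! ### Boolean circuits over the basis {and, or, not} with unbounded fan-in -/

/-- A wire of a circuit with input bits indexed by `ι`: an input bit, or the output of the
`j`-th gate. -/
inductive Wire (ι : Type) where
  | input (i : ι)
  | gate (j : ℕ)

/-- A gate, with the list of wires it reads. -/
inductive Gate (ι : Type) where
  | and (args : List (Wire ι))
  | or (args : List (Wire ι))
  | not (arg : Wire ι)

/-- A circuit with input bits indexed by `ι` and output bits indexed by `o`: a list of gates in
topological order, and the wire of each output bit. -/
structure Circuit (ι o : Type) where
  gates : List (Gate ι)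
  out : o → Wire ι

/-- The bit on a wire, when the input is `x` and the gates evaluated so far have the values `vals`.
A wire that refers to no earlier gate carries the constant `0`. -/
def Wire.value {ι : Type} (x : ι → Bool) (vals : List Bool) : Wire ι → Bool
  | .input i => x i
  | .gate j => vals.getD j false

/-- The output bit of a gate. -/
def Gate.value {ι : Type} (x : ι → Bool) (vals : List Bool) : Gate ι → Bool
  | .and args => args.all (fun w => w.value x vals)
  | .or args => args.any (fun w => w.value x vals)
  | .not arg => !(arg.value x vals)

/-- The values of all gates, computed one after the other. -/
def gateValues {ι : Type} (x : ι → Bool) (gs : List (Gate ι)) : List Bool :=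
  gs.foldl (fun vals g => vals ++ [g.value x vals]) []

/-- The function computed by a circuit. -/
def Circuit.run {ι o : Type} (C : Circuit ι o) (x : ι → Bool) : o → Bool :=
  fun j => (C.out j).value x (gateValues x C.gates)

/-- One for the gate, plus its fan-in. -/
def Gate.size {ι : Type} : Gate ι → ℕ
  | .and args => 1 + args.length
  | .or args => 1 + args.length
  | .not _ => 2

/-- Size of a circuit: number of gates, plus number of wires into gates, plus number of output bits.
This is the running time of the circuit. -/
def Circuit.size {ι o : Type} [Fintype o] (C : Circuit ι o) : ℕ :=
  (C.gates.map Gate.size).sum + Fintype.card o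

/-- Depth of a wire, when the gates so far have the depths `ds`. -/
def Wire.depth {ι : Type} (ds : List ℕ) : Wire ι → ℕ
  | .input _ => 0
  | .gate j => ds.getD j 0

/-- Depth of a gate. As usual for unbounded fan-in circuits, negations are not counted. -/
def Gate.depth {ι : Type} (ds : List ℕ) : Gate ι → ℕ
  | .and args => 1 + (args.map (fun w => w.depth ds)).foldr max 0
  | .or args => 1 + (args.map (fun w => w.depth ds)).foldr max 0
  | .not arg => arg.depth ds

/-- The depths of all gates. -/
def gateDepths {ι : Type} (gs : List (Gate ι)) : List ℕ :=
  gs.foldl (fun ds g => ds ++ [g.depth ds]) []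

/-- Depth of a circuit: the largest number of and/or gates on a path from an input to an output. -/
def Circuit.depth {ι o : Type} [Fintype o] (C : Circuit ι o) : ℕ :=
  Finset.univ.sup (fun j => (C.out j).depth (gateDepths C.gates))

/-! ### Randomized algorithms and probabilities

Algorithms are non-uniform: on inputs of a given shape an algorithm is a circuit, and its running
time is the size of the circuit. A randomized algorithm reads independent fair coins as additional
input bits. -/

/-- A circuit with `coins` additional input bits for random coins. -/
structure RandCircuit (ι o : Type) where
  coins : ℕ
  circuit : Circuit (ι ⊕ Fin coins) o

/-- The possible outcomes of the coins of a randomized circuit. -/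
abbrev RandCircuit.Coins {ι o : Type} (A : RandCircuit ι o) : Type := Fin A.coins → Bool

/-- The output on input `x` when the coins come out as `ρ`. -/
def RandCircuit.run {ι o : Type} (A : RandCircuit ι o) (x : ι → Bool) (ρ : A.Coins) : o → Bool :=
  A.circuit.run (Sum.elim x ρ)

/-- The running time of a randomized circuit. -/
def RandCircuit.size {ι o : Type} [Fintype o] (A : RandCircuit ι o) : ℕ := A.circuit.size

open Classical in
/-- Probability of an event under the uniform distribution on a finite sample space. All sample
spaces below are finite products of coin spaces, so that different coins are independent. -/
noncomputable def prob {Ω : Type} [Fintype Ω] (A : Ω → Prop) : ℝ :=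
  ((Finset.univ.filter A).card : ℝ) / (Fintype.card Ω : ℝ)

/-- `t` is bounded by a polynomial in `m`: `t = poly(m)`. -/
def PolyBounded (t m : ℕ → ℕ) : Prop := ∃ c : ℕ, ∀ κ, t κ ≤ c * (m κ + 1) ^ c

/-- `Q κ` is a set of Boolean functions on `κ` bits; all of them are computed by circuits of
size at most `s κ` and depth at most `h`. -/
def HasCircuits (Q : ∀ κ : ℕ, Set ((Fin κ → Bool) → Bool)) (s : ℕ → ℕ) (h : ℕ) : Prop :=
  ∀ κ, ∀ q ∈ Q κ, ∃ D : Circuit (Fin κ) Unit,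
    (∀ x, D.run x () = q x) ∧ D.size ≤ s κ ∧ D.depth ≤ h

/-! ### Encryption schemes -/

/-- A (private-key, one-bit) encryption scheme: efficient algorithms `Gen`, `Enc`, `Dec` with keys in
`{0,1}^κ` and ciphertexts in a set `C^(κ)` of bit strings of length `len κ`. -/
structure EncScheme where
  len : ℕ → ℕ
  /-- The ciphertext space `C^(κ)`. -/
  ciphertexts : ∀ κ, Set (Fin (len κ) → Bool)
  gen : ∀ κ, RandCircuit Empty (Fin κ)
  /-- Reads a key and a message bit. -/
  enc : ∀ κ, RandCircuit (Fin κ ⊕ Unit) (Fin (len κ))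
  /-- Reads a key and a ciphertext. -/
  dec : ∀ κ, Circuit (Fin κ ⊕ Fin (len κ)) Unit
  enc_mem : ∀ κ (sk : Fin κ → Bool) (b : Bool) (ρ : (enc κ).Coins),
    (enc κ).run (Sum.elim sk fun _ => b) ρ ∈ ciphertexts κ
  gen_time : PolyBounded (fun κ => (gen κ).size) (fun κ => κ)
  enc_time : PolyBounded (fun κ => (enc κ).size) (fun κ => κ)
  dec_time : PolyBounded (fun κ => (dec κ).size) (fun κ => κ)

namespace EncScheme

variable (E : EncScheme)

/-- `Gen(1^κ)` with coins `γ`. -/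
def Gen (κ : ℕ) (γ : (E.gen κ).Coins) : Fin κ → Bool := (E.gen κ).run Empty.elim γ

/-- `Enc(sk, b)` with coins `ρ`. -/
def Enc (κ : ℕ) (sk : Fin κ → Bool) (b : Bool) (ρ : (E.enc κ).Coins) : Fin (E.len κ) → Bool :=
  (E.enc κ).run (Sum.elim sk fun _ => b) ρ

/-- `Dec(sk, c)`. -/
def Dec (κ : ℕ) (sk : Fin κ → Bool) (c : Fin (E.len κ) → Bool) : Bool :=
  (E.dec κ).run (Sum.elim sk c) ()

/-- Perfect correctness. -/
def Correct : Prop :=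
  ∀ (b : Bool) (κ : ℕ),
    prob (fun ω : (E.gen κ).Coins × (E.enc κ).Coins =>
      E.Dec κ (E.Gen κ ω.1) (E.Enc κ (E.Gen κ ω.1) b ω.2) = b) = 1

/-- The probability that `A` outputs `1` on independent encryptions of `b 0, b 1, ...` under one
random key. -/
noncomputable def acceptProb (κ q : ℕ) (A : RandCircuit (Fin q × Fin (E.len κ)) Unit)
    (b : Fin q → Bool) : ℝ :=
  prob (fun ω : (E.gen κ).Coins × (Fin q → (E.enc κ).Coins) × A.Coins =>
    A.run (fun p => E.Enc κ (E.Gen κ ω.1) (b p.1) (ω.2.1 p.1) p.2) ω.2.2 () = true)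

/-- `(ε, q, T)`-security: no adversary of running time `T(κ, q(κ))` distinguishes the encryptions
of two sequences of `q(κ)` messages with advantage more than `ε(κ)`. -/
def Secure (ε : ℕ → ℝ) (q : ℕ → ℕ) (T : ℕ → ℕ → ℕ) : Prop :=
  ∀ (κ : ℕ) (A : RandCircuit (Fin (q κ) × Fin (E.len κ)) Unit), A.size ≤ T κ (q κ) →
    ∀ b b' : Fin (q κ) → Bool,
      |E.acceptProb κ (q κ) A b - E.acceptProb κ (q κ) A b'| ≤ ε κ

/-- The decryption function family: all functions `sk ↦ Dec(sk, c)` for ciphertexts `c`. -/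
def decFamily (κ : ℕ) : Set ((Fin κ → Bool) → Bool) :=
  {f | ∃ c ∈ E.ciphertexts κ, f = fun sk => E.Dec κ sk c}

end EncScheme

/-! ### Traitor-tracing schemes -/

/-- A traitor-tracing scheme with `n(κ)` users whose tracing algorithm makes one `k(κ)`-tuple of
queries to its oracle. The tracing algorithm is given by two circuits that read the same coins:
`query` computes the tuple of ciphertexts given to the oracle, and `accuse` computes the accused user
(as a unit vector in `{0,1}^n`) from the keys, the coins and the answers of the oracle. -/
structure TTScheme (n k : ℕ → ℕ) where
  len : ℕ → ℕ
  /-- The ciphertext space `C^(κ)`. -/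
  ciphertexts : ∀ κ, Set (Fin (len κ) → Bool)
  /-- Outputs one key in `{0,1}^κ` for each of the `n(κ)` users. -/
  gen : ∀ κ, RandCircuit Empty (Fin (n κ) × Fin κ)
  /-- Reads the keys of all users and a message bit. -/
  enc : ∀ κ, RandCircuit ((Fin (n κ) × Fin κ) ⊕ Unit) (Fin (len κ))
  /-- Reads the key of one user and a ciphertext. -/
  dec : ∀ κ, Circuit (Fin κ ⊕ Fin (len κ)) Unit
  traceCoins : ℕ → ℕ
  query : ∀ κ, Circuit ((Fin (n κ) × Fin κ) ⊕ Fin (traceCoins κ)) (Fin (k κ) × Fin (len κ))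
  accuse : ∀ κ,
    Circuit ((Fin (n κ) × Fin κ) ⊕ (Fin (traceCoins κ) ⊕ Fin (k κ))) (Fin (n κ))
  enc_mem : ∀ κ (sk : Fin (n κ) × Fin κ → Bool) (b : Bool) (ρ : (enc κ).Coins),
    (enc κ).run (Sum.elim sk fun _ => b) ρ ∈ ciphertexts κ
  query_mem : ∀ κ (sk : Fin (n κ) × Fin κ → Bool) (τ : Fin (traceCoins κ) → Bool) (j : Fin (k κ)),
    (fun l => (query κ).run (Sum.elim sk τ) (j, l)) ∈ ciphertexts κ
  accuse_unique : ∀ κ, 0 < n κ → ∀ (sk : Fin (n κ) × Fin κ → Bool)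
    (τ : Fin (traceCoins κ) → Bool) (a : Fin (k κ) → Bool),
    ∃! i, (accuse κ).run (Sum.elim sk (Sum.elim τ a)) i = true
  gen_time : PolyBounded (fun κ => (gen κ).size) (fun κ => κ + n κ)
  enc_time : PolyBounded (fun κ => (enc κ).size) (fun κ => κ + n κ)
  dec_time : PolyBounded (fun κ => (dec κ).size) (fun κ => κ + n κ)
  query_time : PolyBounded (fun κ => (query κ).size) (fun κ => κ + n κ + k κ)
  accuse_time : PolyBounded (fun κ => (accuse κ).size) (fun κ => κ + n κ + k κ)

namespace TTScheme

variable {n k : ℕ → ℕ} (TT : TTScheme n k)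

/-- The key of user `i` produced by `Gen(1^κ)` with coins `γ`. -/
def Gen (κ : ℕ) (γ : (TT.gen κ).Coins) (i : Fin (n κ)) : Fin κ → Bool :=
  fun l => (TT.gen κ).run Empty.elim γ (i, l)

/-- `Enc((sk_1, ..., sk_n), b)` with coins `ρ`. -/
def Enc (κ : ℕ) (sk : Fin (n κ) → Fin κ → Bool) (b : Bool) (ρ : (TT.enc κ).Coins) :
    Fin (TT.len κ) → Bool :=
  (TT.enc κ).run (Sum.elim (fun p => sk p.1 p.2) fun _ => b) ρ

/-- `Dec(sk, c)`. -/
def Dec (κ : ℕ) (sk : Fin κ → Bool) (c : Fin (TT.len κ) → Bool) : Bool :=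
  (TT.dec κ).run (Sum.elim sk c) ()

/-- The `j`-th ciphertext that the tracing algorithm with coins `τ` submits to its oracle. -/
def Query (κ : ℕ) (sk : Fin (n κ) → Fin κ → Bool) (τ : Fin (TT.traceCoins κ) → Bool)
    (j : Fin (k κ)) : Fin (TT.len κ) → Bool :=
  fun l => (TT.query κ).run (Sum.elim (fun p => sk p.1 p.2) τ) (j, l)

/-- The tracing algorithm with coins `τ` returns user `i` when the oracle answers `a`. -/
def Accuses (κ : ℕ) (sk : Fin (n κ) → Fin κ → Bool) (τ : Fin (TT.traceCoins κ) → Bool)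
    (a : Fin (k κ) → Bool) (i : Fin (n κ)) : Prop :=
  (TT.accuse κ).run (Sum.elim (fun p => sk p.1 p.2) (Sum.elim τ a)) i = true

/-- Perfect correctness: every user decrypts honestly generated ciphertexts correctly. -/
def Correct : Prop :=
  ∀ (b : Bool) (κ : ℕ) (i : Fin (n κ)),
    prob (fun ω : (TT.gen κ).Coins × (TT.enc κ).Coins =>
      TT.Dec κ (TT.Gen κ ω.1 i) (TT.Enc κ (TT.Gen κ ω.1) b ω.2) = b) = 1

/-- A pirate decoder: a randomized algorithm that is given the keys of the users in `S` and a
`k(κ)`-tuple of ciphertexts, and returns `k(κ)` bits. -/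
def Pirate : Type :=
  ∀ (κ : ℕ) (S : Finset (Fin (n κ))),
    RandCircuit ((S × Fin κ) ⊕ (Fin (k κ) × Fin (TT.len κ))) (Fin (k κ))

variable {TT}

/-- `P(sk_S, c_1, ..., c_k)` with coins `ρ`. -/
def Pirate.answer (P : TT.Pirate) (κ : ℕ) (S : Finset (Fin (n κ))) (sk : Fin (n κ) → Fin κ → Bool)
    (c : Fin (k κ) → Fin (TT.len κ) → Bool) (ρ : (P κ S).Coins) : Fin (k κ) → Bool :=
  (P κ S).run (Sum.elim (fun p => sk p.1 p.2) (fun p => c p.1 p.2)) ρ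

/-- The pirate runs in time `poly(κ, n(κ), k(κ))`, for the coalitions `S` with `|S| ≥ n(κ) - 1`. -/
def Pirate.Efficient (P : TT.Pirate) : Prop :=
  ∃ c : ℕ, ∀ (κ : ℕ) (S : Finset (Fin (n κ))), n κ ≤ S.card + 1 →
    (P κ S).size ≤ c * (κ + n κ + k κ + 1) ^ c

/-- An available pirate decoder: except with probability `o(1/n²)`, whenever all keys in the coalition
decrypt a ciphertext to the same bit, the pirate answers this bit. -/
def Pirate.Available (P : TT.Pirate) : Prop :=
  ∃ η : ℕ → ℝ, η =o[atTop] (fun κ => 1 / (n κ : ℝ) ^ 2) ∧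
    ∀ (κ : ℕ) (sk : Fin (n κ) → Fin κ → Bool) (S : Finset (Fin (n κ))), n κ ≤ S.card + 1 →
      ∀ c : Fin (k κ) → Fin (TT.len κ) → Bool, (∀ j, c j ∈ TT.ciphertexts κ) →
        prob (fun ρ : (P κ S).Coins =>
          ∃ (j : Fin (k κ)) (b : Bool),
            (∀ i ∈ S, TT.Dec κ (sk i) (c j) = b) ∧ P.answer κ S sk c ρ j ≠ b) ≤ η κ

variable (TT)

/-- Security: for every coalition of at least `n - 1` users and every efficient available pirate
decoder, the tracing algorithm fails to return a user in the coalition with probability `o(1/n)`. -/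
def Secure : Prop :=
  ∀ S : ∀ κ, Finset (Fin (n κ)), (∀ κ, n κ ≤ (S κ).card + 1) →
    ∀ P : TT.Pirate, P.Efficient → P.Available →
      (fun κ => prob (fun ω : (TT.gen κ).Coins × (Fin (TT.traceCoins κ) → Bool) × (P κ (S κ)).Coins =>
        ¬ ∃ i ∈ S κ, TT.Accuses κ (TT.Gen κ ω.1) ω.2.1
          (P.answer κ (S κ) (TT.Gen κ ω.1) (TT.Query κ (TT.Gen κ ω.1) ω.2.1) ω.2.2) i))
        =o[atTop] (fun κ => 1 / (n κ : ℝ))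

/-- The decryption function family: all functions `sk ↦ Dec(sk, c)` for ciphertexts `c`. -/
def decFamily (κ : ℕ) : Set ((Fin κ → Bool) → Bool) :=
  {f | ∃ c ∈ TT.ciphertexts κ, f = fun sk => TT.Dec κ sk c}

end TTScheme

end TraitorTracing

namespace TraitorTracing

/-! ### Composition of circuits -/

section Substitution

variable {ι ι' o o' : Type}

/-! Every user gets an independent key of the encryption scheme at security parameter `κ / 2` and,
in the remaining `κ - κ / 2` bits, a name of their own. A ciphertext is a list of `n` ciphertexts,
one under each key. Decryption picks the entry that matches the name: one level of conjunctions and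
one disjunction over `n` branches on top of the old decryption circuits, which gives depth `h + 2`.
As different users can be sent different bits, the tracer submits `k` lists whose bits form a random
matrix, a fingerprinting code, and computes the accused user from the answers.

The code: in each column a uniform bias is drawn and every user independently gets a bit with this
bias, so the number `t` of ones is close to uniform on `0, …, n` (`le_weightProb`). A column
answered by 1 adds `g(t) * (n * bit - t)` to each user's score. These increments sum to zero over
the users, so some score is nonnegative, and the first such user is accused. The weight `g(t)` is
chosen so that, given the bits of the other `n - 1` users, the increment of an innocent user has
mean zero whatever the pirate answers, apart from rounding. The exceptions come from the marking
condition: if all others have 0 the answer is 0, and if all others have 1 the answer is 1, where the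
innocent user loses `n - 1` on average over all columns. This drift against a variance of order `n ^
4 * log n` per column yields, by an exponential moment (`moment_le`, `sum_momentBound_le`,
`prob_accuse_innocent_le`), an accusation probability of at most `(1 - 1 / (128 n² (1 + log n))) ^
k`, hence at most `1 / n²` for some `k = Õ(n²)`.

That argument needs answers independent of the innocent user's bits, and encryption provides this:
the pirate lacks that user's key, so encrypting 0 to that user instead changes the accusation
probability by at most `ε` (`prob_accused_le_add`). The distinguisher simulates the pirate and the
accusation on at most `q` ciphertexts; its size is polynomial, so below `n (κ / 2) ^ a` for a
suitable `a`. Availability makes the answers satisfy the marking condition up to `η`. In total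
tracing fails with probability at most `η + 1 / n² + ε = o(1 / n)` (`tracing_failProb_le`). Finitely
many small `κ` are served by a trivial scheme. -/

/-- A wire of a circuit with `a` gates, seen in a circuit that has `b` further gates: references to
missing gates stay references to missing gates. -/
def Wire.extend (a b : ℕ) : Wire ι → Wire ι
  | .input i => .input i
  | .gate j => if j < a then .gate j else .gate (j + b)

/-- A wire of a circuit with `b` gates that is placed after `a` gates, its inputs being connected to
the wires `e`. -/
def Wire.subst (a b : ℕ) (e : ι' → Wire ι) : Wire ι' → Wire ι
  | .input i => (e i).extend a b
  | .gate j => .gate (a + j)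

def Gate.subst (a b : ℕ) (e : ι' → Wire ι) : Gate ι' → Gate ι
  | .and args => .and (args.map (Wire.subst a b e))
  | .or args => .or (args.map (Wire.subst a b e))
  | .not arg => .not (arg.subst a b e)

theorem Gate.size_subst (a b : ℕ) (e : ι' → Wire ι) (g : Gate ι') :
    (g.subst a b e).size = g.size := by
  cases g <;> simp [Gate.subst, Gate.size]

theorem Wire.value_extend {a b : ℕ} {x : ι → Bool} {u v : List Bool} (hu : u.length = a)
    (hv : v.length ≤ b) (w : Wire ι) : (w.extend a b).value x (u ++ v) = w.value x u := by
  cases w with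
  | input i => rfl
  | gate j =>
    by_cases hj : j < a
    · simp only [Wire.extend, hj, if_true, Wire.value]
      rw [List.getD_append _ _ _ _ (by omega)]
    · simp only [Wire.extend, hj, if_false, Wire.value]
      rw [List.getD_eq_default _ _ (by simp; omega), List.getD_eq_default _ _ (by omega)]

theorem Wire.value_subst {a b : ℕ} {e : ι' → Wire ι} {x : ι → Bool} {u v : List Bool}
    (hu : u.length = a) (hv : v.length ≤ b) (w : Wire ι') :
    (w.subst a b e).value x (u ++ v) = w.value (fun i => (e i).value x u) v := by
  cases w with
  | input i => exact Wire.value_extend hu hv _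
  | gate j =>
    simp only [Wire.subst, Wire.value]
    rw [List.getD_append_right _ _ _ _ (by omega)]
    congr 1; omega

theorem Gate.value_subst {a b : ℕ} {e : ι' → Wire ι} {x : ι → Bool} {u v : List Bool}
    (hu : u.length = a) (hv : v.length ≤ b) (g : Gate ι') :
    (g.subst a b e).value x (u ++ v) = g.value (fun i => (e i).value x u) v := by
  cases g with
  | and args =>
    simp only [Gate.subst, Gate.value, List.all_map]
    congr 1; funext w; exact Wire.value_subst hu hv w
  | or args =>
    simp only [Gate.subst, Gate.value, List.any_map]
    congr 1; funext w; exact Wire.value_subst hu hv w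
  | not arg => simp only [Gate.subst, Gate.value, Wire.value_subst hu hv]

theorem length_foldl_snoc {α β : Type} (f : List β → α → β) (l : List α) (u : List β) :
    (l.foldl (fun v a => v ++ [f v a]) u).length = u.length + l.length := by
  induction l generalizing u with
  | nil => rfl
  | cons a l ih => simp [ih]; omega

theorem length_gateValues (x : ι → Bool) (gs : List (Gate ι)) :
    (gateValues x gs).length = gs.length := by
  simp [gateValues, length_foldl_snoc (fun v (g : Gate ι) => g.value x v)]

theorem length_gateDepths (gs : List (Gate ι)) : (gateDepths gs).length = gs.length := by
  simp [gateDepths, length_foldl_snoc (fun v (g : Gate ι) => g.depth v)]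

/-- The shift `b` is the final number of appended gates, fixed in advance; at every intermediate
stage at most `b` of them have been evaluated, so dangling references still read the default value.
-/
theorem foldl_value_subst {a b : ℕ} {e : ι' → Wire ι} {x : ι → Bool} {u : List Bool}
    (hu : u.length = a) (hs : List (Gate ι')) (v : List Bool) (hv : v.length + hs.length ≤ b) :
    (hs.map (Gate.subst a b e)).foldl (fun vals g => vals ++ [g.value x vals]) (u ++ v) =
      u ++ hs.foldl (fun vals g => vals ++ [g.value (fun i => (e i).value x u) vals]) v := by
  induction hs generalizing v with
  | nil => rfl
  | cons g hs ih =>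
    simp only [List.map_cons, List.foldl_cons, List.length_cons] at hv ⊢
    rw [Gate.value_subst hu (by omega), List.append_assoc]
    exact ih _ (by simp; omega)

theorem gateValues_append_subst {b : ℕ} (e : ι' → Wire ι) (x : ι → Bool) (gs : List (Gate ι))
    (hs : List (Gate ι')) (hb : hs.length = b) :
    gateValues x (gs ++ hs.map (Gate.subst gs.length b e)) =
      gateValues x gs ++ gateValues (fun i => (e i).value x (gateValues x gs)) hs := by
  have := foldl_value_subst (e := e) (x := x) (length_gateValues x gs) hs (b := b) []
    (by simp [hb])
  rw [gateValues, List.foldl_append]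
  simpa [gateValues] using this

theorem Wire.depth_extend {a b : ℕ} {u v : List ℕ} (hu : u.length = a)
    (hv : v.length ≤ b) (w : Wire ι) : (w.extend a b).depth (u ++ v) = w.depth u := by
  cases w with
  | input i => rfl
  | gate j =>
    by_cases hj : j < a
    · simp only [Wire.extend, hj, if_true, Wire.depth]
      rw [List.getD_append _ _ _ _ (by omega)]
    · simp only [Wire.extend, hj, if_false, Wire.depth]
      rw [List.getD_eq_default _ _ (by simp; omega), List.getD_eq_default _ _ (by omega)]

theorem Wire.depth_subst {a b : ℕ} {e : ι' → Wire ι} {u v v' : List ℕ} {D : ℕ}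
    (hu : u.length = a) (hv : v.length ≤ b) (he : ∀ i, (e i).depth u ≤ D)
    (hvv : ∀ j, v.getD j 0 ≤ D + v'.getD j 0) (w : Wire ι') :
    (w.subst a b e).depth (u ++ v) ≤ D + w.depth v' := by
  cases w with
  | input i => exact (Wire.depth_extend hu hv _).le.trans ((he i).trans (by simp [Wire.depth]))
  | gate j =>
    simp only [Wire.subst, Wire.depth]
    rw [List.getD_append_right _ _ _ _ (by omega)]
    convert hvv j using 2; omega

theorem foldr_max_le_iff (l : List ℕ) (B : ℕ) : l.foldr max 0 ≤ B ↔ ∀ a ∈ l, a ≤ B := by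
  induction l with
  | nil => simp
  | cons a l ih => simp [ih]

theorem le_foldr_max {l : List ℕ} {a : ℕ} (h : a ∈ l) : a ≤ l.foldr max 0 :=
  (foldr_max_le_iff l _).1 le_rfl a h

theorem Gate.depth_subst {a b : ℕ} {e : ι' → Wire ι} {u v v' : List ℕ} {D : ℕ}
    (hu : u.length = a) (hv : v.length ≤ b) (he : ∀ i, (e i).depth u ≤ D)
    (hvv : ∀ j, v.getD j 0 ≤ D + v'.getD j 0) (g : Gate ι') :
    (g.subst a b e).depth (u ++ v) ≤ D + g.depth v' := by
  have key : ∀ args : List (Wire ι'),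
      1 + ((args.map (Wire.subst a b e)).map (fun w => w.depth (u ++ v))).foldr max 0 ≤
        D + (1 + (args.map (fun w => w.depth v')).foldr max 0) := by
    intro args
    have : ((args.map (Wire.subst a b e)).map (fun w => w.depth (u ++ v))).foldr max 0 ≤
        D + (args.map (fun w => w.depth v')).foldr max 0 := by
      rw [foldr_max_le_iff]
      simp only [List.mem_map, List.map_map, Function.comp]
      rintro _ ⟨w, hw, rfl⟩
      refine (Wire.depth_subst hu hv he hvv w).trans ?_
      gcongr
      exact le_foldr_max (List.mem_map_of_mem hw)
    omega
  cases g with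
  | and args => exact key args
  | or args => exact key args
  | not arg => exact Wire.depth_subst hu hv he hvv arg

theorem foldl_depth_subst {a b : ℕ} {e : ι' → Wire ι} {u : List ℕ} {D : ℕ}
    (hu : u.length = a) (he : ∀ i, (e i).depth u ≤ D) (hs : List (Gate ι')) (v v' : List ℕ)
    (hlen : v.length = v'.length) (hv : v.length + hs.length ≤ b)
    (hvv : ∀ j, v.getD j 0 ≤ D + v'.getD j 0) :
    ∃ z : List ℕ, z.length = v.length + hs.length ∧
      (hs.map (Gate.subst a b e)).foldl (fun ds g => ds ++ [g.depth ds]) (u ++ v) = u ++ z ∧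
      ∀ j, z.getD j 0 ≤ D + (hs.foldl (fun ds g => ds ++ [g.depth ds]) v').getD j 0 := by
  induction hs generalizing v v' with
  | nil => exact ⟨v, by simp, by simp, hvv⟩
  | cons g hs ih =>
    simp only [List.map_cons, List.foldl_cons, List.length_cons] at hv ⊢
    have hg := Gate.depth_subst (e := e) hu (b := b) (by omega) he hvv g
    obtain ⟨z, hz, hz', hz''⟩ := ih (v ++ [(g.subst a b e).depth (u ++ v)]) (v' ++ [g.depth v'])
      (by simp [hlen]) (by simp; omega) (by
        intro j
        rcases lt_trichotomy j v.length with hj | hj | hj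
        · rw [List.getD_append _ _ _ _ hj, List.getD_append _ _ _ _ (by omega)]
          exact hvv j
        · subst hj
          rw [List.getD_append_right _ _ _ _ le_rfl, List.getD_append_right _ _ _ _ (by omega)]
          simpa [hlen] using hg
        · rw [List.getD_eq_default _ _ (by simp; omega)]
          exact Nat.zero_le _)
    refine ⟨z, by simp at hz; omega, ?_, hz''⟩
    rw [List.append_assoc]
    exact hz'

theorem gateDepths_append_subst {b D : ℕ} (e : ι' → Wire ι) (gs : List (Gate ι))
    (hs : List (Gate ι')) (hb : hs.length = b) (he : ∀ i, (e i).depth (gateDepths gs) ≤ D) :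
    ∃ z : List ℕ, z.length = b ∧
      gateDepths (gs ++ hs.map (Gate.subst gs.length b e)) = gateDepths gs ++ z ∧
      ∀ j, z.getD j 0 ≤ D + (gateDepths hs).getD j 0 := by
  obtain ⟨z, h1, h2, h3⟩ := foldl_depth_subst (e := e) (length_gateDepths gs) he hs (b := b) [] []
    rfl (by simp [hb]) (by simp)
  refine ⟨z, by simp [h1, hb], ?_, h3⟩
  rw [gateDepths, List.foldl_append]
  simpa [gateDepths] using h2

end Substitution

/-! ### Functions of bounded circuit complexity -/

/-- `F` is computed by a circuit whose gates have total size at most `s`, and whose outputs have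
depth at most `d`. -/
def Computes {ι o : Type} (s : ℕ) (d : ℕ∞) (F : (ι → Bool) → o → Bool) : Prop :=
  ∃ C : Circuit ι o, C.run = F ∧ (C.gates.map Gate.size).sum ≤ s ∧
    ∀ j, ((C.out j).depth (gateDepths C.gates) : ℕ∞) ≤ d

namespace Computes

variable {ι ι' o o' : Type} {s s' : ℕ} {d d' : ℕ∞}

theorem mono {F : (ι → Bool) → o → Bool} (h : Computes s d F) (hs : s ≤ s') (hd : d ≤ d') :
    Computes s' d' F := by
  obtain ⟨C, h1, h2, h3⟩ := h
  exact ⟨C, h1, h2.trans hs, fun j => (h3 j).trans hd⟩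

theorem untrack {F : (ι → Bool) → o → Bool} (h : Computes s d F) : Computes s ⊤ F :=
  h.mono le_rfl le_top

theorem of_circuit [Fintype o] (C : Circuit ι o) : Computes C.size ⊤ C.run :=
  ⟨C, rfl, Nat.le_add_right _ _, fun _ => le_top⟩

/-- Reconnecting the outputs, without new gates. -/
theorem select {F : (ι → Bool) → o → Bool} (h : Computes s d F) (f : o' → o) :
    Computes s d (fun x j => F x (f j)) := by
  obtain ⟨C, rfl, h2, h3⟩ := h
  exact ⟨⟨C.gates, fun j => C.out (f j)⟩, rfl, h2, fun j => h3 _⟩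

theorem comp {F : (ι → Bool) → ι' → Bool} {G : (ι' → Bool) → o → Bool}
    (hG : Computes s' d' G) (hF : Computes s d F) : Computes (s + s') (d + d') (fun x => G (F x)) := by
  obtain ⟨C, rfl, h2, h3⟩ := hF
  obtain ⟨C', rfl, h2', h3'⟩ := hG
  refine ⟨⟨C.gates ++ C'.gates.map (Gate.subst C.gates.length C'.gates.length C.out),
    fun j => (C'.out j).subst C.gates.length C'.gates.length C.out⟩, ?_, ?_, ?_⟩
  · funext x j
    simp only [Circuit.run]
    rw [gateValues_append_subst _ _ _ _ rfl,
      Wire.value_subst (length_gateValues _ _) (length_gateValues _ _).le]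
    rfl
  · simp only [List.map_append, List.sum_append, List.map_map]
    refine Nat.add_le_add h2 (le_trans (le_of_eq ?_) h2')
    congr 2
    funext g
    exact Gate.size_subst _ _ _ g
  · intro j
    rcases eq_or_ne d ⊤ with rfl | hd
    · simp
    lift d to ℕ using hd
    obtain ⟨z, hz1, hz2, hz3⟩ := gateDepths_append_subst C.out C.gates C'.gates rfl
      (D := d) (fun i => by exact_mod_cast h3 i)
    have := Wire.depth_subst (length_gateDepths C.gates) hz1.le
      (fun i => by exact_mod_cast h3 i) hz3 (C'.out j)
    rw [← hz2] at this
    calc _ ≤ ((d + (C'.out j).depth (gateDepths C'.gates) : ℕ) : ℕ∞) := by exact_mod_cast this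
      _ ≤ _ := by
        push_cast
        gcongr
        exact h3' j

theorem pair {F : (ι → Bool) → o → Bool} {G : (ι → Bool) → o' → Bool}
    (hF : Computes s d F) (hG : Computes s' d G) :
    Computes (s + s') d (fun x => Sum.elim (F x) (G x)) := by
  obtain ⟨C, rfl, h2, h3⟩ := hF
  obtain ⟨C', rfl, h2', h3'⟩ := hG
  have hin : ∀ i : ι, (Wire.input i).depth (gateDepths C.gates) ≤ 0 := fun i => le_rfl
  refine ⟨⟨C.gates ++ C'.gates.map (Gate.subst C.gates.length C'.gates.length .input),
    Sum.elim (fun j => (C.out j).extend C.gates.length C'.gates.length)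
      (fun j => (C'.out j).subst C.gates.length C'.gates.length .input)⟩, ?_, ?_, ?_⟩
  · funext x j
    simp only [Circuit.run]
    rw [gateValues_append_subst _ _ _ _ rfl]
    cases j with
    | inl j => exact Wire.value_extend (length_gateValues _ _) (length_gateValues _ _).le _
    | inr j => exact Wire.value_subst (length_gateValues _ _) (length_gateValues _ _).le _
  · simp only [List.map_append, List.sum_append, List.map_map]
    refine Nat.add_le_add h2 (le_trans (le_of_eq ?_) h2')
    congr 2
    funext g
    exact Gate.size_subst _ _ _ g
  · intro j
    obtain ⟨z, hz1, hz2, hz3⟩ := gateDepths_append_subst (ι' := ι) .input C.gates C'.gates rfl hin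
    dsimp only
    rw [hz2]
    cases j with
    | inl j =>
      rw [Sum.elim_inl, Wire.depth_extend (length_gateDepths _) hz1.le]
      exact h3 j
    | inr j =>
      have := Wire.depth_subst (length_gateDepths C.gates) hz1.le hin hz3 (C'.out j)
      refine le_trans ?_ (h3' j)
      rw [Sum.elim_inr]
      exact_mod_cast this.trans (by simp)

/-! ### Elementary circuits and symmetric functions. -/

/-- Every output is an input or a constant. -/
theorem wires (e : o → ι ⊕ Bool) :
    Computes 2 0 (fun (x : ι → Bool) j => Sum.elim x id (e j)) := by
  -- The only gate refers to itself before it has a value, reads the default 0 and so carries the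
  -- constant 1; the missing gate 1 carries 0.
  refine ⟨⟨[.not (.gate 0)], fun j => Sum.elim Wire.input
    (fun b => if b then .gate 0 else .gate 1) (e j)⟩, ?_, ?_, ?_⟩
  · funext x j
    simp only [Circuit.run]
    rcases e j with i | b
    · rfl
    · cases b <;> simp [Wire.value, gateValues, Gate.value]
  · simp [Gate.size]
  · intro j
    dsimp only
    rcases e j with i | b
    · simp [Wire.depth]
    · cases b <;> simp [Wire.depth, gateDepths, Gate.depth]

/-- Every output is an input. -/
theorem inputs (e : o → ι) : Computes 0 0 (fun (x : ι → Bool) j => x (e j)) :=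
  ⟨⟨[], fun j => .input (e j)⟩, rfl, by simp, fun j => by simp [Wire.depth]⟩

theorem const (c : o → Bool) : Computes 2 0 (fun (_ : ι → Bool) => c) :=
  wires fun j => .inr (c j)

theorem forall_fintype [Fintype ι] :
    Computes (1 + Fintype.card ι) 1 (fun (x : ι → Bool) (_ : Unit) => decide (∀ i, x i = true)) := by
  refine ⟨⟨[.and (Finset.univ.toList.map .input)], fun _ => .gate 0⟩, ?_, ?_, ?_⟩
  · funext x j
    simp only [Circuit.run, Wire.value, gateValues, Gate.value, List.foldl_cons, List.foldl_nil,
      List.nil_append, List.getD_cons_zero]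
    rw [Bool.eq_iff_iff]
    simp
  · simp [Gate.size]
  · intro j
    have : ((Finset.univ : Finset ι).toList.map
        ((fun w => Wire.depth (ι := ι) [] w) ∘ Wire.input)).foldr max 0 ≤ 0 := by
      rw [foldr_max_le_iff]; simp [Wire.depth]
    simp only [Wire.depth, gateDepths, Gate.depth, List.foldl_cons, List.foldl_nil,
      List.nil_append, List.getD_cons_zero, List.map_map]
    exact_mod_cast Nat.add_le_add_left this 1

theorem exists_fintype [Fintype ι] :
    Computes (1 + Fintype.card ι) 1 (fun (x : ι → Bool) (_ : Unit) => decide (∃ i, x i = true)) := by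
  refine ⟨⟨[.or (Finset.univ.toList.map .input)], fun _ => .gate 0⟩, ?_, ?_, ?_⟩
  · funext x j
    simp only [Circuit.run, Wire.value, gateValues, Gate.value, List.foldl_cons, List.foldl_nil,
      List.nil_append, List.getD_cons_zero]
    rw [Bool.eq_iff_iff]
    simp
  · simp [Gate.size]
  · intro j
    have : ((Finset.univ : Finset ι).toList.map
        ((fun w => Wire.depth (ι := ι) [] w) ∘ Wire.input)).foldr max 0 ≤ 0 := by
      rw [foldr_max_le_iff]; simp [Wire.depth]
    simp only [Wire.depth, gateDepths, Gate.depth, List.foldl_cons, List.foldl_nil,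
      List.nil_append, List.getD_cons_zero, List.map_map]
    exact_mod_cast Nat.add_le_add_left this 1

theorem not : Computes 2 0 (fun (x : Unit → Bool) (_ : Unit) => !(x ())) :=
  ⟨⟨[.not (.input ())], fun _ => .gate 0⟩, by
    funext x j; simp [Circuit.run, Wire.value, gateValues, Gate.value], by simp [Gate.size],
    fun j => by simp [Wire.depth, gateDepths, Gate.depth]⟩

theorem family_fin {B : Type} (N : ℕ) {F : (ι → Bool) → Fin N × B → Bool}
    (h : ∀ i, Computes s d (fun x b => F x (i, b))) : Computes (N * s) d F := by
  induction N with
  | zero => exact ⟨⟨[], fun j => j.1.elim0⟩, by funext x j; exact j.1.elim0, by simp,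
      fun j => j.1.elim0⟩
  | succ N ih =>
    have h1 := ih (F := fun x p => F x (p.1.castSucc, p.2)) (fun i => h i.castSucc)
    have h2 := (h1.pair (h (Fin.last N))).select
      (fun p : Fin (N + 1) × B => Fin.lastCases (motive := fun _ => (Fin N × B) ⊕ B)
        (Sum.inr p.2) (fun i => Sum.inl (i, p.2)) p.1)
    convert h2 using 1
    · ring
    · funext x ⟨i, b⟩
      cases i using Fin.lastCases <;> simp

/-- A finite family of functions. -/
theorem family {A B : Type} [Fintype A] {F : (ι → Bool) → A × B → Bool}
    (h : ∀ i, Computes s d (fun x b => F x (i, b))) : Computes (Fintype.card A * s) d F := by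
  have h1 := family_fin (F := fun x (p : Fin (Fintype.card A) × B) =>
    F x ((Fintype.equivFin A).symm p.1, p.2)) (Fintype.card A)
    (fun i => h ((Fintype.equivFin A).symm i))
  simpa using h1.select (fun p : A × B => (Fintype.equivFin A p.1, p.2))

/-- A finite family of Boolean functions. -/
theorem family_unit {A : Type} [Fintype A] {F : (ι → Bool) → A → Bool}
    (h : ∀ i, Computes s d (fun x (_ : Unit) => F x i)) : Computes (Fintype.card A * s) d F :=
  (family (F := fun x (p : A × Unit) => F x p.1) h).select (fun a => (a, ()))

/-- Every literal with a sign of its own. -/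
theorem signs [Fintype ι] (c : ι → Bool) :
    Computes (Fintype.card ι * 2) 0 (fun (x : ι → Bool) i => x i == c i) := by
  refine family_unit (fun i => ?_)
  cases h : c i
  · simpa [h] using (not.comp (inputs (fun _ : Unit => i)))
  · simpa [h] using (inputs (fun _ : Unit => i)).mono (Nat.zero_le 2) le_rfl

theorem congr {F F' : (ι → Bool) → o → Bool} (h : Computes s d F) (hs : s ≤ s') (hd : d ≤ d')
    (hF : ∀ x j, F x j = F' x j) : Computes s' d' F' := by
  obtain rfl : F = F' := by funext x j; exact hF x j
  exact h.mono hs hd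

/-- The test whether the input equals a constant. -/
theorem eq_const [Fintype ι] (c : ι → Bool) :
    Computes (1 + 3 * Fintype.card ι) 1 (fun (x : ι → Bool) (_ : Unit) => decide (x = c)) := by
  have := forall_fintype.comp (signs c)
  refine this.congr (by omega) (by simp) (fun x j => ?_)
  simp [funext_iff]

/-- Every Boolean function has a circuit in disjunctive normal form. -/
theorem of_fun [Fintype ι] (f : (ι → Bool) → Bool) :
    Computes (2 ^ Fintype.card ι * (3 * Fintype.card ι + 3)) ⊤
      (fun (x : ι → Bool) (_ : Unit) => f x) := by
  classical
  have h1 := family_unit (F := fun (x : ι → Bool) (v : {v : ι → Bool // f v = true}) =>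
    decide (x = v)) (fun v => eq_const v.1)
  have hc : Fintype.card {v : ι → Bool // f v = true} ≤ 2 ^ Fintype.card ι := by
    refine (Fintype.card_subtype_le _).trans (by simp)
  have hp : 1 ≤ 2 ^ Fintype.card ι := Nat.one_le_two_pow
  refine (exists_fintype.comp h1).congr ?_ le_top (fun x j => ?_)
  · calc _ ≤ 2 ^ Fintype.card ι * (1 + 3 * Fintype.card ι) +
        (2 ^ Fintype.card ι + 2 ^ Fintype.card ι) := by gcongr
      _ = _ := by ring
  · simp

/-- Unary counters. -/
theorem counter (N T : ℕ) :
    Computes (N * (T * 96) + 2) ⊤ (fun (x : Fin N → Bool) (c : Fin T) =>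
      decide (c.1 ≤ (Finset.univ.filter fun i => x i = true).card)) := by
  induction N with
  | zero =>
    refine (const (fun c : Fin T => decide (c.1 = 0))).congr (by simp) le_top (fun x c => ?_)
    simp
  | succ N ih =>
    have h1 := (ih.comp (inputs (Fin.castSucc (n := N)))).pair
      ((inputs (fun _ : Unit => Fin.last N)).untrack)
    -- The count reaches `c` iff `c = 0`, or it did so before the last bit, or it had reached `c -
    -- 1` and the last bit is set. Truncation of `c - 1` is harmless since `c = 0` is treated apart.
    -- The constant 96 is the cost `2 ^ 3 * (3 * 3 + 3)` of a truth table on three bits.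
    let sel : Fin T → Fin 3 → Fin T ⊕ Unit := fun c i =>
      if i = 0 then .inl c else if i = 1 then .inl ⟨c.1 - 1, by omega⟩ else .inr ()
    have h2 := family_unit (F := fun (y : Fin T ⊕ Unit → Bool) (c : Fin T) =>
        decide (c.1 = 0) || (y (sel c 0) || (y (sel c 1) && y (sel c 2)))) (fun c =>
      ((of_fun (fun z : Fin 3 → Bool => decide (c.1 = 0) || (z 0 || (z 1 && z 2)))).comp
        (inputs (sel c))))
    refine (h2.comp h1).congr ?_ le_top (fun x c => ?_)
    · simp only [Fintype.card_fin]
      ring_nf; omega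
    · have hcard : (Finset.univ.filter fun i : Fin (N + 1) => x i = true).card =
          (Finset.univ.filter fun i : Fin N => x i.castSucc = true).card +
            (if x (Fin.last N) = true then 1 else 0) := by
        simp only [Finset.card_filter, Fin.sum_univ_castSucc]
      rw [Bool.eq_iff_iff]
      simp only [sel, if_true, if_false, Fin.reduceEq, one_ne_zero, Sum.elim_inl, Sum.elim_inr,
        Bool.or_eq_true, decide_eq_true_eq, Bool.and_eq_true]
      rw [hcard]
      split_ifs with hx <;> simp only [hx] <;> simp <;> omega

/-- Every symmetric function has a small circuit. -/
theorem symmetric_fin (N : ℕ) (f : ℕ → Bool) :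
    Computes (200 * (N + 2) ^ 2) ⊤ (fun (x : Fin N → Bool) (_ : Unit) =>
      f (Finset.univ.filter fun i => x i = true).card) := by
  have h1 := counter N (N + 2)
  -- The count equals `t` iff threshold `t` is reached and threshold `t + 1` is not; hence
  -- thresholds up to `N + 1` are needed.
  let sel : Fin (N + 1) → Bool → Fin (N + 2) := fun t b => if b then t.castSucc else t.succ
  have h2 := family_unit (F := fun (y : Fin (N + 2) → Bool) (t : Fin (N + 1)) =>
      f t.1 && (y (sel t true) && !(y (sel t false)))) (fun t =>
    ((of_fun (fun z : Bool → Bool => f t.1 && (z true && !(z false)))).comp (inputs (sel t))))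
  refine (exists_fintype.comp (h2.comp h1)).congr ?_ le_top (fun x c => ?_)
  · simp only [Fintype.card_fin, Fintype.card_bool]
    nlinarith
  · rw [Bool.eq_iff_iff]
    simp only [sel, if_true, if_false, Bool.false_eq_true, Fin.val_castSucc, Fin.val_succ,
      Bool.and_eq_true, Bool.not_eq_true', decide_eq_false_iff_not, decide_eq_true_eq]
    constructor
    · rintro ⟨t, h, h1, h2⟩
      rwa [show (Finset.univ.filter fun i => x i = true).card = t.1 by omega]
    · intro h
      have := Finset.card_filter_le (Finset.univ : Finset (Fin N)) (fun i => x i = true)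
      simp only [Finset.card_univ, Fintype.card_fin] at this
      exact ⟨⟨(Finset.univ.filter fun i => x i = true).card, Nat.lt_succ_of_le this⟩, h, le_rfl,
        Nat.not_succ_le_self _⟩

theorem symmetric [Fintype ι] (f : ℕ → Bool) :
    Computes (200 * (Fintype.card ι + 2) ^ 2) ⊤ (fun (x : ι → Bool) (_ : Unit) =>
      f (Finset.univ.filter fun i => x i = true).card) := by
  refine ((symmetric_fin (Fintype.card ι) f).comp
    (inputs (Fintype.equivFin ι).symm)).congr (by simp) le_top (fun x c => ?_)
  congr 1
  refine Finset.card_bij (fun i _ => (Fintype.equivFin ι).symm i) (by simp) (by simp) ?_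
  intro i hi
  exact ⟨Fintype.equivFin ι i, by simpa using hi, by simp⟩

/-- A circuit that computes a function of bounded complexity. -/
noncomputable def circuit {F : (ι → Bool) → o → Bool} (h : Computes s d F) : Circuit ι o :=
  h.choose

theorem run_circuit {F : (ι → Bool) → o → Bool} (h : Computes s d F) : h.circuit.run = F :=
  h.choose_spec.1

theorem size_circuit [Fintype o] {F : (ι → Bool) → o → Bool} (h : Computes s d F) :
    h.circuit.size ≤ s + Fintype.card o :=
  Nat.add_le_add_right h.choose_spec.2.1 _

theorem depth_circuit [Fintype o] {n : ℕ} {F : (ι → Bool) → o → Bool} (h : Computes s n F) :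
    h.circuit.depth ≤ n :=
  Finset.sup_le fun j _ => Nat.cast_le.1 (h.choose_spec.2.2 j)

end Computes
end TraitorTracing

namespace TraitorTracing

/-! ### The distribution of the columns of the fingerprinting code -/

/-- Classify the subsets of `{0, …, M - 1}` of size `a + b + 1` by the element `r` that has exactly
`a` smaller ones. -/
theorem sum_choose_mul_choose (M a b : ℕ) :
    ∑ r ∈ Finset.range M, r.choose a * (M - 1 - r).choose b = M.choose (a + b + 1) := by
  induction M generalizing a b with
  | zero => simp
  | succ M ih =>
    cases b with
    | zero =>
      have := ih a 0
      simp only [Nat.choose_zero_right, mul_one, add_zero] at this ⊢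
      rw [Finset.sum_range_succ, this, Nat.choose_succ_succ, add_comm]
    | succ b =>
      rw [Finset.sum_range_succ]
      have h1 : ∀ r ∈ Finset.range M, r.choose a * (M + 1 - 1 - r).choose (b + 1) =
          r.choose a * (M - 1 - r).choose b + r.choose a * (M - 1 - r).choose (b + 1) := by
        intro r hr
        rw [Finset.mem_range] at hr
        rw [show M + 1 - 1 - r = (M - 1 - r) + 1 by omega, Nat.choose_succ_succ]
        ring
      rw [Finset.sum_congr rfl h1, Finset.sum_add_distrib, ih, ih]
      rw [show a + (b + 1) + 1 = (a + b + 1) + 1 by ring, Nat.choose_succ_succ M]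
      simp

/-- The number of sequences `r, r_1, …, r_n < M` such that `r_i < r` exactly for the `i` in a given
set of `t` indices. -/
def columnCount (n M t : ℕ) : ℕ := ∑ r ∈ Finset.range M, r ^ t * (M - r) ^ (n - t)

theorem sum_choose_mul_columnCount (n M : ℕ) :
    ∑ t ∈ Finset.range (n + 1), n.choose t * columnCount n M t = M ^ (n + 1) := by
  simp only [columnCount, Finset.mul_sum]
  rw [Finset.sum_comm]
  have : ∀ r ∈ Finset.range M,
      ∑ t ∈ Finset.range (n + 1), n.choose t * (r ^ t * (M - r) ^ (n - t)) = M ^ n := by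
    intro r hr
    rw [Finset.mem_range] at hr
    have := add_pow r (M - r) n
    rw [show r + (M - r) = M by omega] at this
    rw [this]
    exact Finset.sum_congr rfl fun t _ => by rw [Nat.cast_id]; ring
  rw [Finset.sum_congr rfl this]
  simp [pow_succ, mul_comm]

/-- A discrete beta integral: replacing powers by falling factorials turns the sum over `r` into
`sum_choose_mul_choose`, and the resulting lower bound no longer depends on `t`. -/
theorem factorial_mul_choose_le (n M t : ℕ) (ht : t ≤ n) :
    n.factorial * M.choose (n + 1) ≤ n.choose t * columnCount n M t := by
  have h := sum_choose_mul_choose M t (n - t)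
  rw [show t + (n - t) + 1 = n + 1 by omega] at h
  rw [← h, columnCount, Finset.mul_sum, Finset.mul_sum]
  refine Finset.sum_le_sum fun r _ => ?_
  have h1 : t.factorial * r.choose t ≤ r ^ t := by
    rw [← Nat.descFactorial_eq_factorial_mul_choose]; exact Nat.descFactorial_le_pow _ _
  have h2 : (n - t).factorial * (M - 1 - r).choose (n - t) ≤ (M - r) ^ (n - t) := by
    rw [← Nat.descFactorial_eq_factorial_mul_choose]
    exact (Nat.descFactorial_le_pow _ _).trans (Nat.pow_le_pow_left (by omega) _)
  calc n.factorial * (r.choose t * (M - 1 - r).choose (n - t))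
      = n.choose t * ((t.factorial * r.choose t) *
          ((n - t).factorial * (M - 1 - r).choose (n - t))) := by
        rw [← Nat.choose_mul_factorial_mul_factorial ht]; ring
    _ ≤ _ := by gcongr

/-- The probability of a given column with `t` ones. -/
noncomputable def columnProb (n M t : ℕ) : ℝ := columnCount n M t / (M : ℝ) ^ (n + 1)

/-- The probability that a column has `t` ones. -/
noncomputable def weightProb (n M t : ℕ) : ℝ := n.choose t * columnProb n M t

theorem columnProb_nonneg (n M t : ℕ) : 0 ≤ columnProb n M t := by unfold columnProb; positivity

theorem sum_weightProb (n M : ℕ) (hM : 0 < M) :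
    ∑ t ∈ Finset.range (n + 1), weightProb n M t = 1 := by
  have h := sum_choose_mul_columnCount n M
  simp only [weightProb, columnProb, ← mul_div_assoc]
  rw [← Finset.sum_div, div_eq_one_iff_eq (by positivity)]
  exact_mod_cast h

/-- With a continuous bias the weight would be exactly uniform on `n + 1` values. Discretizing the
bias to `M` levels costs a factor `(1 - n / M) ^ (n + 1)`, which is at least 1/2 by Bernoulli's
inequality. -/
theorem le_weightProb (n M t : ℕ) (ht : t ≤ n) (hM0 : 0 < M) (hM : 2 * n * (n + 1) ≤ M) :
    1 / (2 * (n + 1 : ℝ)) ≤ weightProb n M t := by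
  have h1 := factorial_mul_choose_le n M t ht
  have h2 := Nat.pow_sub_le_descFactorial M (n + 1)
  rw [Nat.descFactorial_eq_factorial_mul_choose, Nat.factorial_succ, mul_assoc] at h2
  have h3 : (M - n) ^ (n + 1) ≤ (n + 1) * (n.choose t * columnCount n M t) := by
    refine le_trans ?_ (h2.trans (Nat.mul_le_mul_left _ h1))
    exact Nat.pow_le_pow_left (by omega) _
  have hn : n ≤ M := by nlinarith
  have h3' : ((M : ℝ) - n) ^ (n + 1) ≤ (n + 1) * (n.choose t * columnCount n M t) := by
    have : (((M - n) ^ (n + 1) : ℕ) : ℝ) ≤ (((n + 1) * (n.choose t * columnCount n M t) : ℕ) : ℝ) :=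
      by exact_mod_cast h3
    push_cast [Nat.cast_sub hn] at this
    exact this
  have hM' : (0 : ℝ) < M := by exact_mod_cast hM0
  have hMr : 2 * (n : ℝ) * (n + 1) ≤ M := by exact_mod_cast hM
  have h4 : (1 : ℝ) / 2 ≤ ((M - n) / M) ^ (n + 1) := by
    have hb := one_add_mul_le_pow (a := -((n : ℝ) / M)) (by
      have : (n : ℝ) / M ≤ 1 := by rw [div_le_one hM']; exact_mod_cast hn
      linarith) (n + 1)
    rw [show (M - n : ℝ) / M = 1 + -((n : ℝ) / M) by field_simp; ring]
    refine le_trans ?_ hb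
    have : (n : ℝ) / M * (n + 1) ≤ 1 / 2 := by
      rw [div_mul_eq_mul_div, div_le_iff₀ hM']; linarith
    push_cast
    linarith
  rw [weightProb, columnProb, ← mul_div_assoc, div_le_div_iff₀ (by positivity) (by positivity)]
  rw [div_pow, le_div_iff₀ (by positivity)] at h4
  nlinarith

/-- The ideal weight in the accusation scores of a column with `t` ones. -/
noncomputable def idealWeight (n M t : ℕ) : ℝ :=
  if 0 < t ∧ t < n then (n * (n - 1)) / (weightProb n M t * (t * (n - t))) else 0

/-- The weight in the accusation scores of a column with `t` ones. -/
noncomputable def scoreWeight (n M t : ℕ) : ℕ := ⌊idealWeight n M t⌋₊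

/-- Rounding makes the scores integers, which a circuit can compare by counting; the loss of up to
one per weight is paid for in `sum_momentBound_le`. -/
theorem idealWeight_le_scoreWeight_add_one (n M t : ℕ) : idealWeight n M t ≤ scoreWeight n M t + 1 :=
  (Nat.lt_floor_add_one _).le

/-- Passes from the weight `s` of the other users' bits to the weight of the whole column when the
distinguished user has bit 0, an event of conditional probability `(n - t) / n` given weight `t`. -/
theorem sum_choose_mul_left {n : ℕ} (hn : 2 ≤ n) (f : ℕ → ℝ) :
    ∑ s ∈ Finset.range n, (n - 1).choose s * f s =
      ∑ t ∈ Finset.range (n + 1), n.choose t * ((n - t) / n * f t) := by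
  have hn0 : (n : ℝ) ≠ 0 := by positivity
  rw [Finset.sum_range_succ]
  simp only [sub_self, zero_div, zero_mul, mul_zero, add_zero]
  refine Finset.sum_congr rfl fun s hs => ?_
  have hs := (Finset.mem_range.1 hs).le
  have := Nat.choose_mul_succ_eq (n - 1) s
  rw [show n - 1 + 1 = n by omega] at this
  have h := congrArg (Nat.cast (R := ℝ)) this
  push_cast [Nat.cast_sub hs] at h
  field_simp
  linear_combination f s * h

/-- The counterpart for bit 1, which has conditional probability `t / n` and raises the weight to `s
+ 1`. -/
theorem sum_choose_mul_right {n : ℕ} (hn : 2 ≤ n) (g : ℕ → ℝ) :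
    ∑ s ∈ Finset.range n, (n - 1).choose s * g (s + 1) =
      ∑ t ∈ Finset.range (n + 1), n.choose t * (t / n * g t) := by
  have hn0 : (n : ℝ) ≠ 0 := by positivity
  rw [Finset.sum_range_succ']
  simp only [Nat.cast_zero, zero_div, zero_mul, mul_zero, add_zero]
  refine Finset.sum_congr rfl fun s hs => ?_
  have := Nat.add_one_mul_choose_eq (n - 1) s
  rw [show n - 1 + 1 = n by omega] at this
  have h := congrArg (Nat.cast (R := ℝ)) this
  push_cast at h ⊢
  field_simp
  linear_combination g (s + 1) * h

/-! ### Mean and variance of an innocent user's score in one column. -/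

section Moments

variable {n M : ℕ} (hn : 2 ≤ n) (hM : 2 * n * (n + 1) ≤ M)
include hn hM

theorem weightProb_pos {t : ℕ} (ht : t ≤ n) : 0 < weightProb n M t :=
  lt_of_lt_of_le (by positivity) (le_weightProb n M t ht (by nlinarith) hM)

theorem idealWeight_nonneg (t : ℕ) : 0 ≤ idealWeight n M t := by
  unfold idealWeight
  split_ifs with h
  · have := weightProb_pos hn hM h.2.le
    have h1 : (t : ℝ) < n := by exact_mod_cast h.2
    have h2 : (2 : ℝ) ≤ n := by exact_mod_cast hn
    have : (0 : ℝ) ≤ n - t := by linarith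
    have : (0 : ℝ) ≤ n - 1 := by linarith
    positivity
  · exact le_rfl

theorem scoreWeight_le_idealWeight (t : ℕ) : (scoreWeight n M t : ℝ) ≤ idealWeight n M t :=
  Nat.floor_le (idealWeight_nonneg hn hM t)

/-- Bounds the upward jumps of a score, so that after scaling by `l` they are at most 1 and the
quadratic bound on the exponential applies. Downward jumps need no bound. -/
theorem idealWeight_mul_le {t : ℕ} (ht : 0 < t) : (n - t : ℝ) * idealWeight n M t ≤
    4 * n ^ 2 * (n - 1) := by
  have h2 : (2 : ℝ) ≤ n := by exact_mod_cast hn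
  unfold idealWeight
  split_ifs with h
  · have h0 := weightProb_pos hn hM h.2.le
    have hw := le_weightProb n M t h.2.le (by nlinarith) hM
    have h1 : (t : ℝ) < n := by exact_mod_cast h.2
    have h3 : (1 : ℝ) ≤ t := by exact_mod_cast ht
    have h4 : (0 : ℝ) < n - t := by linarith
    have h5 : (0 : ℝ) < n - 1 := by linarith
    rw [show (n - t : ℝ) * (n * (n - 1) / (weightProb n M t * (t * (n - t)))) =
      n * (n - 1) / (weightProb n M t * t) by field_simp]
    rw [div_le_iff₀ (by positivity)]
    have h6 : 1 ≤ 4 * n * (weightProb n M t * t) := by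
      rw [div_le_iff₀ (by positivity)] at hw
      have : weightProb n M t * (2 * (n + 1)) ≤ weightProb n M t * t * (4 * n) := by
        rw [mul_assoc]
        apply mul_le_mul_of_nonneg_left _ h0.le
        nlinarith
      linarith
    calc n * (n - 1 : ℝ) = n * (n - 1) * 1 := by ring
      _ ≤ n * (n - 1) * (4 * n * (weightProb n M t * t)) :=
        mul_le_mul_of_nonneg_left h6 (by positivity)
      _ = _ := by ring
  · have : (0 : ℝ) ≤ n - 1 := by linarith
    simp; positivity

theorem scoreWeight_le (t : ℕ) : scoreWeight n M t ≤ 4 * n ^ 3 := by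
  by_cases h : 0 < t ∧ t < n
  · have h1 := idealWeight_mul_le hn hM h.1
    have h2 := scoreWeight_le_idealWeight hn hM t
    have h3 := idealWeight_nonneg hn hM t
    have h4 : (1 : ℝ) ≤ n - t := by
      have : ((t + 1 : ℕ) : ℝ) ≤ n := by exact_mod_cast h.2
      push_cast at this; linarith
    have h5 : (2 : ℝ) ≤ n := by exact_mod_cast hn
    have : (scoreWeight n M t : ℝ) ≤ 4 * n ^ 3 := by nlinarith
    exact_mod_cast this
  · simp [scoreWeight, idealWeight, h]

/-- The left side is the expected loss of a user with bit 0 when the others have a given pattern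
with `s` ones. The weight was chosen to make it the same as the expected gain in
`sub_mul_idealWeight_mul_columnProb`. -/
theorem mul_idealWeight_mul_columnProb {s : ℕ} (hs : 0 < s) (hs' : s < n) :
    s * idealWeight n M s * columnProb n M s = (n - 1) / (n - 1).choose s := by
  have h0 := weightProb_pos hn hM hs'.le
  have h1 : (s : ℝ) < n := by exact_mod_cast hs'
  have h2 : (0 : ℝ) < n - s := by linarith
  have h3 : (0 : ℝ) < s := by exact_mod_cast hs
  have hc : (0 : ℝ) < n.choose s := by exact_mod_cast Nat.choose_pos hs'.le
  have hc' : (0 : ℝ) < (n - 1).choose s := by exact_mod_cast Nat.choose_pos (by omega)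
  have hcc : (n : ℝ) * (n - 1).choose s = n.choose s * (n - s) := by
    have := Nat.choose_mul_succ_eq (n - 1) s
    rw [show n - 1 + 1 = n by omega] at this
    rw [mul_comm]
    have h := congrArg (Nat.cast (R := ℝ)) this
    push_cast [Nat.cast_sub hs'.le] at h
    exact h
  rw [idealWeight, if_pos ⟨hs, hs'⟩]
  unfold weightProb at h0 ⊢
  have hp : 0 < columnProb n M s := by
    by_contra h
    have := columnProb_nonneg n M s
    rw [le_antisymm (not_lt.1 h) this] at h0
    simp at h0
  field_simp
  linear_combination (n - 1 : ℝ) * hcc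

/-- The expected gain of the same user with bit 1. It fails for `s + 1 = n`, where the column is all
ones and has weight zero; this asymmetry is the whole drift. -/
theorem sub_mul_idealWeight_mul_columnProb {s : ℕ} (hs' : s + 1 < n) :
    (n - (s + 1 : ℕ)) * idealWeight n M (s + 1) * columnProb n M (s + 1) =
      (n - 1) / (n - 1).choose s := by
  have h := mul_idealWeight_mul_columnProb hn hM (Nat.succ_pos s) hs'
  have hc : (0 : ℝ) < (n - 1).choose s := by exact_mod_cast Nat.choose_pos (by omega)
  have hc' : (0 : ℝ) < (n - 1).choose (s + 1) := by exact_mod_cast Nat.choose_pos (by omega)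
  have hcc : ((n - 1).choose (s + 1) : ℝ) * (s + 1 : ℕ) = (n - 1).choose s * (n - (s + 1 : ℕ)) := by
    have := Nat.choose_succ_right_eq (n - 1) s
    rw [show n - 1 - s = n - (s + 1) by omega] at this
    have h := congrArg (Nat.cast (R := ℝ)) this
    rw [Nat.cast_mul, Nat.cast_mul, Nat.cast_sub hs'.le] at h
    exact h
  rw [eq_div_iff hc'.ne'] at h
  rw [eq_div_iff hc.ne', ← h]
  simp only [Nat.succ_eq_add_one]
  linear_combination -(idealWeight n M (s + 1) * columnProb n M (s + 1)) * hcc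

/-- A bound on the exponential moment of the score of a user in a column, restricted to a choice of
the bits of the other users with `s` ones. -/
noncomputable def momentBound (n M : ℕ) (l : ℝ) (s : ℕ) : ℝ :=
  columnProb n M s + columnProb n M (s + 1) + l * (columnProb n M s * s) +
    l ^ 2 * (columnProb n M s * (s * idealWeight n M s) ^ 2 +
      columnProb n M (s + 1) * ((n - (s + 1 : ℕ)) * idealWeight n M (s + 1)) ^ 2) -
    if s + 1 = n then l * (n - 1) else 0

/-- Expand the exponential to second order in `l`. The answer 0 leaves the score unchanged; for the
answer 1 the linear terms cancel up to rounding, unless all other bits are 1. The hypotheses `h0`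
and `h1` are the marking condition. -/
theorem moment_le {l : ℝ} (hl : 0 ≤ l) (hl' : l * (4 * n ^ 2 * (n - 1)) ≤ 1) {s : ℕ} (hs : s < n)
    (b : Bool) (h0 : s = 0 → b = false) (h1 : s + 1 = n → b = true) :
    columnProb n M s * (if b then Real.exp (l * (scoreWeight n M s * (0 - s))) else 1) +
      columnProb n M (s + 1) *
        (if b then Real.exp (l * (scoreWeight n M (s + 1) * (n - (s + 1 : ℕ)))) else 1) ≤
      momentBound n M l s := by
  have hp := columnProb_nonneg n M s
  have hp' := columnProb_nonneg n M (s + 1)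
  cases b with
  | false =>
    have : s + 1 ≠ n := fun h => by simpa using h1 h
    simp only [momentBound, this, if_false, Bool.false_eq_true, mul_one, sub_zero]
    have : 0 ≤ l * (columnProb n M s * s) := by positivity
    have : 0 ≤ l ^ 2 * (columnProb n M s * (s * idealWeight n M s) ^ 2 +
      columnProb n M (s + 1) * ((n - (s + 1 : ℕ)) * idealWeight n M (s + 1)) ^ 2) := by positivity
    linarith
  | true =>
    have hs0 : 0 < s := by
      rcases Nat.eq_zero_or_pos s with h | h
      · simpa using h0 h
      · exact h
    -- No lower bound on `z` is needed: below -1 the left side is at most 1 while `z + z ^ 2` is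
    -- positive.
    have hexp : ∀ z : ℝ, z ≤ 1 → Real.exp z ≤ 1 + z + z ^ 2 := by
      intro z hz
      rcases le_or_gt (-1) z with h | h
      · have := Real.abs_exp_sub_one_sub_id_le (x := z) (abs_le.2 ⟨h, hz⟩)
        rw [abs_le] at this
        linarith [this.2]
      · have : Real.exp z ≤ 1 := Real.exp_le_one_iff.2 (by linarith)
        nlinarith
    have hx := scoreWeight_le_idealWeight hn hM s
    have hx1 := idealWeight_le_scoreWeight_add_one n M s
    have hx' := scoreWeight_le_idealWeight hn hM (s + 1)
    have hns : (0 : ℝ) ≤ n - (s + 1 : ℕ) := by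
      have : ((s + 1 : ℕ) : ℝ) ≤ n := by exact_mod_cast hs
      linarith
    have hz := idealWeight_mul_le hn hM (Nat.succ_pos s)
    have e0 := mul_idealWeight_mul_columnProb hn hM hs0 hs
    have b0 : Real.exp (l * (scoreWeight n M s * (0 - s))) ≤
        1 + l * s - l * (s * idealWeight n M s) + l ^ 2 * (s * idealWeight n M s) ^ 2 := by
      refine (hexp _ ?_).trans ?_
      · have : 0 ≤ l * (scoreWeight n M s * s) := by positivity
        nlinarith
      · have h1 : (s : ℝ) * scoreWeight n M s ≤ s * idealWeight n M s := by gcongr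
        have h2 : ((s : ℝ) * scoreWeight n M s) ^ 2 ≤ (s * idealWeight n M s) ^ 2 := by gcongr
        have h3 : l * (s * idealWeight n M s) ≤ l * (s * (scoreWeight n M s + 1)) := by gcongr
        have h4 := mul_le_mul_of_nonneg_left h2 (sq_nonneg l)
        nlinarith
    have b1 : Real.exp (l * (scoreWeight n M (s + 1) * (n - (s + 1 : ℕ)))) ≤
        1 + l * ((n - (s + 1 : ℕ)) * idealWeight n M (s + 1)) +
          l ^ 2 * ((n - (s + 1 : ℕ)) * idealWeight n M (s + 1)) ^ 2 := by
      have h1 : (scoreWeight n M (s + 1) : ℝ) * (n - (s + 1 : ℕ)) ≤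
          (n - (s + 1 : ℕ)) * idealWeight n M (s + 1) := by
        rw [mul_comm]; gcongr
      refine (hexp _ ?_).trans ?_
      · refine le_trans ?_ hl'
        exact mul_le_mul_of_nonneg_left (h1.trans hz) hl
      · have h0 : 0 ≤ (scoreWeight n M (s + 1) : ℝ) * (n - (s + 1 : ℕ)) := by positivity
        have := mul_le_mul_of_nonneg_left (pow_le_pow_left₀ h0 h1 2) (sq_nonneg l)
        have := mul_le_mul_of_nonneg_left h1 hl
        nlinarith
    have c0 := mul_le_mul_of_nonneg_left b0 hp
    have c1 := mul_le_mul_of_nonneg_left b1 hp'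
    simp only [if_true]
    refine (add_le_add c0 c1).trans ?_
    simp only [momentBound]
    by_cases hsn : s + 1 = n
    · rw [if_pos hsn]
      -- With bit 1 the column is constant and scores nothing, so the loss for bit 0 remains
      -- uncompensated.
      have : idealWeight n M (s + 1) = 0 := by simp [idealWeight, hsn]
      rw [this]
      rw [show n - 1 = s by omega, Nat.choose_self, Nat.cast_one, div_one] at e0
      have : l * _ = l * _ := congrArg (fun z => l * z) e0
      nlinarith
    · rw [if_neg hsn]
      have e1 := sub_mul_idealWeight_mul_columnProb hn hM (s := s) (by omega)
      -- Expected loss and expected gain agree, so the linear terms in the ideal weights cancel.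
      have : l * _ = l * _ := congrArg (fun z => l * z) (e0.trans e1.symm)
      nlinarith

/-- By the choice of the weights each summand is `n² (n - 1)²` divided by `weightProb * t * (n -
t)`. With near-uniform weights and partial fractions this becomes a harmonic sum, the source of the
logarithm in `1 + Real.log n`. -/
theorem sum_variance_le : ∑ t ∈ Finset.range (n + 1),
    weightProb n M t * (t * (n - t) * idealWeight n M t ^ 2) ≤
      8 * n ^ 2 * (n - 1) ^ 2 * (1 + Real.log n) := by
  have h2 : (2 : ℝ) ≤ n := by exact_mod_cast hn
  have key : ∀ t ∈ Finset.range (n + 1), weightProb n M t * (t * (n - t) * idealWeight n M t ^ 2) ≤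
      if 0 < t ∧ t < n then 2 * (n + 1) * n * (n - 1) ^ 2 * ((t : ℝ)⁻¹ + ((n - t : ℕ) : ℝ)⁻¹)
      else 0 := by
    intro t _
    unfold idealWeight
    split_ifs with h
    · have h0 := weightProb_pos hn hM h.2.le
      have hw := le_weightProb n M t h.2.le (by nlinarith) hM
      have h1 : (t : ℝ) < n := by exact_mod_cast h.2
      have h3 : (0 : ℝ) < t := by exact_mod_cast h.1
      rw [Nat.cast_sub h.2.le]
      have h4 : (0 : ℝ) < n - t := by linarith
      have h5 : (0 : ℝ) < n - 1 := by linarith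
      rw [show weightProb n M t * (t * (n - t) *
          (n * (n - 1) / (weightProb n M t * (t * (n - t)))) ^ 2) =
          (n ^ 2 * (n - 1) ^ 2 / (t * (n - t))) * (1 / weightProb n M t) by field_simp]
      rw [show 2 * (n + 1) * n * (n - 1 : ℝ) ^ 2 * ((t : ℝ)⁻¹ + (n - t : ℝ)⁻¹) =
        (n ^ 2 * (n - 1) ^ 2 / (t * (n - t))) * (2 * (n + 1)) by field_simp; ring]
      apply mul_le_mul_of_nonneg_left _ (by positivity)
      rw [div_le_iff₀ h0]
      rw [div_le_iff₀ (by positivity)] at hw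
      linarith
    · simp
  refine (Finset.sum_le_sum key).trans ?_
  rw [← Finset.sum_filter]
  have hf : (Finset.range (n + 1)).filter (fun t => 0 < t ∧ t < n) = Finset.Ioo 0 n := by
    ext t; simp; omega
  rw [hf, ← Finset.mul_sum, Finset.sum_add_distrib]
  have hr : ∑ t ∈ Finset.Ioo 0 n, ((n - t : ℕ) : ℝ)⁻¹ = ∑ t ∈ Finset.Ioo 0 n, (t : ℝ)⁻¹ := by
    refine Finset.sum_bij' (fun t _ => n - t) (fun t _ => n - t) ?_ ?_ ?_ ?_ ?_ <;>
      simp <;> intros <;> omega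
  have hh : ∑ t ∈ Finset.Ioo 0 n, (t : ℝ)⁻¹ ≤ 1 + Real.log n := by
    refine le_trans ?_ (harmonic_le_one_add_log n)
    rw [harmonic_eq_sum_Icc]
    push_cast
    refine Finset.sum_le_sum_of_subset_of_nonneg ?_ (fun _ _ _ => by positivity)
    intro t ht
    simp at ht ⊢; omega
  rw [hr]
  have hlog : 0 ≤ 1 + Real.log n := by have := Real.log_nonneg (x := n) (by linarith); linarith
  calc _ ≤ 2 * (n + n : ℝ) * n * (n - 1) ^ 2 * ((1 + Real.log n) + (1 + Real.log n)) := by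
        gcongr
        linarith
    _ = _ := by ring

/-- Summed over all patterns of the other users, the probabilities add up to 1, the rounding errors
contribute at most `l * (n / 4)`, and the drift `-l * (n - 1)` comes from the all-ones pattern
alone. -/
theorem sum_momentBound_le {l : ℝ} (hl : 0 ≤ l) :
    ∑ s ∈ Finset.range n, (n - 1).choose s * momentBound n M l s ≤
      1 + l * (n / 4) + l ^ 2 * (8 * n ^ 2 * (n - 1) ^ 2 * (1 + Real.log n)) - l * (n - 1) := by
  have hn0 : (n : ℝ) ≠ 0 := by positivity
  have hlast : ∑ s ∈ Finset.range n, ((n - 1).choose s : ℝ) *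
      (if s + 1 = n then l * (n - 1 : ℝ) else 0) = l * (n - 1) := by
    rw [Finset.sum_eq_single (n - 1)]
    · rw [if_pos (by omega)]; simp
    · intro s _ hs; rw [if_neg (by omega), mul_zero]
    · intro h; simp at h; omega
  have hsplit : ∑ s ∈ Finset.range n, (n - 1).choose s * momentBound n M l s =
      ∑ s ∈ Finset.range n, (n - 1).choose s * (columnProb n M s + l * (columnProb n M s * s) +
        l ^ 2 * (columnProb n M s * (s * idealWeight n M s) ^ 2)) +
      ∑ s ∈ Finset.range n, (n - 1).choose s * (columnProb n M (s + 1) +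
        l ^ 2 * (columnProb n M (s + 1) * ((n - (s + 1 : ℕ)) * idealWeight n M (s + 1)) ^ 2)) -
      l * (n - 1) := by
    rw [← hlast, ← Finset.sum_add_distrib, ← Finset.sum_sub_distrib]
    refine Finset.sum_congr rfl fun s _ => ?_
    unfold momentBound
    ring
  rw [hsplit, sum_choose_mul_left hn (fun s => columnProb n M s + l * (columnProb n M s * s) +
    l ^ 2 * (columnProb n M s * (s * idealWeight n M s) ^ 2)),
    sum_choose_mul_right hn (fun t => columnProb n M t +
      l ^ 2 * (columnProb n M t * ((n - (t : ℕ)) * idealWeight n M t) ^ 2)),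
    ← Finset.sum_add_distrib]
  have hterm : ∀ t ∈ Finset.range (n + 1),
      n.choose t * ((n - t) / n * (columnProb n M t + l * (columnProb n M t * t) +
        l ^ 2 * (columnProb n M t * (t * idealWeight n M t) ^ 2))) +
      n.choose t * (t / n * (columnProb n M t +
        l ^ 2 * (columnProb n M t * ((n - (t : ℕ)) * idealWeight n M t) ^ 2))) ≤
      weightProb n M t * (1 + l * (n / 4)) +
        l ^ 2 * (weightProb n M t * (t * (n - t) * idealWeight n M t ^ 2)) := by
    intro t ht
    have ht := Nat.lt_succ_iff.1 (Finset.mem_range.1 ht)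
    have h0 := (weightProb_pos hn hM ht).le
    -- The inequality of arithmetic and geometric means for `t` and `n - t`; this is the rounding
    -- error.
    have h1 : (n - t : ℝ) / n * t ≤ n / 4 := by
      rw [div_mul_eq_mul_div, div_le_div_iff₀ (by positivity) (by norm_num)]
      nlinarith [sq_nonneg ((n : ℝ) - 2 * t)]
    have h2 := mul_le_mul_of_nonneg_left h1 (mul_nonneg h0 hl)
    calc _ = weightProb n M t + weightProb n M t * l * ((n - t) / n * t) +
          l ^ 2 * (weightProb n M t * (t * (n - t) * idealWeight n M t ^ 2)) := by
          unfold weightProb; field_simp; ring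
      _ ≤ _ := by linarith
  refine (sub_le_sub_right (Finset.sum_le_sum hterm) _).trans ?_
  rw [Finset.sum_add_distrib, ← Finset.sum_mul, ← Finset.mul_sum,
    sum_weightProb n M (by nlinarith)]
  have hv := mul_le_mul_of_nonneg_left (sum_variance_le hn hM) (sq_nonneg l)
  linarith

end Moments
end TraitorTracing

namespace TraitorTracing

/-! ### Uniform probabilities -/

section Prob

variable {Ω Ω' : Type} [Fintype Ω] [Fintype Ω']

open Classical in
theorem prob_eq_sum (A : Ω → Prop) :
    prob A = (∑ ω, if A ω then (1 : ℝ) else 0) / Fintype.card Ω := by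
  rw [prob, Finset.sum_boole]

theorem prob_nonneg (A : Ω → Prop) : 0 ≤ prob A := by unfold prob; positivity

theorem prob_mono {A B : Ω → Prop} (h : ∀ ω, A ω → B ω) : prob A ≤ prob B := by
  classical
  unfold prob
  gcongr with ω
  exact h ω

theorem prob_congr {A B : Ω → Prop} (h : ∀ ω, A ω ↔ B ω) : prob A = prob B :=
  congrArg prob (funext fun ω => propext (h ω))

theorem prob_or_le (A B : Ω → Prop) : prob (fun ω => A ω ∨ B ω) ≤ prob A + prob B := by
  classical
  unfold prob
  rw [← add_div]
  gcongr
  refine (Nat.cast_le.2 (Finset.card_le_card (t := Finset.univ.filter A ∪ Finset.univ.filter B)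
    fun ω => ?_)).trans ?_
  · simp
  · exact_mod_cast Finset.card_union_le _ _

theorem prob_false : prob (fun _ : Ω => False) = 0 := by simp [prob]

/-- A uniform finite space has no nonempty null events, so perfect correctness holds for every
outcome of the coins. -/
theorem forall_of_prob_eq_one {A : Ω → Prop} (h : prob A = 1) (ω : Ω) : A ω := by
  classical
  have hpos : (0 : ℝ) < Fintype.card Ω := by exact_mod_cast Fintype.card_pos_iff.2 ⟨ω⟩
  rw [prob, div_eq_one_iff_eq hpos.ne'] at h
  have h' : (Finset.univ.filter A).card = Fintype.card Ω := by
    have := Nat.cast_injective (R := ℝ) h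
    convert this
  have := (Finset.card_eq_iff_eq_univ _).1 h'
  have : ω ∈ Finset.univ.filter A := by rw [this]; exact Finset.mem_univ _
  exact (Finset.mem_filter.1 this).2

theorem prob_eq_one_of_forall [Nonempty Ω] {A : Ω → Prop} (h : ∀ ω, A ω) : prob A = 1 := by
  classical
  have hpos : (0 : ℝ) < Fintype.card Ω := by exact_mod_cast Fintype.card_pos
  rw [prob, Finset.filter_true_of_mem fun ω _ => h ω, Finset.card_univ, div_self hpos.ne']

theorem prob_equiv (e : Ω ≃ Ω') (A : Ω' → Prop) : prob (fun ω => A (e ω)) = prob A := by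
  classical
  rw [prob_eq_sum, prob_eq_sum, Fintype.card_congr e]
  congr 1
  exact e.sum_comp (fun ω => if A ω then (1 : ℝ) else 0)

theorem prob_prod (A : Ω × Ω' → Prop) :
    prob A = (∑ ω, prob fun ω' => A (ω, ω')) / Fintype.card Ω := by
  classical
  simp only [prob_eq_sum]
  rw [Fintype.sum_prod_type, ← Finset.sum_div, Fintype.card_prod, Nat.cast_mul, div_div, mul_comm]

theorem prob_prod_le_add [Nonempty Ω] {A B : Ω × Ω' → Prop} {ε : ℝ}
    (h : ∀ ω, prob (fun ω' => A (ω, ω')) ≤ prob (fun ω' => B (ω, ω')) + ε) :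
    prob A ≤ prob B + ε := by
  have hpos : (0 : ℝ) < Fintype.card Ω := by exact_mod_cast Fintype.card_pos
  rw [prob_prod A, prob_prod B, div_add' _ _ _ hpos.ne']
  gcongr
  refine (Finset.sum_le_sum fun ω _ => h ω).trans ?_
  rw [Finset.sum_add_distrib]
  simp [mul_comm]

theorem prob_prod_le [Nonempty Ω] {A : Ω × Ω' → Prop} {ε : ℝ}
    (h : ∀ ω, prob (fun ω' => A (ω, ω')) ≤ ε) : prob A ≤ ε := by
  have := prob_prod_le_add (A := A) (B := fun _ => False) (ε := ε) (fun ω => by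
    have := prob_nonneg (fun _ : Ω' => False)
    linarith [h ω])
  rwa [prob_false, zero_add] at this

theorem prob_fst [Nonempty Ω'] (A : Ω → Prop) : prob (fun ω : Ω × Ω' => A ω.1) = prob A := by
  classical
  have hpos : (0 : ℝ) < Fintype.card Ω' := by exact_mod_cast Fintype.card_pos
  rw [prob_prod, prob_eq_sum]
  congr 1
  refine Finset.sum_congr rfl fun ω _ => ?_
  by_cases h : A ω
  · simp only [h, if_true]
    exact prob_eq_one_of_forall fun _ => trivial
  · simp only [h, if_false]
    exact prob_false

end Prob

/-! ### The fingerprinting code -/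

section Fingerprint

/-- The columns are independent, so the seeds producing a given matrix form a product of fibres. -/
theorem sum_pi_comp {Ω β : Type} [Fintype Ω] [Fintype β] [DecidableEq β] (k : ℕ) (c : Ω → β)
    (f : (Fin k → β) → ℝ) :
    ∑ R : Fin k → Ω, f (fun j => c (R j)) =
      ∑ W : Fin k → β, (∏ j, ((Finset.univ.filter fun ω => c ω = W j).card : ℝ)) * f W := by
  classical
  rw [← Finset.sum_fiberwise (s := Finset.univ) (g := fun (R : Fin k → Ω) j => c (R j))]
  refine Finset.sum_congr rfl fun W _ => ?_
  have h1 : ∀ R ∈ Finset.univ.filter (fun R : Fin k → Ω => (fun j => c (R j)) = W),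
      f (fun j => c (R j)) = f W := by
    intro R hR
    rw [(Finset.mem_filter.1 hR).2]
  rw [Finset.sum_congr rfl h1, Finset.sum_const, nsmul_eq_mul]
  congr 1
  have : Finset.univ.filter (fun R : Fin k → Ω => (fun j => c (R j)) = W) =
      Fintype.piFinset fun j => Finset.univ.filter fun ω => c ω = W j := by
    ext R
    simp [funext_iff]
  rw [this, Fintype.card_piFinset]
  push_cast
  rfl

theorem sum_bool_card {α : Type} [Fintype α] [DecidableEq α] (f : ℕ → ℝ) :
    ∑ w : α → Bool, f (Finset.univ.filter fun i => w i = true).card =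
      ∑ s ∈ Finset.range (Fintype.card α + 1), (Fintype.card α).choose s * f s := by
  have h := Finset.sum_powerset_apply_card f (x := (Finset.univ : Finset α))
  rw [Finset.card_univ] at h
  simp only [nsmul_eq_mul] at h
  rw [← h, Finset.powerset_univ]
  refine Finset.sum_bij' (fun w _ => Finset.univ.filter fun i => w i = true)
    (fun s _ i => decide (i ∈ s)) ?_ ?_ ?_ ?_ ?_ <;> simp

/-- The number of ones. -/
def ones {n : ℕ} (w : Fin n → Bool) : ℕ := (Finset.univ.filter fun i => w i = true).card

/-- An enumeration of the strings of length `m`. -/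
noncomputable def rank (m : ℕ) : (Fin m → Bool) ≃ Fin (2 ^ m) :=
  Fintype.equivFinOfCardEq (by simp)

/-- A column of the code: user `i` gets the bit `1` if its random string comes before a random
threshold. -/
noncomputable def column {n m : ℕ} (R : Option (Fin n) → Fin m → Bool) (i : Fin n) : Bool :=
  decide (rank m (R (some i)) < rank m (R none))

theorem card_rank_lt {m : ℕ} (r : Fin (2 ^ m)) (b : Bool) :
    (Finset.univ.filter fun v : Fin m → Bool => decide (rank m v < r) = b).card =
      if b then r.1 else 2 ^ m - r.1 := by
  classical
  have h : (Finset.univ.filter fun v : Fin m → Bool => decide (rank m v < r) = b).card =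
      (Finset.univ.filter fun v : Fin (2 ^ m) => decide (v < r) = b).card := by
    refine Finset.card_bij (fun v _ => rank m v) (by simp) (by simp) ?_
    intro v hv
    exact ⟨(rank m).symm v, by simpa using hv, by simp⟩
  rw [h]
  cases b
  · simp only [decide_eq_false_iff_not, not_lt, Bool.false_eq_true, if_false]
    rw [show (Finset.univ.filter fun v : Fin (2 ^ m) => r ≤ v) = Finset.Ici r by ext; simp]
    simp
  · simp only [decide_eq_true_eq, if_true]
    rw [show (Finset.univ.filter fun v : Fin (2 ^ m) => v < r) = Finset.Iio r by ext; simp]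
    simp

/-- Given a threshold of rank `r`, exactly `r` strings yield the bit 1 and `2 ^ m - r` the bit 0,
independently for each user. Comparing strings is a way to get random biases out of fair coins. -/
theorem card_column {n m : ℕ} (w : Fin n → Bool) :
    (Finset.univ.filter fun R : Option (Fin n) → Fin m → Bool => column R = w).card =
      columnCount n (2 ^ m) (ones w) := by
  classical
  have h0 : ∀ r : Fin (2 ^ m), (Finset.univ.filter fun R' : Fin n → Fin m → Bool =>
      (fun i => decide (rank m (R' i) < r)) = w).card = r.1 ^ ones w * (2 ^ m - r.1) ^ (n - ones w) := by
    intro r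
    have : (Finset.univ.filter fun R' : Fin n → Fin m → Bool =>
      (fun i => decide (rank m (R' i) < r)) = w) = Fintype.piFinset fun i =>
        Finset.univ.filter fun v : Fin m → Bool => decide (rank m v < r) = w i := by
      ext R; simp only [Finset.mem_filter, Finset.mem_univ, true_and, Fintype.mem_piFinset,
        funext_iff]
    rw [this, Fintype.card_piFinset]
    simp only [card_rank_lt]
    rw [Finset.prod_ite, Finset.prod_const, Finset.prod_const]
    congr 2
    have := Finset.card_filter_add_card_filter_not (s := (Finset.univ : Finset (Fin n)))
      (fun i => w i = true)
    simp only [Finset.card_univ, Fintype.card_fin] at this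
    unfold ones
    omega
  rw [columnCount, Finset.card_filter]
  refine ((Equiv.piOptionEquivProd (β := fun _ : Option (Fin n) => Fin m → Bool)).symm.sum_comp
    _).symm.trans ?_
  rw [Fintype.sum_prod_type, ← (rank m).symm.sum_comp]
  rw [← Fin.sum_univ_eq_sum_range (fun r => r ^ ones w * (2 ^ m - r) ^ (n - ones w))]
  refine Finset.sum_congr rfl fun r _ => ?_
  rw [← h0 r, Finset.card_filter]
  refine Finset.sum_congr rfl fun R' _ => ?_
  have : column (Equiv.piOptionEquivProd.symm ((rank m).symm r, R')) =
      fun i => decide (rank m (R' i) < r) := by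
    funext i
    simp [column, Equiv.piOptionEquivProd]
  rw [this]

/-- The accusation score of user `i`, if the pirate answers `a` on the code matrix `W`. -/
noncomputable def score {n k : ℕ} (M : ℕ) (W : Fin k → Fin n → Bool) (a : Fin k → Bool) (i : Fin n) : ℤ :=
  ∑ j, if a j then (scoreWeight n M (ones (W j)) : ℤ) * (n * (if W j i then 1 else 0) - ones (W j))
    else 0

/-- In every column the centred bits `n * bit - ones` sum to zero over the users. Hence some user
always has a nonnegative score and the tracer never fails to accuse. -/
theorem sum_score {n k : ℕ} (M : ℕ) (W : Fin k → Fin n → Bool) (a : Fin k → Bool) :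
    ∑ i, score M W a i = 0 := by
  unfold score
  rw [Finset.sum_comm]
  refine Finset.sum_eq_zero fun j _ => ?_
  split_ifs
  · rw [← Finset.mul_sum, Finset.sum_sub_distrib, ← Finset.mul_sum, Finset.sum_boole]
    simp [ones]
  · simp

/-- The answer `b` on a column is consistent with the marking condition, for the coalition of all
users but `i₀`. -/
def Legal {n : ℕ} (i₀ : Fin n) (w : Fin n → Bool) (b : Bool) : Prop :=
  ∀ b', (∀ i, i ≠ i₀ → w i = b') → b = b'

theorem ones_eq {n : ℕ} (i₀ : Fin n) (w : Fin n → Bool) : ones w =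
    (Finset.univ.filter fun i : {i // i ≠ i₀} => w i = true).card + (if w i₀ then 1 else 0) := by
  classical
  unfold ones
  rw [Finset.card_filter, Finset.card_filter, ← Fintype.sum_subtype_add_sum_subtype (· ≠ i₀)]
  congr 1
  rw [Fintype.sum_eq_single ⟨i₀, by simp⟩]
  intro x hx
  exact absurd (Subtype.ext (not_not.1 x.2)) hx

theorem sum_split {n k : ℕ} (i₀ : Fin n) (f : (Fin k → Fin n → Bool) → ℝ) :
    ∑ W, f W = ∑ v : Fin k → {i // i ≠ i₀} → Bool, ∑ u : Fin k → Bool,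
      f (fun j => (Equiv.funSplitAt i₀ Bool).symm (u j, v j)) := by
  rw [Finset.sum_comm, ← Fintype.sum_prod_type', ← (Equiv.arrowProdEquivProdArrow _ _ _).sum_comp,
    ← ((Equiv.refl (Fin k)).arrowCongr (Equiv.funSplitAt i₀ Bool)).sum_comp]
  refine Finset.sum_congr rfl fun W _ => ?_
  congr 1
  funext j
  exact ((Equiv.funSplitAt i₀ Bool).symm_apply_apply (W j)).symm

/-! ### The tail bound for an innocent user. -/

variable {n m k : ℕ}

/-- A Chernoff bound. By `ha` the answers ignore the bits of `i₀`; once all other bits are fixed,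
the answers are fixed too and the bits of `i₀` in different columns remain independent, so the
exponential moment factors over the columns. -/
theorem prob_accuse_innocent_le (hn : 2 ≤ n) (hM : 2 * n * (n + 1) ≤ 2 ^ m) (i₀ : Fin n)
    (a : (Fin k → Fin n → Bool) → Fin k → Bool)
    (ha : ∀ W W' : Fin k → Fin n → Bool, (∀ j i, i ≠ i₀ → W j i = W' j i) → a W = a W') :
    prob (fun R : Fin k → Option (Fin n) → Fin m → Bool =>
      (∀ j, Legal i₀ (column (R j)) (a (fun j => column (R j)) j)) ∧
        0 ≤ score (2 ^ m) (fun j => column (R j)) (a fun j => column (R j)) i₀) ≤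
      (1 - 1 / (128 * n ^ 2 * (1 + Real.log n))) ^ k := by
  classical
  have h2 : (2 : ℝ) ≤ n := by exact_mod_cast hn
  have hlog : 0 ≤ Real.log n := Real.log_nonneg (by linarith)
  have hn1 : (0 : ℝ) < n - 1 := by linarith
  set L : ℝ := 1 + Real.log n with hL
  have hL1 : 1 ≤ L := by linarith
  -- The minimizer of `-l (n - 1) / 2 + l² * 8 n² (n - 1)² L`.
  set l : ℝ := 1 / (32 * n ^ 2 * (n - 1) * L) with hl
  have hl0 : 0 ≤ l := by positivity
  have hl1 : l * (4 * n ^ 2 * (n - 1)) ≤ 1 := by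
    rw [hl, div_mul_eq_mul_div, div_le_one (by positivity)]
    have : 0 ≤ (n : ℝ) ^ 2 * (n - 1) := by positivity
    nlinarith
  set μ : (Fin n → Bool) → ℝ := fun w => columnProb n (2 ^ m) (ones w) with hμ
  -- Setting the factor to 0 for illegal answers builds the marking condition into the product.
  set G : (Fin n → Bool) → Bool → ℝ := fun w b => if Legal i₀ w b then
    Real.exp (l * (if b then (scoreWeight n (2 ^ m) (ones w) : ℝ) *
      (n * (if w i₀ then 1 else 0) - ones w) else 0)) else 0 with hG
  have step1 : prob (fun R : Fin k → Option (Fin n) → Fin m → Bool =>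
      (∀ j, Legal i₀ (column (R j)) (a (fun j => column (R j)) j)) ∧
        0 ≤ score (2 ^ m) (fun j => column (R j)) (a fun j => column (R j)) i₀) ≤
      ∑ W : Fin k → Fin n → Bool, ∏ j, (μ (W j) * G (W j) (a W j)) := by
    rw [prob_eq_sum]
    refine le_of_eq_of_le (congrArg (· / _)
      (sum_pi_comp k (fun R : Option (Fin n) → Fin m → Bool => column R)
      (fun W => @ite _ ((∀ j, Legal i₀ (W j) (a W j)) ∧ 0 ≤ score (2 ^ m) W (a W) i₀)
        (Classical.propDecidable _) (1 : ℝ) 0))) ?_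
    rw [Finset.sum_div]
    refine Finset.sum_le_sum fun W _ => ?_
    rw [Finset.prod_mul_distrib, mul_div_right_comm]
    have hprod : (∏ j, ((Finset.univ.filter fun R : Option (Fin n) → Fin m → Bool =>
        column R = W j).card : ℝ)) / (Fintype.card (Fin k → Option (Fin n) → Fin m → Bool) : ℝ) =
        ∏ j, μ (W j) := by
      simp only [card_column, hμ, columnProb, Finset.prod_div_distrib]
      simp
    rw [hprod]
    refine mul_le_mul_of_nonneg_left ?_
      (Finset.prod_nonneg fun j _ => columnProb_nonneg _ _ _)
    split_ifs with h
    · simp only [hG, h.1, if_true]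
      rw [← Real.exp_sum, Real.one_le_exp_iff, ← Finset.mul_sum]
      refine mul_nonneg hl0 ?_
      have := h.2
      unfold score at this
      have h' : ((0 : ℤ) : ℝ) ≤ _ := Int.cast_le.2 this
      push_cast at h'
      refine h'.trans (le_of_eq ?_)
      refine Finset.sum_congr rfl fun j _ => ?_
      split_ifs <;> simp
    · refine Finset.prod_nonneg fun j _ => ?_
      simp only [hG]
      split_ifs <;> positivity
  have hothers : Fintype.card {i : Fin n // i ≠ i₀} = n - 1 := by
    simp [Fintype.card_subtype_compl]
  set cnt : ({i : Fin n // i ≠ i₀} → Bool) → ℕ := fun v =>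
    (Finset.univ.filter fun i => v i = true).card with hcnt
  have hcnt_lt : ∀ v, cnt v < n := by
    intro v
    have := Finset.card_le_univ (Finset.univ.filter fun i => v i = true)
    rw [hothers] at this
    simp only [hcnt]; omega
  have step2 : ∀ (v : {i : Fin n // i ≠ i₀} → Bool) (b : Bool),
      ∑ u : Bool, μ ((Equiv.funSplitAt i₀ Bool).symm (u, v)) *
        G ((Equiv.funSplitAt i₀ Bool).symm (u, v)) b ≤ momentBound n (2 ^ m) l (cnt v) := by
    intro v b
    have hones : ∀ u : Bool, ones ((Equiv.funSplitAt i₀ Bool).symm (u, v)) =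
        cnt v + if u then 1 else 0 := by
      intro u
      rw [ones_eq i₀]
      simp only [Equiv.funSplitAt, Equiv.piSplitAt_symm_apply, hcnt]
      congr 2
      · congr 1
        ext i
        simp [i.2]
    have hval : ∀ u : Bool, (Equiv.funSplitAt i₀ Bool).symm (u, v) i₀ = u := by
      intro u; simp [Equiv.funSplitAt]
    have hlegal : ∀ u : Bool, Legal i₀ ((Equiv.funSplitAt i₀ Bool).symm (u, v)) b ↔
        ∀ b', (∀ i, v i = b') → b = b' := by
      intro u
      have : ∀ b', (∀ i, i ≠ i₀ → (Equiv.funSplitAt i₀ Bool).symm (u, v) i = b') ↔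
          ∀ i, v i = b' := by
        intro b'
        constructor
        · intro h i
          have := h i i.2
          simpa [Equiv.funSplitAt, i.2] using this
        · intro h i hi
          simpa [Equiv.funSplitAt, hi] using h ⟨i, hi⟩
      simp only [Legal, this]
    rw [Fintype.sum_bool]
    simp only [hG, hlegal, hμ, hones, hval, if_true, Bool.false_eq_true, if_false]
    by_cases hb : ∀ b', (∀ i, v i = b') → b = b'
    · simp only [if_pos hb]
      have := moment_le hn hM hl0 hl1 (hcnt_lt v) b
        (fun h => hb false fun i => by
          have := Finset.filter_eq_empty_iff.1 (Finset.card_eq_zero.1 h) (Finset.mem_univ i)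
          simpa using this)
        (fun h => hb true fun i => by
          have h' : cnt v = Fintype.card {i : Fin n // i ≠ i₀} := by omega
          have := (Finset.card_eq_iff_eq_univ _).1 h'
          have : i ∈ Finset.univ.filter fun i => v i = true := by
            rw [this]; exact Finset.mem_univ _
          exact (Finset.mem_filter.1 this).2)
      refine le_trans (le_of_eq ?_) this
      rw [add_comm]
      cases b <;> simp
    · simp only [if_neg hb, mul_zero, add_zero]
      -- For an illegal answer the left side is 0 and only nonnegativity of the bound is at stake.
      -- It follows from `moment_le` for some legal answer, which exists because `n ≥ 2`.
      have := moment_le hn hM hl0 hl1 (hcnt_lt v) (decide (cnt v + 1 = n))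
        (fun h => by simp; omega) (fun h => by simp [h])
      refine le_trans ?_ this
      have h1 := columnProb_nonneg n (2 ^ m) (cnt v)
      have h2 := columnProb_nonneg n (2 ^ m) (cnt v + 1)
      split_ifs <;> positivity
  have hGnn : ∀ w b, 0 ≤ μ w * G w b := by
    intro w b
    refine mul_nonneg (columnProb_nonneg _ _ _) ?_
    simp only [hG]
    split_ifs <;> positivity
  have step3 : ∑ W : Fin k → Fin n → Bool, ∏ j, (μ (W j) * G (W j) (a W j)) ≤
      (∑ v : {i : Fin n // i ≠ i₀} → Bool, momentBound n (2 ^ m) l (cnt v)) ^ k := by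
    rw [sum_split i₀]
    -- Freezing the answers at `u = false` allows the sum over `u` to be exchanged with the product
    -- over the columns.
    have hsub : ∀ (v : Fin k → {i : Fin n // i ≠ i₀} → Bool) (u : Fin k → Bool),
        a (fun j => (Equiv.funSplitAt i₀ Bool).symm (u j, v j)) =
          a (fun j => (Equiv.funSplitAt i₀ Bool).symm (false, v j)) := by
      intro v u
      apply ha
      intro j i hi
      simp [Equiv.funSplitAt, hi]
    calc _ = ∑ v : Fin k → {i : Fin n // i ≠ i₀} → Bool, ∏ j, ∑ u : Bool,
          (μ ((Equiv.funSplitAt i₀ Bool).symm (u, v j)) *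
            G ((Equiv.funSplitAt i₀ Bool).symm (u, v j))
              (a (fun j => (Equiv.funSplitAt i₀ Bool).symm (false, v j)) j)) := by
          refine Finset.sum_congr rfl fun v _ => ?_
          rw [Finset.prod_univ_sum, Fintype.piFinset_univ]
          refine Finset.sum_congr rfl fun u _ => ?_
          rw [hsub v u]
      _ ≤ ∑ v : Fin k → {i : Fin n // i ≠ i₀} → Bool, ∏ j, momentBound n (2 ^ m) l (cnt (v j)) :=
          Finset.sum_le_sum fun v _ => Finset.prod_le_prod
            (fun j _ => Finset.sum_nonneg fun u _ => hGnn _ _) (fun j _ => step2 _ _)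
      _ = _ := by
          have := Finset.prod_univ_sum (fun _ : Fin k => Finset.univ)
            (fun _ v => momentBound n (2 ^ m) l (cnt v))
          rw [Fintype.piFinset_univ] at this
          rw [← this]
          simp
  refine step1.trans (step3.trans ?_)
  have hpos : ∀ v, 0 ≤ momentBound n (2 ^ m) l (cnt v) := fun v =>
    (Finset.sum_nonneg fun u _ => hGnn _ _).trans (step2 v true)
  refine pow_le_pow_left₀ (Finset.sum_nonneg fun v _ => hpos v) ?_ k
  rw [hcnt, sum_bool_card (momentBound n (2 ^ m) l), hothers, show n - 1 + 1 = n by omega]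
  refine (sum_momentBound_le hn hM hl0).trans ?_
  rw [← hL]
  -- The variance term is half of the drift `l (n - 1) / 2` that is left after rounding, since `n /
  -- 4 ≤ (n - 1) / 2`.
  have e1 : l ^ 2 * (8 * n ^ 2 * (n - 1) ^ 2 * L) = 1 / (128 * n ^ 2 * L) := by
    rw [hl]; field_simp; norm_num
  have e2 : l * (n - 1) / 2 = 2 * (1 / (128 * n ^ 2 * L)) := by
    rw [hl]; field_simp; norm_num
  have e3 : l * (n / 4) ≤ l * (n - 1) / 2 := by
    have : (n : ℝ) / 4 ≤ (n - 1) / 2 := by linarith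
    calc _ ≤ l * ((n - 1) / 2) := by gcongr
      _ = _ := by ring
  linarith

end Fingerprint
end TraitorTracing

namespace TraitorTracing

/-! ### Circuits for the tracing algorithm -/

namespace Computes

variable {ι o : Type} {s : ℕ} {d : ℕ∞}

/-- Selecting one of several functions by an index that is part of the input. -/
theorem multiplex {n B : ℕ} (idx : Fin B → ι) (code : Fin n → Fin B → Bool)
    {D : Fin n → (ι → Bool) → Bool} (h : ∀ i, Computes s d (fun x (_ : Unit) => D i x)) :
    Computes (n * (s + 3 * B + 3) + 1) (d + 2) (fun (x : ι → Bool) (_ : Unit) =>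
      decide (∃ i, (∀ l, x (idx l) = code i l) ∧ D i x = true)) := by
  have h1 : ∀ i, Computes (B * 2 + s + (1 + (B + 1))) (d + 1) (fun (x : ι → Bool) (_ : Unit) =>
      decide ((∀ l, x (idx l) = code i l) ∧ D i x = true)) := by
    intro i
    have h2 := (((signs (code i)).comp (inputs idx)).mono le_rfl
      (by simp : (0 : ℕ∞) + 0 ≤ d)).pair (h i)
    refine (forall_fintype.comp h2).congr (by simp) le_rfl (fun x _ => ?_)
    rw [Bool.eq_iff_iff]
    simp
  refine (exists_fintype.comp (family_unit (F := fun x i =>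
    decide ((∀ l, x (idx l) = code i l) ∧ D i x = true)) h1)).congr ?_ ?_ (fun x _ => ?_)
  · simp only [Fintype.card_fin]; ring_nf; omega
  · rw [add_assoc]; norm_num
  · simp

/-- A truth table on `2 * m` bits, affordable because `m` will be logarithmic in the number of
users. -/
theorem column_bit {m n : ℕ} (idx : Option (Fin n) → Fin m → ι) (i : Fin n) :
    Computes (2 ^ (2 * m) * (6 * m + 3)) ⊤ (fun (x : ι → Bool) (_ : Unit) =>
      column (fun u v => x (idx u v)) i) := by
  refine ((of_fun (fun y : Fin m ⊕ Fin m → Bool =>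
    decide (rank m (fun v => y (.inl v)) < rank m (fun v => y (.inr v))))).comp
    (inputs (Sum.elim (idx (some i)) (idx none)))).congr ?_ le_top (fun x _ => ?_)
  · simp only [Fintype.card_sum, Fintype.card_fin, ← two_mul]
    exact le_of_eq (by ring)
  · rfl

/-- The nonnegativity of an accusation score. -/
theorem score_nonneg {n k M : ℕ} (hn : 2 ≤ n) (hM : 2 * n * (n + 1) ≤ M) (i : Fin n) :
    Computes (k * (4 * n ^ 4) * 2 * (200 * (n + 2) ^ 2 + 96) + 200 * (k * (4 * n ^ 4) * 2 + 2) ^ 2) ⊤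
      (fun (x : (Fin k × Fin n) ⊕ Fin k → Bool) (_ : Unit) =>
        decide (0 ≤ score M (fun j i => x (.inl (j, i))) (fun j => x (.inr j)) i)) := by
  classical
  set w : ℕ := 4 * n ^ 4 with hw
  let wt : Bool → ℕ → ℕ := fun b t => if b then (n - t) * scoreWeight n M t else t * scoreWeight n M t
  let f3 : Bool → (Fin 3 → Bool) → Bool := fun b z =>
    if b then z 0 && (z 1 && z 2) else !(z 0 && (!(z 1) && z 2))
  -- The score is turned into a count of true bits. In column `j` a gain is written in unary by the
  -- bits with `true`; a loss is the number of false bits among the `w` with `false`. So the count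
  -- is `k * w` plus the score. The bound `w = 4 * n ^ 4` suffices since each weight is at most `4 *
  -- n ^ 3`.
  let lit : (Fin k × Fin n ⊕ Fin k → Bool) → Fin k × Fin w × Bool → Bool := fun x p =>
    if p.2.2 then x (.inr p.1) && (x (.inl (p.1, i)) &&
      decide (p.2.1.1 < wt true (ones fun i => x (.inl (p.1, i)))))
    else !(x (.inr p.1) && (!(x (.inl (p.1, i))) &&
      decide (p.2.1.1 < wt false (ones fun i => x (.inl (p.1, i))))))
  have h1 : ∀ p, Computes (200 * (n + 2) ^ 2 + 96) ⊤ (fun x (_ : Unit) => lit x p) := by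
    rintro ⟨j, c, b⟩
    have h2 := ((symmetric (ι := Fin n) (fun t => decide (c.1 < wt b t))).comp
      (inputs (fun i : Fin n => (.inl (j, i) : Fin k × Fin n ⊕ Fin k)))).pair
      ((inputs (fun u : Bool => if u then (.inr j : Fin k × Fin n ⊕ Fin k) else .inl (j, i))).untrack
        |>.mono le_rfl (by simp))
    have h3 := ((of_fun (f3 b)).comp
      (inputs (fun l : Fin 3 => if l = 0 then (.inr true : Unit ⊕ Bool) else
        if l = 1 then .inr false else .inl ()))).comp h2
    refine h3.congr ?_ le_top (fun x _ => ?_)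
    · simp only [Fintype.card_fin]; omega
    · cases b <;> simp [f3, lit, ones]
  have hle : ∀ t, t ≤ n → ∀ b, wt b t ≤ w := by
    intro t ht b
    have := scoreWeight_le hn hM t
    have h4 : n * scoreWeight n M t ≤ w := by
      calc _ ≤ n * (4 * n ^ 3) := Nat.mul_le_mul_left _ this
        _ = w := by rw [hw]; ring
    cases b
    · exact (Nat.mul_le_mul_right _ ht).trans h4
    · exact (Nat.mul_le_mul_right _ (Nat.sub_le _ _)).trans h4
  have hcl : ∀ T, T ≤ w → ∑ c : Fin w, (if c.1 < T then 1 else 0) = T := by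
    intro T hT
    rw [Fin.sum_univ_eq_sum_range (fun c => if c < T then 1 else 0) w, ← Finset.sum_filter]
    rw [show (Finset.range w).filter (fun c => c < T) = Finset.range T by ext; simp; omega]
    simp
  have hcount : ∀ x, ((Finset.univ.filter fun p => lit x p = true).card : ℤ) =
      k * w + score M (fun j i => x (.inl (j, i))) (fun j => x (.inr j)) i := by
    intro x
    rw [Finset.card_filter, Fintype.sum_prod_type]
    have : (k * w : ℤ) = ∑ j : Fin k, (w : ℤ) := by simp
    rw [this, score, ← Finset.sum_add_distrib]
    push_cast
    refine Finset.sum_congr rfl fun j _ => ?_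
    rw [Fintype.sum_prod_type_right]
    simp only [Fintype.sum_bool, lit, if_true, Bool.false_eq_true, if_false]
    set t := ones (fun i => x (.inl (j, i))) with ht
    have htn : t ≤ n := by
      have := Finset.card_le_univ (Finset.univ.filter fun i => x (.inl (j, i)) = true)
      simpa [ht, ones] using this
    have e1 : ∑ c : Fin w, (if c.1 < wt true t then (1 : ℤ) else 0) = wt true t := by
      exact_mod_cast hcl _ (hle t htn true)
    have e2 : ∑ c : Fin w, (if c.1 < wt false t then (1 : ℤ) else 0) = wt false t := by
      exact_mod_cast hcl _ (hle t htn false)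
    have e3 : ∑ c : Fin w, (if c.1 < wt false t then (0 : ℤ) else 1) = w - wt false t := by
      rw [← e2, eq_sub_iff_add_eq, ← Finset.sum_add_distrib]
      rw [Finset.sum_congr rfl (g := fun _ => (1 : ℤ)) (fun c _ => by split_ifs <;> simp)]
      simp
    cases ha : x (.inr j) <;> cases hb : x (.inl (j, i))
    · simp
    · simp
    · simp only [Bool.true_and, Bool.false_and, Bool.not_false, Bool.not_eq_true',
        decide_eq_false_iff_not, ite_not]
      rw [e3]
      simp [wt]
      ring
    · simp only [Bool.true_and, Bool.not_true, Bool.false_and, decide_eq_true_eq, Bool.not_false]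
      rw [e1]
      simp [wt]
      push_cast [Nat.cast_sub htn]
      ring
  refine ((symmetric (fun c => decide (k * w ≤ c))).comp (family_unit h1)).congr ?_ le_top
    (fun x _ => ?_)
  · simp only [Fintype.card_prod, Fintype.card_fin, Fintype.card_bool, mul_assoc]
    exact le_rfl
  · have := hcount x
    rw [decide_eq_decide]
    constructor <;> intro h <;> zify at * <;> linarith

end Computes

/-- User `i` is the first one with a nonnegative score. -/
noncomputable def accused {n k : ℕ} (M : ℕ) (W : Fin k → Fin n → Bool) (a : Fin k → Bool)
    (i : Fin n) : Bool :=
  decide ((fun i' : {i' // i' ≤ i} => decide (0 ≤ score M W a i')) = fun i' => decide (i'.1 = i))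

theorem score_nonneg_of_accused {n k M : ℕ} {W : Fin k → Fin n → Bool} {a : Fin k → Bool}
    {i : Fin n} (h : accused M W a i = true) : 0 ≤ score M W a i := by
  have := congrFun (of_decide_eq_true h) ⟨i, le_rfl⟩
  simpa using this

/-- Not all scores are negative because they sum to zero, and a least index exists. -/
theorem existsUnique_accused {n k : ℕ} (hn : 0 < n) (M : ℕ) (W : Fin k → Fin n → Bool)
    (a : Fin k → Bool) : ∃! i, accused M W a i = true := by
  have hex : ∃ i, 0 ≤ score M W a i := by
    by_contra! h
    have : Nonempty (Fin n) := ⟨⟨0, hn⟩⟩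
    have := Finset.sum_lt_sum_of_nonempty (Finset.univ_nonempty (α := Fin n)) (fun i _ => h i)
    rw [sum_score] at this
    simp at this
  have hacc : ∀ i, accused M W a i = true ↔
      0 ≤ score M W a i ∧ ∀ i' < i, ¬ 0 ≤ score M W a i' := by
    intro i
    simp only [accused, decide_eq_true_eq, funext_iff, Subtype.forall, decide_eq_decide]
    constructor
    · intro h
      exact ⟨(h i le_rfl).2 rfl, fun i' hi' h' => hi'.ne ((h i' hi'.le).1 h')⟩
    · rintro ⟨h1, h2⟩ i' hi'
      rcases hi'.lt_or_eq with h | rfl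
      · simp [h.ne, h2 i' h]
      · simp [h1]
  obtain ⟨i, hi, hmin⟩ := (wellFounded_lt (α := Fin n)).has_min {i | 0 ≤ score M W a i} hex
  refine ⟨i, (hacc i).2 ⟨hi, fun i' h h' => hmin i' h' h⟩, fun i' h' => ?_⟩
  obtain ⟨h1, h2⟩ := (hacc i').1 h'
  rcases lt_trichotomy i i' with h | h | h
  · exact absurd hi (h2 i h)
  · exact h.symm
  · exact absurd h (hmin i' h1)

/-- A bound on the size of a circuit for the accusation. -/
def accuseSize (n k : ℕ) : ℕ :=
  n * (k * (4 * n ^ 4) * 2 * (200 * (n + 2) ^ 2 + 96) + 200 * (k * (4 * n ^ 4) * 2 + 2) ^ 2) +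
    n * (1 + 3 * n)

theorem Computes.accused {n k M : ℕ} (hn : 2 ≤ n) (hM : 2 * n * (n + 1) ≤ M) :
    Computes (accuseSize n k) ⊤ (fun (x : (Fin k × Fin n) ⊕ Fin k → Bool) i =>
        accused M (fun j i => x (.inl (j, i))) (fun j => x (.inr j)) i) := by
  have h1 := family_unit (F := fun (x : (Fin k × Fin n) ⊕ Fin k → Bool) i =>
    decide (0 ≤ score M (fun j i => x (.inl (j, i))) (fun j => x (.inr j)) i))
    (fun i => score_nonneg hn hM i)
  have hle : ∀ i : Fin n, Fintype.card {i' // i' ≤ i} ≤ n := fun i =>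
    (Fintype.card_subtype_le _).trans (by simp)
  have h2 := family_unit (F := fun (y : Fin n → Bool) i =>
    decide ((fun i' : {i' // i' ≤ i} => y i') = fun i' => decide (i'.1 = i))) (s := 1 + 3 * n)
    (d := ⊤) (fun i => ((eq_const (fun i' : {i' // i' ≤ i} => decide (i'.1 = i))).comp
      (inputs (fun i' : {i' // i' ≤ i} => i'.1))).mono (s' := 1 + 3 * n) (by
        have := hle i
        omega) le_top)
  exact (h2.comp h1).congr (by simp [accuseSize]) le_top (fun x i => rfl)

end TraitorTracing

namespace TraitorTracing

/-! ### Traitor tracing for one value of the security parameter -/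

/-- The part of a traitor-tracing scheme that belongs to one value of the security parameter. -/
structure Instance (n k κ : ℕ) where
  len : ℕ
  ciphertexts : Set (Fin len → Bool)
  gen : RandCircuit Empty (Fin n × Fin κ)
  enc : RandCircuit ((Fin n × Fin κ) ⊕ Unit) (Fin len)
  dec : Circuit (Fin κ ⊕ Fin len) Unit
  traceCoins : ℕ
  query : Circuit ((Fin n × Fin κ) ⊕ Fin traceCoins) (Fin k × Fin len)
  accuse : Circuit ((Fin n × Fin κ) ⊕ (Fin traceCoins ⊕ Fin k)) (Fin n)
  enc_mem : ∀ (sk : Fin n × Fin κ → Bool) (b : Bool) (ρ : enc.Coins),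
    enc.run (Sum.elim sk fun _ => b) ρ ∈ ciphertexts
  query_mem : ∀ (sk : Fin n × Fin κ → Bool) (τ : Fin traceCoins → Bool) (j : Fin k),
    (fun l => query.run (Sum.elim sk τ) (j, l)) ∈ ciphertexts
  accuse_unique : 0 < n → ∀ (sk : Fin n × Fin κ → Bool)
    (τ : Fin traceCoins → Bool) (a : Fin k → Bool),
    ∃! i, accuse.run (Sum.elim sk (Sum.elim τ a)) i = true

namespace Instance

variable {n k κ : ℕ} (I : Instance n k κ)

def Gen (γ : I.gen.Coins) (i : Fin n) : Fin κ → Bool := fun l => I.gen.run Empty.elim γ (i, l)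

def Enc (sk : Fin n → Fin κ → Bool) (b : Bool) (ρ : I.enc.Coins) : Fin I.len → Bool :=
  I.enc.run (Sum.elim (fun p => sk p.1 p.2) fun _ => b) ρ

def Dec (sk : Fin κ → Bool) (c : Fin I.len → Bool) : Bool := I.dec.run (Sum.elim sk c) ()

def Query (sk : Fin n → Fin κ → Bool) (τ : Fin I.traceCoins → Bool) (j : Fin k) :
    Fin I.len → Bool :=
  fun l => I.query.run (Sum.elim (fun p => sk p.1 p.2) τ) (j, l)

def Accuses (sk : Fin n → Fin κ → Bool) (τ : Fin I.traceCoins → Bool) (a : Fin k → Bool)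
    (i : Fin n) : Prop :=
  I.accuse.run (Sum.elim (fun p => sk p.1 p.2) (Sum.elim τ a)) i = true

def Correct : Prop :=
  ∀ (b : Bool) (i : Fin n) (γ : I.gen.Coins) (ρ : I.enc.Coins),
    I.Dec (I.Gen γ i) (I.Enc (I.Gen γ) b ρ) = b

/-- The answer of a pirate decoder. -/
def answer {S : Finset (Fin n)} (P : RandCircuit ((S × Fin κ) ⊕ (Fin k × Fin I.len)) (Fin k))
    (sk : Fin n → Fin κ → Bool) (c : Fin k → Fin I.len → Bool) (ρ : P.Coins) : Fin k → Bool :=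
  P.run (Sum.elim (fun p => sk p.1 p.2) (fun p => c p.1 p.2)) ρ

/-- The pirate decoder is available, with error at most `η`. -/
def Available {S : Finset (Fin n)} (P : RandCircuit ((S × Fin κ) ⊕ (Fin k × Fin I.len)) (Fin k))
    (η : ℝ) : Prop :=
  ∀ (sk : Fin n → Fin κ → Bool) (c : Fin k → Fin I.len → Bool), (∀ j, c j ∈ I.ciphertexts) →
    prob (fun ρ : P.Coins => ∃ (j : Fin k) (b : Bool),
      (∀ i ∈ S, I.Dec (sk i) (c j) = b) ∧ I.answer P sk c ρ j ≠ b) ≤ η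

/-- The probability that no member of the coalition is accused. -/
noncomputable def failProb {S : Finset (Fin n)}
    (P : RandCircuit ((S × Fin κ) ⊕ (Fin k × Fin I.len)) (Fin k)) : ℝ :=
  prob (fun ω : I.gen.Coins × (Fin I.traceCoins → Bool) × P.Coins =>
    ¬ ∃ i ∈ S, I.Accuses (I.Gen ω.1) ω.2.1
      (I.answer P (I.Gen ω.1) (I.Query (I.Gen ω.1) ω.2.1) ω.2.2) i)

/-- The total size of the key generation, encryption and decryption circuits. -/
def userSize : ℕ := I.gen.size + I.enc.size + I.dec.size

/-- The total size of the tracing circuits. -/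
def traceSize : ℕ := I.query.size + I.accuse.size

end Instance

/-- The traitor-tracing scheme with given instances. -/
def TTScheme.ofInstances {n k : ℕ → ℕ} (I : ∀ κ, Instance (n κ) (k κ) κ)
    (hu : PolyBounded (fun κ => (I κ).userSize) (fun κ => κ + n κ))
    (ht : PolyBounded (fun κ => (I κ).traceSize) (fun κ => κ + n κ + k κ)) : TTScheme n k where
  len κ := (I κ).len
  ciphertexts κ := (I κ).ciphertexts
  gen κ := (I κ).gen
  enc κ := (I κ).enc
  dec κ := (I κ).dec
  traceCoins κ := (I κ).traceCoins
  query κ := (I κ).query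
  accuse κ := (I κ).accuse
  enc_mem κ := (I κ).enc_mem
  query_mem κ := (I κ).query_mem
  accuse_unique κ := (I κ).accuse_unique
  gen_time := by
    obtain ⟨c, hc⟩ := hu
    exact ⟨c, fun κ => le_trans (by simp only [Instance.userSize]; omega) (hc κ)⟩
  enc_time := by
    obtain ⟨c, hc⟩ := hu
    exact ⟨c, fun κ => le_trans (by simp only [Instance.userSize]; omega) (hc κ)⟩
  dec_time := by
    obtain ⟨c, hc⟩ := hu
    exact ⟨c, fun κ => le_trans (by simp only [Instance.userSize]; omega) (hc κ)⟩
  query_time := by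
    obtain ⟨c, hc⟩ := ht
    exact ⟨c, fun κ => le_trans (by simp only [Instance.traceSize]; omega) (hc κ)⟩
  accuse_time := by
    obtain ⟨c, hc⟩ := ht
    exact ⟨c, fun κ => le_trans (by simp only [Instance.traceSize]; omega) (hc κ)⟩

/-- A randomized circuit with coins indexed by a finite type. -/
noncomputable def RandCircuit.ofComputes {ι o T : Type} [Fintype T] {s : ℕ}
    {F : (ι ⊕ T → Bool) → o → Bool} (h : Computes s ⊤ F) : RandCircuit ι o :=
  ⟨Fintype.card T, (h.comp (Computes.inputs (Sum.map id (Fintype.equivFin T)))).circuit⟩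

theorem RandCircuit.run_ofComputes {ι o T : Type} [Fintype T] {s : ℕ}
    {F : (ι ⊕ T → Bool) → o → Bool} (h : Computes s ⊤ F) (x : ι → Bool)
    (ρ : (RandCircuit.ofComputes h).Coins) :
    (RandCircuit.ofComputes h).run x ρ = F (Sum.elim x fun t => ρ (Fintype.equivFin T t)) := by
  unfold RandCircuit.run RandCircuit.ofComputes
  rw [Computes.run_circuit]
  congr 1
  funext j
  cases j <;> rfl

theorem RandCircuit.size_ofComputes {ι o T : Type} [Fintype T] [Fintype o] {s : ℕ}
    {F : (ι ⊕ T → Bool) → o → Bool} (h : Computes s ⊤ F) :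
    (RandCircuit.ofComputes h).size ≤ s + Fintype.card o :=
  (Computes.size_circuit _).trans (by simp)

/-- A scheme without any security, for the values of the security parameter that are too small for
the actual construction. -/
theorem exists_trivial_instance (n k κ : ℕ) : ∃ I : Instance n k κ, I.Correct ∧
    ∀ c, ∃ D : Circuit (Fin κ) Unit, (∀ x, D.run x () = I.Dec x c) ∧ D.size ≤ 3 ∧ D.depth ≤ 0 := by
  refine ⟨{
    len := 1
    ciphertexts := Set.univ
    gen := ⟨0, (Computes.const fun _ => false).circuit⟩
    enc := ⟨0, (Computes.inputs (fun _ => .inl (.inr ()))).circuit⟩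
    dec := (Computes.inputs (fun _ => .inr 0)).circuit
    traceCoins := 0
    query := (Computes.const fun _ => false).circuit
    accuse := (Computes.const fun i => decide (i.1 = 0)).circuit
    enc_mem := fun _ _ _ => trivial
    query_mem := fun _ _ _ => trivial
    accuse_unique := fun hn _ _ _ => by
      rw [Computes.run_circuit]
      exact ⟨⟨0, hn⟩, by simp, fun i hi => Fin.ext (by simpa using hi)⟩ }, ?_, fun c =>
    ⟨(Computes.const fun _ => c 0).circuit, fun x => ?_, Computes.size_circuit _,
      Computes.depth_circuit (n := 0) _⟩⟩
  · intro b i γ ρ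
    simp [Instance.Dec, Instance.Enc, RandCircuit.run, Computes.run_circuit]
  · simp [Instance.Dec, Computes.run_circuit]

/-! ### The construction -/

namespace EncScheme

variable (E : EncScheme) (K : ℕ)

theorem computes_Gen : Computes (E.gen K).size ⊤ (fun y => E.Gen K y) := by
  refine ((Computes.of_circuit (E.gen K).circuit).comp
    (Computes.inputs (Sum.elim Empty.elim id))).congr (by simp [RandCircuit.size]) le_top
    (fun x j => ?_)
  simp only [Gen, RandCircuit.run]
  congr 1
  funext z
  rcases z with z | z
  · exact z.elim
  · rfl

theorem computes_Enc : Computes (E.enc K).size ⊤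
    (fun (y : (Fin K ⊕ Unit) ⊕ Fin (E.enc K).coins → Bool) =>
      E.Enc K (fun l => y (.inl (.inl l))) (y (.inl (.inr ()))) (fun c => y (.inr c))) := by
  refine (Computes.of_circuit (E.enc K).circuit).congr le_rfl le_top (fun x j => ?_)
  simp only [Enc, RandCircuit.run]
  congr 1
  funext z
  rcases z with (z | z) | z <;> rfl

theorem computes_Dec : Computes (E.dec K).size ⊤
    (fun (y : Fin K ⊕ Fin (E.len K) → Bool) (_ : Unit) =>
      E.Dec K (fun l => y (.inl l)) (fun l => y (.inr l))) := by
  refine (Computes.of_circuit (E.dec K)).congr le_rfl le_top (fun x j => ?_)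
  simp only [Dec]
  congr 1
  funext z
  rcases z with z | z <;> rfl

variable {K} {n k κ B m : ℕ} (e : Fin K ⊕ Fin B ≃ Fin κ) (code : Fin n → Fin B → Bool)

/-- The key of a user consists of a key of `E` and the code of the user. -/
def userKey (i : Fin n) (γ : Fin (E.gen K).coins → Bool) : Fin κ → Bool :=
  fun l => Sum.elim (E.Gen K γ) (code i) (e.symm l)

/-- The tuple of encryptions of the bits `w i`. -/
def encTuple (sk : Fin n → Fin κ → Bool) (w : Fin n → Bool)
    (ρ : Fin n → Fin (E.enc K).coins → Bool) : Fin (n * E.len K) → Bool :=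
  fun l => E.Enc K (fun l' => sk (finProdFinEquiv.symm l).1 (e (.inl l')))
    (w (finProdFinEquiv.symm l).1) (ρ (finProdFinEquiv.symm l).1) (finProdFinEquiv.symm l).2

/-- Decryption of the ciphertext that belongs to the code in the key. -/
def decTuple (sk : Fin κ → Bool) (c : Fin (n * E.len K) → Bool) : Bool :=
  decide (∃ i, (∀ l, sk (e (.inr l)) = code i l) ∧
    E.Dec K (fun l => sk (e (.inl l))) (fun l => c (finProdFinEquiv (i, l))) = true)

/-- Indices of the coins of the tracing algorithm: for the code and for the encryptions. -/
abbrev TraceIndex (n k m K : ℕ) : Type :=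
  (Fin k × Option (Fin n) × Fin m) ⊕ (Fin k × Fin n × Fin (E.enc K).coins)

theorem computes_keys : Computes (n * ((E.gen K).size + 2)) ⊤
    (fun (x : Empty ⊕ (Fin n × Fin (E.gen K).coins) → Bool) (p : Fin n × Fin κ) =>
      E.userKey e code p.1 (fun c => x (.inr (p.1, c))) p.2) := by
  have := Computes.family (A := Fin n) (B := Fin κ) (s := (E.gen K).size + 2) (d := ⊤) (F :=
    fun (x : Empty ⊕ (Fin n × Fin (E.gen K).coins) → Bool) (p : Fin n × Fin κ) =>
      E.userKey e code p.1 (fun c => x (.inr (p.1, c))) p.2) (fun i => by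
    refine ((Computes.wires (fun l => Sum.map id (code i) (e.symm l))).comp
      ((E.computes_Gen K).comp (Computes.inputs (fun c => .inr (i, c))))).congr (by simp) le_top
      (fun x l => ?_)
    simp only [userKey]
    rcases e.symm l with l | l <;> rfl)
  simpa using this

theorem computes_encTuple : Computes (n * (E.enc K).size) ⊤
    (fun (x : ((Fin n × Fin κ) ⊕ Unit) ⊕ (Fin n × Fin (E.enc K).coins) → Bool) =>
      E.encTuple e (fun i l => x (.inl (.inl (i, l)))) (fun _ => x (.inl (.inr ())))
        (fun i c => x (.inr (i, c)))) := by
  have := (Computes.family (A := Fin n) (B := Fin (E.len K)) (s := (E.enc K).size) (d := ⊤) (F :=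
    fun (x : ((Fin n × Fin κ) ⊕ Unit) ⊕ (Fin n × Fin (E.enc K).coins) → Bool) p =>
      E.Enc K (fun l => x (.inl (.inl (p.1, e (.inl l))))) (x (.inl (.inr ())))
        (fun c => x (.inr (p.1, c))) p.2) (fun i =>
    ((E.computes_Enc K).comp (Computes.inputs (Sum.elim (Sum.elim (fun l => .inl (.inl (i, e (.inl l))))
      (fun _ => .inl (.inr ()))) (fun c => .inr (i, c))))).congr (by simp) le_top
      (fun x l => rfl))).select (finProdFinEquiv (m := n) (n := E.len K)).symm
  exact this.congr (by simp) le_top (fun x l => rfl)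

theorem computes_decTuple : Computes (n * ((E.dec K).size + 3 * B + 3) + 1) ⊤
    (fun (x : Fin κ ⊕ Fin (n * E.len K) → Bool) (_ : Unit) =>
      E.decTuple e code (fun l => x (.inl l)) (fun l => x (.inr l))) := by
  have := Computes.multiplex (ι := Fin κ ⊕ Fin (n * E.len K)) (fun l => .inl (e (.inr l))) code
    (d := ⊤) (s := (E.dec K).size) (D := fun i x => E.Dec K (fun l => x (.inl (e (.inl l))))
      (fun l => x (.inr (finProdFinEquiv (i, l))))) (fun i =>
    ((E.computes_Dec K).comp (Computes.inputs (Sum.elim (fun l => .inl (e (.inl l)))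
      (fun l => .inr (finProdFinEquiv (i, l)))))).congr (by simp) le_top (fun x _ => rfl))
  exact this.congr le_rfl le_top (fun x _ => rfl)

theorem computes_query : Computes (k * (n * ((E.enc K).size + 2 ^ (2 * m) * (6 * m + 3)))) ⊤
    (fun (x : (Fin n × Fin κ) ⊕ E.TraceIndex n k m K → Bool) (p : Fin k × Fin (n * E.len K)) =>
      E.encTuple e (fun i l => x (.inl (i, l))) (column fun u v => x (.inr (.inl (p.1, u, v))))
        (fun i c => x (.inr (.inr (p.1, i, c)))) p.2) := by
  have h : ∀ j : Fin k, Computes (n * ((E.enc K).size + 2 ^ (2 * m) * (6 * m + 3))) ⊤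
      (fun (x : (Fin n × Fin κ) ⊕ E.TraceIndex n k m K → Bool) (l : Fin (n * E.len K)) =>
      E.encTuple e (fun i l => x (.inl (i, l))) (column fun u v => x (.inr (.inl (j, u, v))))
        (fun i c => x (.inr (.inr (j, i, c)))) l) := by
    intro j
    have := (Computes.family (A := Fin n) (B := Fin (E.len K)) (d := ⊤)
      (s := (E.enc K).size + 2 ^ (2 * m) * (6 * m + 3)) (F :=
      fun (x : (Fin n × Fin κ) ⊕ E.TraceIndex n k m K → Bool) p =>
        E.Enc K (fun l => x (.inl (p.1, e (.inl l))))
          (column (fun u v => x (.inr (.inl (j, u, v)))) p.1)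
          (fun c => x (.inr (.inr (j, p.1, c)))) p.2) (fun i => by
      have h1 := (Computes.column_bit (ι := (Fin n × Fin κ) ⊕ E.TraceIndex n k m K)
        (fun u v => .inr (.inl (j, u, v))) i).pair
        ((Computes.inputs (Sum.elim (fun l => (.inl (i, e (.inl l))))
          (fun c => .inr (.inr (j, i, c))) : Fin K ⊕ Fin (E.enc K).coins →
            (Fin n × Fin κ) ⊕ E.TraceIndex n k m K)).untrack)
      have h2 := ((E.computes_Enc K).comp (Computes.inputs (Sum.elim (Sum.elim
        (fun l => .inr (.inl l)) (fun _ => .inl ())) (fun c => .inr (.inr c)) :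
          (Fin K ⊕ Unit) ⊕ Fin (E.enc K).coins → Unit ⊕ (Fin K ⊕ Fin (E.enc K).coins)))).comp h1
      refine h2.congr (by omega) le_top (fun x l => rfl))).select
        (finProdFinEquiv (m := n) (n := E.len K)).symm
    exact this.congr (by simp) le_top (fun x l => rfl)
  have := Computes.family (A := Fin k) (B := Fin (n * E.len K)) (d := ⊤) (F :=
    fun (x : (Fin n × Fin κ) ⊕ E.TraceIndex n k m K → Bool) (p : Fin k × Fin (n * E.len K)) =>
      E.encTuple e (fun i l => x (.inl (i, l))) (column fun u v => x (.inr (.inl (p.1, u, v))))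
        (fun i c => x (.inr (.inr (p.1, i, c)))) p.2) h
  simpa using this

theorem computes_accuse (hn : 2 ≤ n) (hm : 2 * n * (n + 1) ≤ 2 ^ m) :
    Computes (accuseSize n k + k * (n * (2 ^ (2 * m) * (6 * m + 3)))) ⊤
    (fun (x : (Fin n × Fin κ) ⊕ (E.TraceIndex n k m K ⊕ Fin k) → Bool) =>
      accused (2 ^ m) (fun j => column fun u v => x (.inr (.inl (.inl (j, u, v)))))
        (fun j => x (.inr (.inr j)))) := by
  have h1 := Computes.family_unit (A := Fin k × Fin n) (F :=
    fun (x : (Fin n × Fin κ) ⊕ (E.TraceIndex n k m K ⊕ Fin k) → Bool) p =>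
      column (fun u v => x (.inr (.inl (.inl (p.1, u, v))))) p.2)
    (fun p => Computes.column_bit (ι := (Fin n × Fin κ) ⊕ (E.TraceIndex n k m K ⊕ Fin k))
      (fun u v => .inr (.inl (.inl (p.1, u, v)))) p.2)
  have h2 := h1.pair ((Computes.inputs (fun j : Fin k =>
    (.inr (.inr j) : (Fin n × Fin κ) ⊕ (E.TraceIndex n k m K ⊕ Fin k)))).untrack)
  refine ((Computes.accused hn hm).comp h2).congr ?_ le_top (fun x i => rfl)
  simp only [Fintype.card_prod, Fintype.card_fin, add_zero, mul_assoc]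
  omega

theorem encTuple_mem (sk : Fin n → Fin κ → Bool) (w : Fin n → Bool)
    (ρ : Fin n → Fin (E.enc K).coins → Bool) (i : Fin n) :
    (fun l => E.encTuple e sk w ρ (finProdFinEquiv (i, l))) ∈ E.ciphertexts K := by
  simp only [encTuple, Equiv.symm_apply_apply]
  exact E.enc_mem K _ _ _

/-- The construction of a traitor-tracing scheme from an encryption scheme and a fingerprinting
code. -/
noncomputable def tracing (k : ℕ) (hn : 2 ≤ n) (hm : 2 * n * (n + 1) ≤ 2 ^ m) : Instance n k κ where
  len := n * E.len K
  ciphertexts := {c | ∀ i, (fun l => c (finProdFinEquiv (i, l))) ∈ E.ciphertexts K}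
  gen := .ofComputes (E.computes_keys e code)
  enc := .ofComputes (E.computes_encTuple e)
  dec := (E.computes_decTuple e code).circuit
  traceCoins := Fintype.card (E.TraceIndex n k m K)
  query := ((E.computes_query e).comp (Computes.inputs
    (Sum.map id (Fintype.equivFin (E.TraceIndex n k m K))))).circuit
  accuse := ((E.computes_accuse hn hm).comp (Computes.inputs
    (Sum.map id (Sum.map (Fintype.equivFin (E.TraceIndex n k m K)) id)))).circuit
  enc_mem sk b ρ i := by
    rw [RandCircuit.run_ofComputes]
    exact E.encTuple_mem e _ _ _ i
  query_mem sk τ j i := by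
    rw [Computes.run_circuit]
    dsimp only
    exact E.encTuple_mem e _ _ _ i
  accuse_unique h sk τ a := by
    rw [Computes.run_circuit]
    exact existsUnique_accused h _ _ _

end EncScheme
end TraitorTracing

namespace TraitorTracing

/-! ### Resampling a part of the randomness -/

section Resampling

variable {X Y Z : Type} [Fintype X] [Fintype Y] [Fintype Z]

/-- Exchanging the component `get x` with the fresh `y` is an involution of `X × Y`, so it preserves
the uniform distribution. -/
theorem prob_resample [Nonempty Y] (upd : X → Y → X) (get : X → Y)
    (h1 : ∀ x y, get (upd x y) = y) (h2 : ∀ x, upd x (get x) = x)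
    (h3 : ∀ x y y', upd (upd x y) y' = upd x y') (A : X → Prop) :
    prob (fun ω : X × Y => A (upd ω.1 ω.2)) = prob A := by
  let σ : X × Y ≃ X × Y :=
    { toFun := fun ω => (upd ω.1 ω.2, get ω.1)
      invFun := fun ω => (upd ω.1 ω.2, get ω.1)
      left_inv := fun ω => by simp [h1, h2, h3]
      right_inv := fun ω => by simp [h1, h2, h3] }
  exact (prob_equiv σ fun ω => A ω.1).trans (prob_fst A)

/-- It suffices to compare two events with all randomness fixed except one component of `x`. The
security of a single user's key is applied in this form. -/
theorem prob_le_add_of_resample [Nonempty X] [Nonempty Y] [Nonempty Z] (upd : X → Y → X)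
    (get : X → Y) (h1 : ∀ x y, get (upd x y) = y) (h2 : ∀ x, upd x (get x) = x)
    (h3 : ∀ x y y', upd (upd x y) y' = upd x y') {A B : X × Z → Prop} {ε : ℝ}
    (h : ∀ x z, prob (fun y => A (upd x y, z)) ≤ prob (fun y => B (upd x y, z)) + ε) :
    prob A ≤ prob B + ε := by
  rw [← prob_equiv (Equiv.prodComm Z X) A, ← prob_equiv (Equiv.prodComm Z X) B]
  refine prob_prod_le_add fun z => ?_
  have hA := prob_resample upd get h1 h2 h3 (fun x => A (x, z))
  have hB := prob_resample upd get h1 h2 h3 (fun x => B (x, z))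
  refine le_of_eq_of_le hA.symm (le_trans ?_ (add_le_add_left hB.le ε))
  exact prob_prod_le_add fun x => h x z

end Resampling

namespace EncScheme

variable {E : EncScheme} {K n k κ B m : ℕ} {e : Fin K ⊕ Fin B ≃ Fin κ} {code : Fin n → Fin B → Bool}
  {hn : 2 ≤ n} {hm : 2 * n * (n + 1) ≤ 2 ^ m}

/-! ### Correctness and decryption complexity of the construction. -/

theorem Correct.dec_enc (h : E.Correct) (b : Bool) (γ : (E.gen K).Coins) (ρ : (E.enc K).Coins) :
    E.Dec K (E.Gen K γ) (E.Enc K (E.Gen K γ) b ρ) = b :=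
  forall_of_prob_eq_one (h b K) (γ, ρ)

theorem tracing_Gen (γ : (E.tracing e code k hn hm).gen.Coins) (i : Fin n) :
    (E.tracing e code k hn hm).Gen γ i = E.userKey e code i
      (fun c => γ (Fintype.equivFin (Fin n × Fin (E.gen K).coins) (i, c))) := by
  funext l
  exact congrFun (RandCircuit.run_ofComputes (E.computes_keys e code) _ γ) (i, l)

theorem tracing_Enc (sk : Fin n → Fin κ → Bool) (b : Bool)
    (ρ : (E.tracing e code k hn hm).enc.Coins) :
    (E.tracing e code k hn hm).Enc sk b ρ = E.encTuple e sk (fun _ => b)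
      (fun i c => ρ (Fintype.equivFin (Fin n × Fin (E.enc K).coins) (i, c))) :=
  RandCircuit.run_ofComputes (E.computes_encTuple e) _ ρ

theorem tracing_Dec (sk : Fin κ → Bool) (c : Fin (n * E.len K) → Bool) :
    (E.tracing e code k hn hm).Dec sk c = E.decTuple e code sk c :=
  congrFun (congrFun (Computes.run_circuit (E.computes_decTuple e code)) (Sum.elim sk c)) ()

theorem tracing_Query (sk : Fin n → Fin κ → Bool)
    (τ : Fin (Fintype.card (E.TraceIndex n k m K)) → Bool) (j : Fin k) :
    (E.tracing e code k hn hm).Query sk τ j = E.encTuple e sk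
      (column fun u v => τ (Fintype.equivFin (E.TraceIndex n k m K) (.inl (j, u, v))))
      (fun i c => τ (Fintype.equivFin (E.TraceIndex n k m K) (.inr (j, i, c)))) := by
  funext l
  exact congrFun (congrFun (Computes.run_circuit ((E.computes_query e).comp (Computes.inputs
    (Sum.map id (Fintype.equivFin (E.TraceIndex n k m K)))))) _) (j, l)

theorem tracing_Accuses (sk : Fin n → Fin κ → Bool)
    (τ : Fin (Fintype.card (E.TraceIndex n k m K)) → Bool) (a : Fin k → Bool) (i : Fin n) :
    (E.tracing e code k hn hm).Accuses sk τ a i ↔ accused (2 ^ m) (fun j => column fun u v =>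
      τ (Fintype.equivFin (E.TraceIndex n k m K) (.inl (j, u, v)))) a i = true := by
  have := congrFun (congrFun (Computes.run_circuit ((computes_accuse (E := E) (κ := κ) (k := k)
    (K := K) hn hm).comp (Computes.inputs
    (Sum.map id (Sum.map (Fintype.equivFin (E.TraceIndex n k m K)) id)))))
    (Sum.elim (fun p => sk p.1 p.2) (Sum.elim τ a))) i
  exact Eq.congr_left this

theorem userKey_inl (i : Fin n) (γ : Fin (E.gen K).coins → Bool) (l : Fin K) :
    E.userKey e code i γ (e (.inl l)) = E.Gen K γ l := by
  simp [userKey]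

/-- Names are distinct, so only the disjunct of user `i` survives. The bits may differ between
users, which is what lets tracing queries carry a codeword column; the other users' keys need not be
honest. -/
theorem decTuple_encTuple (hE : E.Correct) (hcode : Function.Injective code)
    (sk : Fin n → Fin κ → Bool) (w : Fin n → Bool) (ρ : Fin n → Fin (E.enc K).coins → Bool)
    (i : Fin n) (γ : Fin (E.gen K).coins → Bool) (hsk : sk i = E.userKey e code i γ) :
    E.decTuple e code (sk i) (E.encTuple e sk w ρ) = w i := by
  have h1 : ∀ i', (∀ l, sk i (e (.inr l)) = code i' l) ↔ i' = i := by
    intro i'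
    constructor
    · intro h
      refine hcode (funext fun l => ?_)
      rw [← h l, hsk]
      simp [userKey]
    · rintro rfl l
      rw [hsk]
      simp [userKey]
  have h2 : E.Dec K (fun l => sk i (e (.inl l)))
      (fun l => E.encTuple e sk w ρ (finProdFinEquiv (i, l))) = w i := by
    simp only [encTuple, Equiv.symm_apply_apply, hsk, userKey_inl]
    exact hE.dec_enc (w i) γ (ρ i)
  simp only [decTuple, h1]
  rw [Bool.eq_iff_iff]
  simp [h2]

theorem tracing_correct (hE : E.Correct) (hcode : Function.Injective code) :
    (E.tracing e code k hn hm).Correct := by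
  intro b i γ ρ
  rw [tracing_Enc, tracing_Dec]
  exact decTuple_encTuple hE hcode _ _ _ i _ (tracing_Gen γ i)

/-- For a fixed list each entry is a ciphertext of `E`, so decrypting it is a member of the original
family; the selection by name adds one conjunction and one disjunction level. -/
theorem tracing_family {s h : ℕ} (hdec : ∀ f ∈ E.decFamily K, ∃ D : Circuit (Fin K) Unit,
    (∀ x, D.run x () = f x) ∧ D.size ≤ s ∧ D.depth ≤ h)
    (c : Fin (n * E.len K) → Bool) (hc : c ∈ (E.tracing e code k hn hm).ciphertexts) :
    ∃ D : Circuit (Fin κ) Unit, (∀ x, D.run x () = (E.tracing e code k hn hm).Dec x c) ∧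
      D.size ≤ n * (s + 3 * B + 3) + 2 ∧ D.depth ≤ h + 2 := by
  have h1 : ∀ i : Fin n, Computes s h (fun (x : Fin κ → Bool) (_ : Unit) =>
      E.Dec K (fun l => x (e (.inl l))) (fun l => c (finProdFinEquiv (i, l)))) := by
    intro i
    obtain ⟨D, hD1, hD2, hD3⟩ := hdec _ ⟨_, hc i, rfl⟩
    have hD : Computes s h D.run := ⟨D, rfl, (Nat.le_add_right _ _).trans hD2, fun j => by
      exact_mod_cast (Finset.le_sup (f := fun j => (D.out j).depth (gateDepths D.gates))
        (Finset.mem_univ j)).trans hD3⟩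
    exact (hD.comp (Computes.inputs (fun l => e (.inl l)))).congr (by simp) (by simp)
      (fun x _ => hD1 _)
  have h2 := Computes.multiplex (fun l => e (.inr l)) code h1
  refine ⟨h2.circuit, fun x => ?_, h2.size_circuit, h2.depth_circuit (n := h + 2)⟩
  rw [h2.run_circuit, tracing_Dec]
  rfl

/-! ### Security of the construction -/

/-- The keys of all users. -/
def keys (E : EncScheme) (e : Fin K ⊕ Fin B ≃ Fin κ) (code : Fin n → Fin B → Bool)
    (γ : Fin n → Fin (E.gen K).coins → Bool) (i : Fin n) : Fin κ → Bool :=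
  E.userKey e code i (γ i)

/-- The game hands out `q` ciphertexts but the test reads only the first `k`; the other `d` encrypt
0 and their coins are averaged out. -/
theorem acceptProb_eq {q d : ℕ} (hq : q = k + d) {s : ℕ}
    {f : (Fin k × Fin (E.len K) → Bool) → Bool}
    (hf : Computes s ⊤ (fun y (_ : Unit) => f y)) :
    ∃ A : RandCircuit (Fin q × Fin (E.len K)) Unit, A.size ≤ s + 1 ∧
      ∀ z : Fin k → Bool, ∃ b : Fin q → Bool, E.acceptProb K q A b =
        prob (fun ω : (E.gen K).Coins × (Fin k → (E.enc K).Coins) =>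
          f (fun p => E.Enc K (E.Gen K ω.1) (z p.1) (ω.2 p.1) p.2) = true) := by
  subst hq
  have hA := hf.comp (Computes.inputs (fun p : Fin k × Fin (E.len K) =>
    (.inl (Fin.castAdd d p.1, p.2) : (Fin (k + d) × Fin (E.len K)) ⊕ Fin 0)))
  refine ⟨⟨0, hA.circuit⟩, hA.size_circuit.trans (by simp), fun z =>
    ⟨Fin.append z fun _ => false, ?_⟩⟩
  let σ : ((E.gen K).Coins × (Fin k → (E.enc K).Coins)) × ((Fin d → (E.enc K).Coins) ×
      (Fin 0 → Bool)) ≃ (E.gen K).Coins × (Fin (k + d) → (E.enc K).Coins) × (Fin 0 → Bool) :=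
    (Equiv.prodAssoc _ _ _).trans (Equiv.prodCongr (Equiv.refl _)
      ((Equiv.prodAssoc _ _ _).symm.trans (Equiv.prodCongr (Fin.appendEquiv k d) (Equiv.refl _))))
  rw [← prob_fst (Ω' := (Fin d → (E.enc K).Coins) × (Fin 0 → Bool)), acceptProb]
  refine (prob_equiv σ _).symm.trans (prob_congr fun ω => ?_)
  simp only [RandCircuit.run]
  rw [hA.run_circuit]
  simp [σ, Fin.appendEquiv]

variable {i₀ : Fin n}

/-- The answer of the pirate, if the bits `w j i` are encrypted. -/
noncomputable def pirateAnswer (hn : 2 ≤ n) (hm : 2 * n * (n + 1) ≤ 2 ^ m) (code : Fin n → Fin B → Bool)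
    {S : Finset (Fin n)}
    (P : RandCircuit ((S × Fin κ) ⊕ (Fin k × Fin (E.tracing e code k hn hm).len)) (Fin k))
    (w : Fin k → Fin n → Bool) (γ : Fin n → Fin (E.gen K).coins → Bool)
    (ρ : Fin k → Fin n → Fin (E.enc K).coins → Bool) (π : P.Coins) : Fin k → Bool :=
  (E.tracing e code k hn hm).answer P (E.keys e code γ)
    (fun j => E.encTuple e (E.keys e code γ) (w j) (ρ j)) π

/-- Replacing the ciphertexts of a user outside of the coalition. -/
theorem prob_accused_le_add {S : Finset (Fin n)} (hS : i₀ ∉ S)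
    (P : RandCircuit ((S × Fin κ) ⊕ (Fin k × Fin (E.tracing e code k hn hm).len)) (Fin k))
    {q t : ℕ} {ε : ℝ} (hq : k ≤ q)
    (hE : ∀ A : RandCircuit (Fin q × Fin (E.len K)) Unit, A.size ≤ t → ∀ b b' : Fin q → Bool,
      |E.acceptProb K q A b - E.acceptProb K q A b'| ≤ ε)
    (ht : P.size + accuseSize n k + 5 ≤ t) (W : Fin k → Fin n → Bool) (z : Fin k → Bool)
    (γ : Fin n → Fin (E.gen K).coins → Bool) (ρ : Fin k → Fin n → Fin (E.enc K).coins → Bool)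
    (π : P.Coins) :
    prob (fun y : (E.gen K).Coins × (Fin k → (E.enc K).Coins) => accused (2 ^ m) W
      (pirateAnswer hn hm code P W (Function.update γ i₀ y.1)
        (fun j => Function.update (ρ j) i₀ (y.2 j)) π) i₀ = true) ≤
    prob (fun y : (E.gen K).Coins × (Fin k → (E.enc K).Coins) => accused (2 ^ m) W
      (pirateAnswer hn hm code P (fun j => Function.update (W j) i₀ (z j))
        (Function.update γ i₀ y.1) (fun j => Function.update (ρ j) i₀ (y.2 j)) π) i₀ = true) + ε := by
  classical
  -- The inputs of the pirate as seen by the distinguisher: ciphertexts of `i₀` come from the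
  -- challenge, while the coalition's keys, all other ciphertexts and the pirate's coins are
  -- hardwired. Hardwiring here and of the code matrix below costs 2 each, and the output 1, which
  -- accounts for the 5 in `ht`.
  let wire : ((S × Fin κ) ⊕ (Fin k × Fin (n * E.len K))) ⊕ Fin P.coins →
      (Fin k × Fin (E.len K)) ⊕ Bool :=
    Sum.elim (Sum.elim (fun p => .inr (E.keys e code γ p.1 p.2))
      (fun p => if (finProdFinEquiv.symm p.2).1 = i₀ then .inl (p.1, (finProdFinEquiv.symm p.2).2)
        else .inr (E.encTuple e (E.keys e code γ) (W p.1) (ρ p.1) p.2))) (fun c => .inr (π c))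
  have hP := (Computes.of_circuit P.circuit).comp (Computes.wires wire)
  have hacc := ((Computes.accused hn hm).comp (Computes.wires (Sum.elim
    (fun p : Fin k × Fin n => (.inr (W p.1 p.2) : Fin k ⊕ Bool)) (fun j : Fin k => .inl j)))).select
    (fun _ : Unit => i₀)
  obtain ⟨d, rfl⟩ := Nat.exists_eq_add_of_le hq
  obtain ⟨A, hA1, hA2⟩ := acceptProb_eq (E := E) rfl (hacc.comp hP)
  have key : ∀ (z : Fin k → Bool) (y : (E.gen K).Coins × (Fin k → (E.enc K).Coins)),
      pirateAnswer hn hm code P (fun j => Function.update (W j) i₀ (z j))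
        (Function.update γ i₀ y.1) (fun j => Function.update (ρ j) i₀ (y.2 j)) π =
      P.circuit.run (fun j => Sum.elim
        (fun p => E.Enc K (E.Gen K y.1) (z p.1) (y.2 p.1) p.2) id (wire j)) := by
    intro z y
    unfold pirateAnswer Instance.answer RandCircuit.run
    congr 1
    funext p
    rcases p with (p | p) | p
    · have : (p.1 : Fin n) ≠ i₀ := fun h => hS (h ▸ p.1.2)
      change E.keys e code (Function.update γ i₀ y.1) p.1 p.2 = E.keys e code γ p.1 p.2
      simp [keys, this]
    · change E.encTuple e _ _ _ p.2 = Sum.elim _ id (wire (.inl (.inr p)))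
      by_cases h : (finProdFinEquiv.symm p.2).1 = i₀
      · rw [show wire (.inl (.inr p)) = .inl (p.1, (finProdFinEquiv.symm p.2).2) from if_pos h]
        unfold encTuple
        rw [h]
        simp [keys, userKey_inl]
      · rw [show wire (.inl (.inr p)) =
          .inr (E.encTuple e (E.keys e code γ) (W p.1) (ρ p.1) p.2) from if_neg h]
        unfold encTuple
        simp only [Function.update_of_ne h, keys]
        rfl
    · rfl
  have hprob : ∀ z : Fin k → Bool, ∃ b : Fin (k + d) → Bool, E.acceptProb K (k + d) A b =
      prob (fun y : (E.gen K).Coins × (Fin k → (E.enc K).Coins) => accused (2 ^ m) W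
        (pirateAnswer hn hm code P (fun j => Function.update (W j) i₀ (z j))
        (Function.update γ i₀ y.1) (fun j => Function.update (ρ j) i₀ (y.2 j)) π) i₀ = true) := by
    intro z
    obtain ⟨b, hb⟩ := hA2 z
    refine ⟨b, hb.trans (prob_congr fun y => ?_)⟩
    rw [key z y]
    rfl
  obtain ⟨b, hb⟩ := hprob (fun j => W j i₀)
  obtain ⟨b', hb'⟩ := hprob z
  simp only [Function.update_eq_self] at hb
  rw [← hb, ← hb']
  have hsize : A.size ≤ t := hA1.trans (le_trans (by simp only [RandCircuit.size]; omega) ht)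
  have := (abs_le.1 (hE A hsize b b')).2
  linarith

/-- If nothing depends on the bits of the innocent user, then they are not accused. -/
theorem prob_accused_ideal_le (hE : E.Correct) (hcode : Function.Injective code)
    {S : Finset (Fin n)} (hS : S = Finset.univ.erase i₀)
    (P : RandCircuit ((S × Fin κ) ⊕ (Fin k × Fin (E.tracing e code k hn hm).len)) (Fin k))
    {η : ℝ} (hP : (E.tracing e code k hn hm).Available P η) :
    prob (fun ω : ((Fin n → Fin (E.gen K).coins → Bool) ×
        (Fin k → Fin n → Fin (E.enc K).coins → Bool)) ×
        ((Fin k → Option (Fin n) → Fin m → Bool) × P.Coins) =>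
      accused (2 ^ m) (fun j => column (ω.2.1 j)) (pirateAnswer hn hm code P
        (fun j => Function.update (column (ω.2.1 j)) i₀ false) ω.1.1 ω.1.2 ω.2.2) i₀ = true) ≤
      η + (1 - 1 / (128 * n ^ 2 * (1 + Real.log n))) ^ k := by
  have : ∀ ω : ((Fin n → Fin (E.gen K).coins → Bool) ×
        (Fin k → Fin n → Fin (E.enc K).coins → Bool)) ×
        ((Fin k → Option (Fin n) → Fin m → Bool) × P.Coins),
      accused (2 ^ m) (fun j => column (ω.2.1 j)) (pirateAnswer hn hm code P
        (fun j => Function.update (column (ω.2.1 j)) i₀ false) ω.1.1 ω.1.2 ω.2.2) i₀ = true →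
      (¬ ∀ j, Legal i₀ (column (ω.2.1 j)) (pirateAnswer hn hm code P
        (fun j => Function.update (column (ω.2.1 j)) i₀ false) ω.1.1 ω.1.2 ω.2.2 j)) ∨
      ((∀ j, Legal i₀ (column (ω.2.1 j)) (pirateAnswer hn hm code P
        (fun j => Function.update (column (ω.2.1 j)) i₀ false) ω.1.1 ω.1.2 ω.2.2 j)) ∧
        0 ≤ score (2 ^ m) (fun j => column (ω.2.1 j)) (pirateAnswer hn hm code P
        (fun j => Function.update (column (ω.2.1 j)) i₀ false) ω.1.1 ω.1.2 ω.2.2) i₀) := by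
    intro ω h
    have := score_nonneg_of_accused h
    tauto
  refine (prob_mono this).trans ((prob_or_le _ _).trans (add_le_add ?_ ?_))
  -- Illegal answers: availability holds for every fixed choice of keys and ciphertexts, and the
  -- coalition decrypts column `j` to its own codeword bits.
  · refine prob_prod_le fun x => prob_prod_le fun R => ?_
    refine le_trans (prob_mono fun π hπ => ?_) (hP (E.keys e code x.1)
      (fun j => E.encTuple e (E.keys e code x.1) (Function.update (column (R j)) i₀ false) (x.2 j))
      (fun j i => E.encTuple_mem e _ _ _ i))
    simp only [Legal] at hπ
    push Not at hπ
    obtain ⟨j, b, hb1, hb2⟩ := hπ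
    refine ⟨j, b, fun i hi => ?_, hb2⟩
    have hi' : i ≠ i₀ := by rw [hS] at hi; exact Finset.ne_of_mem_erase hi
    rw [tracing_Dec, decTuple_encTuple hE hcode _ _ _ i (x.1 i) rfl, Function.update_of_ne hi']
    exact hb1 i hi'
  -- Legal answers: with keys, encryption coins and the pirate's coins fixed, the answers are a
  -- function of the matrix without the row of `i₀`, so the bound for the code applies.
  · refine prob_prod_le fun x => ?_
    refine le_of_eq_of_le (prob_equiv (Equiv.prodComm P.Coins _) _).symm ?_
    refine prob_prod_le fun π => ?_
    exact prob_accuse_innocent_le hn hm i₀ (fun W => pirateAnswer hn hm code P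
      (fun j => Function.update (W j) i₀ false) x.1 x.2 π) (fun W W' h => by
        have : (fun j => Function.update (W j) i₀ false) =
            fun j => Function.update (W' j) i₀ false := by
          funext j i
          by_cases hi : i = i₀
          · subst hi; simp
          · simp [hi, h j i hi]
        simp only [this])

/-- Someone is always accused and at most one user is outside the coalition, so failure means
accusing precisely that user. The maximum with 0 covers the full coalition without requiring the
other bound to be nonnegative. -/
theorem tracing_failProb_le (hE : E.Correct) (hcode : Function.Injective code)
    {S : Finset (Fin n)} (hS : n ≤ S.card + 1)
    (P : RandCircuit ((S × Fin κ) ⊕ (Fin k × Fin (E.tracing e code k hn hm).len)) (Fin k))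
    {η : ℝ} (hP : (E.tracing e code k hn hm).Available P η)
    {q t : ℕ} {ε : ℝ} (hq : k ≤ q)
    (hsec : ∀ A : RandCircuit (Fin q × Fin (E.len K)) Unit, A.size ≤ t → ∀ b b' : Fin q → Bool,
      |E.acceptProb K q A b - E.acceptProb K q A b'| ≤ ε)
    (ht : P.size + accuseSize n k + 5 ≤ t) :
    (E.tracing e code k hn hm).failProb P ≤
      max 0 (η + (1 - 1 / (128 * n ^ 2 * (1 + Real.log n))) ^ k + ε) := by
  classical
  have hcases : S = Finset.univ ∨ ∃ i, i ∉ S := by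
    rw [Finset.eq_univ_iff_forall, ← not_forall]
    exact em _
  rcases hcases with rfl | ⟨i₀, hi₀⟩
  · refine le_max_of_le_left (le_of_eq ?_)
    unfold Instance.failProb
    rw [← prob_false (Ω := (E.tracing e code k hn hm).gen.Coins ×
      (Fin (E.tracing e code k hn hm).traceCoins → Bool) × P.Coins)]
    refine prob_congr fun ω => ?_
    simp only [iff_false, not_not, Finset.mem_univ, true_and]
    exact ((E.tracing e code k hn hm).accuse_unique (by omega) _ _ _).exists
  refine le_max_of_le_right ?_
  have hSe : S = Finset.univ.erase i₀ := by
    refine Finset.eq_of_subset_of_card_le (fun i hi => ?_) ?_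
    · exact Finset.mem_erase.2 ⟨fun h => hi₀ (h ▸ hi), Finset.mem_univ _⟩
    · rw [Finset.card_erase_of_mem (Finset.mem_univ _), Finset.card_univ, Fintype.card_fin]
      omega
  -- Regroups the coins of key generation and tracing by purpose: keys and encryptions on one side,
  -- the code and the pirate on the other.
  let σ : ((Fin n → Fin (E.gen K).coins → Bool) × (Fin k → Fin n → Fin (E.enc K).coins → Bool)) ×
        ((Fin k → Option (Fin n) → Fin m → Bool) × P.Coins) ≃
      (E.tracing e code k hn hm).gen.Coins ×
        (Fin (E.tracing e code k hn hm).traceCoins → Bool) × P.Coins :=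
    { toFun := fun p => (fun t => p.1.1 ((Fintype.equivFin _).symm t).1
          ((Fintype.equivFin _).symm t).2,
        fun t => Sum.elim (fun s => p.2.1 s.1 s.2.1 s.2.2) (fun s => p.1.2 s.1 s.2.1 s.2.2)
          ((Fintype.equivFin (E.TraceIndex n k m K)).symm t), p.2.2)
      invFun := fun ω => ((fun i c => ω.1 (Fintype.equivFin _ (i, c)),
        fun j i c => ω.2.1 (Fintype.equivFin (E.TraceIndex n k m K) (.inr (j, i, c)))),
        (fun j u v => ω.2.1 (Fintype.equivFin (E.TraceIndex n k m K) (.inl (j, u, v))), ω.2.2))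
      left_inv := fun p => by simp
      right_inv := fun ω => by
        refine Prod.ext ?_ (Prod.ext ?_ rfl)
        · funext t
          exact congrArg ω.1 ((Fintype.equivFin (Fin n × Fin (E.gen K).coins)).apply_symm_apply t)
        · funext t
          obtain ⟨s, rfl⟩ := (Fintype.equivFin (E.TraceIndex n k m K)).surjective t
          rcases s with s | s <;> simp }
  have h1 : (E.tracing e code k hn hm).failProb P ≤ prob (fun ω :
      ((Fin n → Fin (E.gen K).coins → Bool) × (Fin k → Fin n → Fin (E.enc K).coins → Bool)) ×
        ((Fin k → Option (Fin n) → Fin m → Bool) × P.Coins) =>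
      accused (2 ^ m) (fun j => column (ω.2.1 j)) (pirateAnswer hn hm code P
        (fun j => column (ω.2.1 j)) ω.1.1 ω.1.2 ω.2.2) i₀ = true) := by
    refine le_of_eq_of_le (prob_equiv σ _).symm (prob_mono fun ω hω => ?_)
    have hgen : (E.tracing e code k hn hm).Gen (σ ω).1 = E.keys e code ω.1.1 := by
      funext i
      rw [tracing_Gen]
      simp [σ, keys]
    have hquery : (E.tracing e code k hn hm).Query (E.keys e code ω.1.1) (σ ω).2.1 =
        fun j => E.encTuple e (E.keys e code ω.1.1) (column (ω.2.1 j)) (ω.1.2 j) := by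
      funext j
      refine (tracing_Query _ _ j).trans ?_
      simp [σ]
      rfl
    have hex := ((E.tracing e code k hn hm).accuse_unique (by omega)
      (fun p => (E.tracing e code k hn hm).Gen (σ ω).1 p.1 p.2) (σ ω).2.1
      ((E.tracing e code k hn hm).answer P ((E.tracing e code k hn hm).Gen (σ ω).1)
        ((E.tracing e code k hn hm).Query ((E.tracing e code k hn hm).Gen (σ ω).1) (σ ω).2.1)
        (σ ω).2.2)).exists
    obtain ⟨i, hi⟩ := hex
    have hi0 : i = i₀ := by
      by_contra hne
      exact hω ⟨i, by rw [hSe]; exact Finset.mem_erase.2 ⟨hne, Finset.mem_univ _⟩, hi⟩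
    subst hi0
    have hacc := (tracing_Accuses _ _ _ _).1 hi
    rw [hgen, hquery] at hacc
    simp only [σ, Equiv.coe_fn_mk, Equiv.symm_apply_apply, Sum.elim_inl] at hacc
    exact hacc
  refine h1.trans ?_
  refine le_trans ?_ (add_le_add_left (prob_accused_ideal_le hE hcode hSe P hP) ε)
  -- Only the key coins and encryption coins of `i₀` are averaged; they are the randomness of the
  -- security game.
  refine prob_le_add_of_resample
    (fun (x : (Fin n → Fin (E.gen K).coins → Bool) × (Fin k → Fin n → Fin (E.enc K).coins → Bool))
      (y : (E.gen K).Coins × (Fin k → (E.enc K).Coins)) =>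
      (Function.update x.1 i₀ y.1, fun j => Function.update (x.2 j) i₀ (y.2 j)))
    (fun x => (x.1 i₀, fun j => x.2 j i₀)) ?_ ?_ ?_ ?_
  · intro x y; simp
  · intro x; simp
  · intro x y y'; simp
  · rintro ⟨γ, ρ⟩ ⟨R, π⟩
    exact prob_accused_le_add hi₀ P hq hsec ht (fun j => column (R j)) (fun _ => false) γ ρ π

end EncScheme
end TraitorTracing

namespace TraitorTracing

/-! ### Polynomial bounds -/

namespace PolyBounded

variable {t t' M M' : ℕ → ℕ}

theorem mono (h : PolyBounded t' M) (ht : ∀ κ, t κ ≤ t' κ) : PolyBounded t M := by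
  obtain ⟨c, hc⟩ := h
  exact ⟨c, fun κ => (ht κ).trans (hc κ)⟩

theorem of_eventually_le (h : PolyBounded t' M) (ht : ∀ᶠ κ in atTop, t κ ≤ t' κ) :
    PolyBounded t M := by
  obtain ⟨c, hc⟩ := h
  obtain ⟨N, hN⟩ := eventually_atTop.1 ht
  refine ⟨c + ∑ i ∈ Finset.range N, t i, fun κ => ?_⟩
  set C := c + ∑ i ∈ Finset.range N, t i with hC
  rcases lt_or_ge κ N with h | h
  · have h1 : t κ ≤ C := (Finset.single_le_sum (f := t) (fun _ _ => Nat.zero_le _)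
      (Finset.mem_range.2 h)).trans (Nat.le_add_left _ _)
    exact h1.trans (Nat.le_mul_of_pos_right _ (by positivity))
  · have hle : c ≤ C := Nat.le_add_right _ _
    refine (hN κ h).trans ((hc κ).trans ?_)
    exact Nat.mul_le_mul hle (Nat.pow_le_pow_right (by omega) hle)

theorem const (a : ℕ) : PolyBounded (fun _ => a) M :=
  ⟨a, fun _ => Nat.le_mul_of_pos_right _ (by positivity)⟩

theorem of_le (h : ∀ κ, t κ ≤ M κ) : PolyBounded t M :=
  ⟨1, fun κ => by simpa using (h κ).trans (Nat.le_succ _)⟩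

theorem add (h : PolyBounded t M) (h' : PolyBounded t' M) :
    PolyBounded (fun κ => t κ + t' κ) M := by
  obtain ⟨c, hc⟩ := h
  obtain ⟨c', hc'⟩ := h'
  refine ⟨c + c', fun κ => (add_le_add (hc κ) (hc' κ)).trans ?_⟩
  rw [add_mul]
  exact add_le_add (Nat.mul_le_mul_left _ (Nat.pow_le_pow_right (by omega) (by omega)))
    (Nat.mul_le_mul_left _ (Nat.pow_le_pow_right (by omega) (by omega)))

theorem mul (h : PolyBounded t M) (h' : PolyBounded t' M) :
    PolyBounded (fun κ => t κ * t' κ) M := by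
  obtain ⟨c, hc⟩ := h
  obtain ⟨c', hc'⟩ := h'
  refine ⟨c * c' + (c + c'), fun κ => (Nat.mul_le_mul (hc κ) (hc' κ)).trans ?_⟩
  calc c * (M κ + 1) ^ c * (c' * (M κ + 1) ^ c') = c * c' * (M κ + 1) ^ (c + c') := by ring
    _ ≤ _ := Nat.mul_le_mul (Nat.le_add_right _ _)
      (Nat.pow_le_pow_right (by omega) (Nat.le_add_left _ _))

theorem pow (h : PolyBounded t M) (a : ℕ) : PolyBounded (fun κ => t κ ^ a) M := by
  induction a with
  | zero => simpa using const 1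
  | succ a ih => simpa [pow_succ] using ih.mul h

theorem trans (h : PolyBounded t M) (h' : PolyBounded M M') : PolyBounded t M' := by
  obtain ⟨c, hc⟩ := h
  exact ((const c).mul ((h'.add (const 1)).pow c)).mono hc

theorem comp (h : PolyBounded t M) (f : ℕ → ℕ) : PolyBounded (fun κ => t (f κ)) (fun κ => M (f κ)) := by
  obtain ⟨c, hc⟩ := h
  exact ⟨c, fun κ => hc _⟩

theorem accuseSize {n k : ℕ → ℕ} (hn : PolyBounded n M) (hk : PolyBounded k M) :
    PolyBounded (fun κ => accuseSize (n κ) (k κ)) M := by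
  have h1 := (hk.mul ((const 4).mul (hn.pow 4))).mul (const 2)
  exact (hn.mul ((h1.mul (((const 200).mul ((hn.add (const 2)).pow 2)).add (const 96))).add
    ((const 200).mul ((h1.add (const 2)).pow 2)))).add (hn.mul ((const 1).add ((const 3).mul hn)))

end PolyBounded

/-! ### Parameters of the code -/

/-- The length of the code. -/
def codeLength (n : ℕ) : ℕ := 512 * n ^ 2 * (Nat.log 2 n + 1) ^ 2

/-- The length of the random strings that determine the code. -/
def codeBits (n : ℕ) : ℕ := 2 * Nat.log 2 n + 3

theorem le_two_pow_codeBits (n : ℕ) : 2 * n * (n + 1) ≤ 2 ^ codeBits n := by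
  have h : n + 1 ≤ 2 ^ (Nat.log 2 n + 1) := Nat.lt_pow_succ_log_self (by norm_num) n
  calc 2 * n * (n + 1) ≤ 2 * (n + 1) * (n + 1) := by gcongr; omega
    _ ≤ 2 * 2 ^ (Nat.log 2 n + 1) * 2 ^ (Nat.log 2 n + 1) := by gcongr
    _ = 2 ^ codeBits n := by unfold codeBits; ring

theorem two_pow_two_mul_codeBits_le (n : ℕ) :
    2 ^ (2 * codeBits n) * (6 * codeBits n + 3) ≤ 64 * (n + 1) ^ 4 * (12 * n + 21) := by
  have h1 : 2 ^ Nat.log 2 n ≤ n + 1 := by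
    rcases Nat.eq_zero_or_pos n with rfl | h
    · simp
    · exact (Nat.pow_log_le_self 2 h.ne').trans (Nat.le_succ n)
  have h2 : Nat.log 2 n ≤ n := Nat.log_le_self 2 n
  refine Nat.mul_le_mul ?_ (by unfold codeBits; omega)
  calc 2 ^ (2 * codeBits n) = 64 * (2 ^ Nat.log 2 n) ^ 4 := by unfold codeBits; ring
    _ ≤ _ := by gcongr

/-- With `ℓ = Nat.log 2 n` the exponent is `4 (ℓ + 1)² / (1 + log n)`, and `log n ≤ ℓ + 1` makes
this at least `2 log n`. -/
theorem pow_codeLength_le {n : ℕ} (hn : 2 ≤ n) :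
    (1 - 1 / (128 * n ^ 2 * (1 + Real.log n)) : ℝ) ^ codeLength n ≤ 1 / (n : ℝ) ^ 2 := by
  have h2 : (2 : ℝ) ≤ n := by exact_mod_cast hn
  have hlog : 0 ≤ Real.log n := Real.log_nonneg (by linarith)
  set x : ℝ := 1 / (128 * n ^ 2 * (1 + Real.log n)) with hx
  have hx1 : x ≤ 1 := by
    rw [hx, div_le_one (by positivity)]
    nlinarith [sq_nonneg ((n : ℝ) - 2), mul_nonneg (sq_nonneg (n : ℝ)) hlog]
  have h1 : (1 - x) ^ codeLength n ≤ Real.exp (-(x * codeLength n)) := by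
    calc (1 - x) ^ codeLength n ≤ Real.exp (-x) ^ codeLength n :=
          pow_le_pow_left₀ (by linarith) (Real.one_sub_le_exp_neg x) _
      _ = _ := by rw [← Real.exp_nat_mul]; ring_nf
  have hL : Real.log n ≤ Nat.log 2 n + 1 := by
    have h3 : (n : ℝ) ≤ 2 ^ (Nat.log 2 n + 1) := by
      exact_mod_cast (Nat.lt_pow_succ_log_self (b := 2) (by norm_num) n).le
    have h4 := Real.log_le_log (by linarith) h3
    rw [Real.log_pow] at h4
    refine h4.trans ?_
    push_cast
    have := Real.log_two_lt_d9
    nlinarith [(Nat.log 2 n).cast_nonneg (α := ℝ)]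
  have h5 : 2 * Real.log n ≤ x * codeLength n := by
    have hl0 : (0 : ℝ) ≤ Nat.log 2 n := Nat.cast_nonneg _
    have e : x * codeLength n = 4 * ((Nat.log 2 n : ℝ) + 1) ^ 2 / (1 + Real.log n) := by
      rw [hx, codeLength]
      push_cast
      field_simp
      ring
    rw [e, le_div_iff₀ (by positivity)]
    nlinarith
  refine h1.trans ((Real.exp_le_exp.2 (neg_le_neg h5)).trans (le_of_eq ?_))
  rw [show -(2 * Real.log n) = -(Real.log (n ^ 2)) by rw [Real.log_pow]; norm_num,
    Real.exp_neg, Real.exp_log (by positivity), one_div]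

theorem codeLength_le (n : ℕ) : codeLength n ≤ 512 * n ^ 2 * (n + 1) ^ 2 := by
  unfold codeLength
  gcongr
  exact Nat.log_le_self 2 n

theorem codeLength_le_log {n : ℕ} (hn : 3 ≤ n) :
    (codeLength n : ℝ) ≤ 4608 * ((n : ℝ) ^ 2 * Real.log n ^ 2) := by
  have h3 : (3 : ℝ) ≤ n := by exact_mod_cast hn
  have hlog : 1 ≤ Real.log n := by
    rw [Real.le_log_iff_exp_le (by linarith)]
    linarith [Real.exp_one_lt_d9]
  have h1 : (2 : ℝ) ^ Nat.log 2 n ≤ n := by exact_mod_cast Nat.pow_log_le_self 2 (by omega)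
  have h2 := Real.log_le_log (by positivity) h1
  rw [Real.log_pow] at h2
  have h4 := Real.log_two_gt_d9
  have h5 : (Nat.log 2 n : ℝ) + 1 ≤ 3 * Real.log n := by
    nlinarith [(Nat.log 2 n).cast_nonneg (α := ℝ)]
  have h0 : (0 : ℝ) ≤ Nat.log 2 n := Nat.cast_nonneg _
  unfold codeLength
  push_cast
  calc 512 * (n : ℝ) ^ 2 * ((Nat.log 2 n : ℝ) + 1) ^ 2 ≤ 512 * n ^ 2 * (3 * Real.log n) ^ 2 := by
        gcongr
    _ = _ := by ring

/-! ### Growth of the number of users -/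

section Growth

variable {n : ℕ → ℕ} {p : Polynomial ℝ} (hp : 0 < p.natDegree)
  (hn : ∀ κ : ℕ, (n κ : ℝ) = p.eval (κ : ℝ))
include hp hn

theorem exists_growth : ∃ c C : ℝ, 0 < c ∧ 0 < C ∧ ∀ᶠ κ : ℕ in atTop,
    c * (κ : ℝ) ^ p.natDegree ≤ n κ ∧ (n κ : ℝ) ≤ C * (κ : ℝ) ^ p.natDegree := by
  have hl : p.leadingCoeff ≠ 0 := by
    rw [Ne, Polynomial.leadingCoeff_eq_zero]
    rintro rfl
    simp at hp
  have h := (Polynomial.isEquivalent_atTop_lead p).isTheta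
  have h1 := h.1.comp_tendsto tendsto_natCast_atTop_atTop
  have h2 := h.2.comp_tendsto tendsto_natCast_atTop_atTop
  obtain ⟨C, hC, h1⟩ := h1.exists_pos
  obtain ⟨D, hD, h2⟩ := h2.exists_pos
  have hl' : 0 < ‖p.leadingCoeff‖ := norm_pos_iff.2 hl
  refine ⟨‖p.leadingCoeff‖ / D, C * ‖p.leadingCoeff‖, by positivity, by positivity, ?_⟩
  filter_upwards [h1.bound, h2.bound] with κ e1 e2
  simp only [Function.comp_apply, ← hn, norm_mul, norm_pow, RCLike.norm_natCast] at e1 e2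
  constructor
  · rw [div_mul_eq_mul_div, div_le_iff₀ hD]
    linarith
  · linarith

theorem tendsto_users : Tendsto (fun κ => (n κ : ℝ)) atTop atTop := by
  obtain ⟨c, C, hc, -, h⟩ := exists_growth hp hn
  refine tendsto_atTop_mono' atTop (h.mono fun κ hκ => hκ.1) ?_
  exact ((tendsto_pow_atTop hp.ne').comp tendsto_natCast_atTop_atTop).const_mul_atTop hc

/-- The encryption scheme runs at parameter `κ / 2`, where its security is measured against `n (κ /
2)`. Polynomial growth makes this comparable to `n κ`, and positive degree makes it at least of
order `κ`. -/
theorem exists_ratio : ∃ R : ℝ, 0 < R ∧ ∀ᶠ κ : ℕ in atTop,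
    (n κ : ℝ) ≤ R * n (κ / 2) ∧ (κ : ℝ) ≤ R * n (κ / 2) := by
  obtain ⟨c, C, hc, hC, h⟩ := exists_growth hp hn
  have h' := (Nat.tendsto_div_const_atTop (n := 2) (by norm_num)).eventually h
  refine ⟨(C + 1) * 3 ^ p.natDegree / c, by positivity, ?_⟩
  filter_upwards [h, h', eventually_ge_atTop 2] with κ h1 h2 h3
  have hK : (κ : ℝ) ≤ 3 * (κ / 2 : ℕ) := by
    have : κ ≤ 3 * (κ / 2) := by omega
    exact_mod_cast this
  have hK1 : (1 : ℝ) ≤ κ := by exact_mod_cast (by omega : 1 ≤ κ)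
  have h4 : (κ : ℝ) ^ p.natDegree ≤ 3 ^ p.natDegree * ((κ / 2 : ℕ) : ℝ) ^ p.natDegree := by
    rw [← mul_pow]; gcongr
  have h5 : (κ : ℝ) ≤ (κ : ℝ) ^ p.natDegree := le_self_pow₀ hK1 hp.ne'
  have h6 : (κ : ℝ) ^ p.natDegree ≤ 3 ^ p.natDegree * (n (κ / 2) / c) := by
    refine h4.trans ?_
    gcongr
    rw [le_div_iff₀ hc]
    linarith [h2.1]
  have h7 : (0 : ℝ) ≤ (κ : ℝ) ^ p.natDegree := by positivity
  rw [show (C + 1) * 3 ^ p.natDegree / c * (n (κ / 2) : ℝ) =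
    (C + 1) * (3 ^ p.natDegree * (n (κ / 2) / c)) by ring]
  have h8 := mul_le_mul_of_nonneg_left h6 (by positivity : 0 ≤ C + 1)
  constructor <;> nlinarith [h1.2]

/-- The half of a key not used by the encryption scheme eventually suffices to name all users. -/
theorem eventually_le_two_pow : ∀ᶠ κ : ℕ in atTop, n κ ≤ 2 ^ (κ - κ / 2) := by
  obtain ⟨c, C, hc, hC, h⟩ := exists_growth hp hn
  have ht := tendsto_pow_const_div_const_pow_of_one_lt p.natDegree (r := (2 : ℝ)) (by norm_num)
  have hpos : 0 < 1 / (C * 2 ^ p.natDegree) := by positivity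
  have h1 := ht.eventually (gt_mem_nhds hpos)
  have hB : Tendsto (fun κ : ℕ => κ - κ / 2) atTop atTop :=
    tendsto_atTop_mono (fun κ => by omega) (Nat.tendsto_div_const_atTop (n := 2) (by norm_num))
  filter_upwards [h, hB.eventually h1] with κ h2 h3
  have hκ : (κ : ℝ) ≤ 2 * (κ - κ / 2 : ℕ) := by
    have : κ ≤ 2 * (κ - κ / 2) := by omega
    exact_mod_cast this
  rw [div_lt_div_iff₀ (by positivity) (by positivity), one_mul] at h3
  have : (n κ : ℝ) ≤ 2 ^ (κ - κ / 2) := by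
    calc (n κ : ℝ) ≤ C * (κ : ℝ) ^ p.natDegree := h2.2
      _ ≤ C * (2 * (κ - κ / 2 : ℕ)) ^ p.natDegree := by gcongr
      _ = ((κ - κ / 2 : ℕ) : ℝ) ^ p.natDegree * (C * 2 ^ p.natDegree) := by rw [mul_pow]; ring
      _ ≤ _ := h3.le
  exact_mod_cast this

/-- Supplies the exponent `a` at which security of the encryption scheme is invoked. The factor `c`
and the ratio of `κ + n κ + 1` to `n (κ / 2)` are absorbed in extra powers of the unbounded `n (κ /
2)`. -/
theorem eventually_poly_le {t : ℕ → ℕ} (ht : PolyBounded t (fun κ => κ + n κ)) :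
    ∃ a : ℕ, 0 < a ∧ ∀ᶠ κ : ℕ in atTop, t κ ≤ n (κ / 2) ^ a := by
  obtain ⟨c, hc⟩ := ht
  obtain ⟨R, hR, h⟩ := exists_ratio hp hn
  refine ⟨2 * c + 1, by omega, ?_⟩
  have hK := (Nat.tendsto_div_const_atTop (n := 2) (by norm_num)).eventually
    ((tendsto_users hp hn).eventually_ge_atTop (2 * R + 1 + c))
  filter_upwards [h, hK] with κ h1 h2
  set N := n (κ / 2) with hN
  have hc0 : (0 : ℝ) ≤ c := Nat.cast_nonneg _
  have h3 : κ + n κ + 1 ≤ N ^ 2 := by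
    have : (κ : ℝ) + n κ + 1 ≤ (N : ℝ) ^ 2 := by nlinarith [h1.1, h1.2]
    exact_mod_cast this
  have h4 : c ≤ N := by
    have : (c : ℝ) ≤ N := by linarith
    exact_mod_cast this
  calc t κ ≤ c * (κ + n κ + 1) ^ c := hc κ
    _ ≤ N * (N ^ 2) ^ c := by gcongr
    _ = N ^ (2 * c + 1) := by ring

end Growth
end TraitorTracing

namespace TraitorTracing

/-! ### The traitor-tracing scheme -/

/-- A bound on the size of the circuits of the users. -/
def userBound (E : EncScheme) (n κ : ℕ) : ℕ :=
  n * ((E.gen (κ / 2)).size + 2) + n * κ + 2 * (n * (E.enc (κ / 2)).size) +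
    (n * ((E.dec (κ / 2)).size + 3 * κ + 3) + 2)

/-- A bound on the size of the tracing circuits. -/
def traceBound (E : EncScheme) (n κ : ℕ) : ℕ :=
  codeLength n * (n * ((E.enc (κ / 2)).size + 64 * (n + 1) ^ 4 * (12 * n + 21))) +
    codeLength n * (n * (E.enc (κ / 2)).size) +
    (accuseSize n (codeLength n) + codeLength n * (n * (64 * (n + 1) ^ 4 * (12 * n + 21)))) + n

theorem EncScheme.len_le (E : EncScheme) (K : ℕ) : E.len K ≤ (E.enc K).size := by
  simp [RandCircuit.size, Circuit.size]

/-- Correctness and small decryption circuits are demanded for every `κ`, security only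
asymptotically. So a trivial scheme may be used whenever there are fewer than two users or not
enough names. -/
theorem exists_instance {E : EncScheme} (hE : E.Correct) (n κ s h : ℕ)
    (hdec : ∀ f ∈ E.decFamily (κ / 2), ∃ D : Circuit (Fin (κ / 2)) Unit,
      (∀ x, D.run x () = f x) ∧ D.size ≤ s ∧ D.depth ≤ h) :
    ∃ I : Instance n (codeLength n) κ, I.Correct ∧
      (∀ c ∈ I.ciphertexts, ∃ D : Circuit (Fin κ) Unit, (∀ x, D.run x () = I.Dec x c) ∧
        D.size ≤ n * (s + 3 * κ + 3) + 3 ∧ D.depth ≤ h + 2) ∧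
      (2 ≤ n → n ≤ 2 ^ (κ - κ / 2) →
        I.userSize ≤ userBound E n κ ∧ I.traceSize ≤ traceBound E n κ ∧
        ∀ (S : Finset (Fin n)), n ≤ S.card + 1 →
        ∀ (P : RandCircuit ((S × Fin κ) ⊕ (Fin (codeLength n) × Fin I.len)) (Fin (codeLength n)))
          (η ε : ℝ) (q t : ℕ), I.Available P η → codeLength n ≤ q →
          (∀ A : RandCircuit (Fin q × Fin (E.len (κ / 2))) Unit, A.size ≤ t →
            ∀ b b' : Fin q → Bool,
              |E.acceptProb (κ / 2) q A b - E.acceptProb (κ / 2) q A b'| ≤ ε) →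
          P.size + accuseSize n (codeLength n) + 5 ≤ t →
          I.failProb P ≤ max 0 (η + 1 / (n : ℝ) ^ 2 + ε)) := by
  by_cases hgood : 2 ≤ n ∧ n ≤ 2 ^ (κ - κ / 2)
  · obtain ⟨hn, hcode⟩ := hgood
    have hm := le_two_pow_codeBits n
    obtain ⟨code⟩ : Nonempty (Fin n ↪ (Fin (κ - κ / 2) → Bool)) :=
      Function.Embedding.nonempty_of_card_le (by simpa using hcode)
    let e : Fin (κ / 2) ⊕ Fin (κ - κ / 2) ≃ Fin κ :=
      finSumFinEquiv.trans (finCongr (by omega))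
    have hlen := E.len_le (κ / 2)
    have hq := two_pow_two_mul_codeBits_le n
    refine ⟨E.tracing e code (codeLength n) hn hm, E.tracing_correct hE code.injective,
      fun c hc => ?_, fun _ _ => ⟨?_, ?_, ?_⟩⟩
    · obtain ⟨D, h1, h2, h3⟩ := E.tracing_family hdec c hc
      refine ⟨D, h1, h2.trans ?_, h3⟩
      have : n * (s + 3 * (κ - κ / 2) + 3) ≤ n * (s + 3 * κ + 3) :=
        Nat.mul_le_mul_left _ (by omega)
      omega
    · have h1 := RandCircuit.size_ofComputes (E.computes_keys e code)
      have h2 := RandCircuit.size_ofComputes (E.computes_encTuple (n := n) e)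
      have h3 := (E.computes_decTuple e code).size_circuit
      simp only [Fintype.card_prod, Fintype.card_fin, Fintype.card_unit] at h1 h2 h3
      have h4 := Nat.mul_le_mul_left n hlen
      have h5 : n * ((E.dec (κ / 2)).size + 3 * (κ - κ / 2) + 3) ≤
          n * ((E.dec (κ / 2)).size + 3 * κ + 3) := Nat.mul_le_mul_left _ (by omega)
      refine (add_le_add (add_le_add h1 h2) h3).trans ?_
      unfold userBound
      omega
    · have h1 := ((E.computes_query (n := n) (k := codeLength n) (m := codeBits n) e).comp
        (Computes.inputs (Sum.map id (Fintype.equivFin (E.TraceIndex n (codeLength n) (codeBits n)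
          (κ / 2)))))).size_circuit
      have h2 := ((E.computes_accuse (K := κ / 2) (κ := κ) (k := codeLength n) hn hm).comp
        (Computes.inputs (Sum.map id (Sum.map (Fintype.equivFin (E.TraceIndex n (codeLength n)
          (codeBits n) (κ / 2))) id)))).size_circuit
      simp only [Fintype.card_prod, Fintype.card_fin] at h1 h2
      refine (add_le_add h1 h2).trans ?_
      unfold traceBound
      have h4 : codeLength n * (n * E.len (κ / 2)) ≤ codeLength n * (n * (E.enc (κ / 2)).size) := by
        gcongr
      have h5 : codeLength n * (n * ((E.enc (κ / 2)).size +
          2 ^ (2 * codeBits n) * (6 * codeBits n + 3))) ≤ codeLength n *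
          (n * ((E.enc (κ / 2)).size + 64 * (n + 1) ^ 4 * (12 * n + 21))) := by
        gcongr
      have h6 : codeLength n * (n * (2 ^ (2 * codeBits n) * (6 * codeBits n + 3))) ≤
          codeLength n * (n * (64 * (n + 1) ^ 4 * (12 * n + 21))) := by
        gcongr
      omega
    · intro S hS P η ε q t hP hkq hsec ht
      refine (E.tracing_failProb_le hE code.injective hS P hP hkq hsec ht).trans ?_
      refine max_le_max le_rfl ?_
      have := pow_codeLength_le hn
      linarith
  · obtain ⟨I, h1, h2⟩ := exists_trivial_instance n (codeLength n) κ
    refine ⟨I, h1, fun c _ => ?_, fun h3 h4 => absurd ⟨h3, h4⟩ hgood⟩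
    obtain ⟨D, h3, h4, h5⟩ := h2 c
    exact ⟨D, h3, by omega, by omega⟩

section Bounds

variable {n : ℕ → ℕ} {M : ℕ → ℕ}

theorem PolyBounded.codeLength (hn : PolyBounded n M) :
    PolyBounded (fun κ => codeLength (n κ)) M :=
  (((const 512).mul (hn.pow 2)).mul ((hn.add (const 1)).pow 2)).mono
    fun κ => codeLength_le (n κ)

theorem PolyBounded.half (hκ : ∀ κ, κ ≤ M κ) {t : ℕ → ℕ} (h : PolyBounded t (fun κ => κ)) :
    PolyBounded (fun κ => t (κ / 2)) M :=
  (h.comp (fun κ => κ / 2)).trans (PolyBounded.of_le fun κ => (Nat.div_le_self κ 2).trans (hκ κ))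

theorem PolyBounded.userBound (E : EncScheme) (hκ : ∀ κ, κ ≤ M κ) (hn : PolyBounded n M) :
    PolyBounded (fun κ => userBound E (n κ) κ) M := by
  have hg := PolyBounded.half hκ E.gen_time
  have he := PolyBounded.half hκ E.enc_time
  have hd := PolyBounded.half hκ E.dec_time
  have hid : PolyBounded (fun κ => κ) M := PolyBounded.of_le hκ
  exact (((hn.mul (hg.add (const 2))).add (hn.mul hid)).add ((const 2).mul (hn.mul he))).add
    ((hn.mul ((hd.add ((const 3).mul hid)).add (const 3))).add (const 2))

theorem PolyBounded.traceBound (E : EncScheme) (hκ : ∀ κ, κ ≤ M κ) (hn : PolyBounded n M) :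
    PolyBounded (fun κ => traceBound E (n κ) κ) M := by
  have he := PolyBounded.half hκ E.enc_time
  have hk := hn.codeLength
  have hq := ((const 64).mul ((hn.add (const 1)).pow 4)).mul (((const 12).mul hn).add (const 21))
  exact (((hk.mul (hn.mul (he.add hq))).add (hk.mul (hn.mul he))).add
    ((PolyBounded.accuseSize hn hk).add (hk.mul (hn.mul hq)))).add hn

end Bounds

theorem isBigO_familySize {n s : ℕ → ℕ} (hn : ∀ᶠ κ in atTop, 3 ≤ n κ)
    (hs : PolyBounded s (fun κ => κ)) :
    ∃ c : ℕ, (fun κ => ((n κ * (s (κ / 2) + 3 * κ + 3) + 3 : ℕ) : ℝ)) =O[atTop]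
      (fun κ => (n κ : ℝ) * Real.log (n κ : ℝ) ^ c * (κ : ℝ) ^ c) := by
  obtain ⟨c, hc⟩ := hs
  refine ⟨c + 1, IsBigO.of_bound (c * 2 ^ c + 9 : ℕ) ?_⟩
  filter_upwards [hn, eventually_ge_atTop 1] with κ h1 h2
  have h3 : (3 : ℝ) ≤ n κ := by exact_mod_cast h1
  have hlog : 1 ≤ Real.log (n κ) := by
    rw [Real.le_log_iff_exp_le (by linarith)]
    linarith [Real.exp_one_lt_d9]
  have h4 : n κ * (s (κ / 2) + 3 * κ + 3) + 3 ≤ (c * 2 ^ c + 9) * (n κ * κ ^ (c + 1)) := by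
    have e1 : κ ≤ κ ^ (c + 1) := Nat.le_self_pow (by omega) κ
    have e2 : s (κ / 2) ≤ c * 2 ^ c * κ ^ (c + 1) := by
      calc s (κ / 2) ≤ c * (κ / 2 + 1) ^ c := hc _
        _ ≤ c * (2 * κ) ^ c := by gcongr; omega
        _ = c * 2 ^ c * κ ^ c := by rw [mul_pow]; ring
        _ ≤ _ := by gcongr; omega
    have e3 : n κ * (s (κ / 2) + 3 * κ + 3) ≤
        n κ * (c * 2 ^ c * κ ^ (c + 1) + 3 * κ ^ (c + 1) + 3 * κ ^ (c + 1)) := by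
      gcongr
      omega
    have e4 : 1 ≤ n κ * κ ^ (c + 1) := Nat.mul_pos (by omega) (by positivity)
    calc _ ≤ n κ * (c * 2 ^ c * κ ^ (c + 1) + 3 * κ ^ (c + 1) + 3 * κ ^ (c + 1)) +
          3 * (n κ * κ ^ (c + 1)) := by omega
      _ = _ := by ring
  rw [Real.norm_of_nonneg (by positivity), Real.norm_of_nonneg (by positivity)]
  calc ((n κ * (s (κ / 2) + 3 * κ + 3) + 3 : ℕ) : ℝ)
      ≤ (((c * 2 ^ c + 9) * (n κ * κ ^ (c + 1)) : ℕ) : ℝ) := by exact_mod_cast h4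
    _ = ((c * 2 ^ c + 9 : ℕ) : ℝ) * ((n κ : ℝ) * 1 * (κ : ℝ) ^ (c + 1)) := by push_cast; ring
    _ ≤ _ := by
      gcongr
      exact one_le_pow₀ hlog

theorem isLittleO_inv_sq_inv {n : ℕ → ℕ} (hn : Tendsto (fun κ => (n κ : ℝ)) atTop atTop) :
    (fun κ => 1 / (n κ : ℝ) ^ 2) =o[atTop] (fun κ => 1 / (n κ : ℝ)) := by
  have h := (isLittleO_const_id_atTop (1 : ℝ)).comp_tendsto hn
  have h2 := h.mul_isBigO (isBigO_refl (fun κ => 1 / (n κ : ℝ) ^ 2) atTop)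
  refine h2.congr' (by simp) ?_
  filter_upwards [hn.eventually_gt_atTop 0] with κ hκ
  simp only [Function.comp_apply, id]
  field_simp

/-- The bound for each instance is combined with the asymptotics. The order of choices matters: the
pirate determines the size of the distinguisher, this determines `a`, and only then are `ε` and `q`
obtained. -/
theorem secure_ofInstances {n : ℕ → ℕ} {p : Polynomial ℝ} (hp : 0 < p.natDegree)
    (hn : ∀ κ : ℕ, (n κ : ℝ) = p.eval (κ : ℝ)) {E : EncScheme}
    (hsecure : ∀ a : ℕ, 0 < a → ∃ (ε : ℕ → ℝ) (q : ℕ → ℕ),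
      ε =o[atTop] (fun κ => 1 / (n κ : ℝ) ^ 2) ∧
      (fun κ => (n κ : ℝ) ^ 4) =o[atTop] (fun κ => (q κ : ℝ)) ∧
      E.Secure ε q (fun κ _ => n κ ^ a))
    (I : ∀ κ, Instance (n κ) (codeLength (n κ)) κ)
    (hI : ∀ᶠ κ in atTop, ∀ (S : Finset (Fin (n κ))), n κ ≤ S.card + 1 →
        ∀ (P : RandCircuit ((S × Fin κ) ⊕ (Fin (codeLength (n κ)) × Fin (I κ).len))
          (Fin (codeLength (n κ)))) (η ε : ℝ) (q t : ℕ), (I κ).Available P η →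
          codeLength (n κ) ≤ q →
          (∀ A : RandCircuit (Fin q × Fin (E.len (κ / 2))) Unit, A.size ≤ t →
            ∀ b b' : Fin q → Bool,
              |E.acceptProb (κ / 2) q A b - E.acceptProb (κ / 2) q A b'| ≤ ε) →
          P.size + accuseSize (n κ) (codeLength (n κ)) + 5 ≤ t →
          (I κ).failProb P ≤ max 0 (η + 1 / (n κ : ℝ) ^ 2 + ε))
    (hu : PolyBounded (fun κ => (I κ).userSize) (fun κ => κ + n κ))
    (ht : PolyBounded (fun κ => (I κ).traceSize) (fun κ => κ + n κ + codeLength (n κ))) :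
    (TTScheme.ofInstances I hu ht).Secure := by
  intro S hS P hPe hPa
  obtain ⟨c, hc⟩ := hPe
  obtain ⟨η, hη, hav⟩ := hPa
  have hnM : PolyBounded n (fun κ => κ + n κ) := PolyBounded.of_le fun κ => Nat.le_add_left _ _
  have hidM : PolyBounded (fun κ => κ) (fun κ => κ + n κ) :=
    PolyBounded.of_le fun κ => Nat.le_add_right _ _
  have hsz : PolyBounded (fun κ => c * (κ + n κ + codeLength (n κ) + 1) ^ c +
      accuseSize (n κ) (codeLength (n κ)) + 5) (fun κ => κ + n κ) :=
    (((PolyBounded.const c).mul ((((hidM.add hnM).add hnM.codeLength).add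
      (PolyBounded.const 1)).pow c)).add (PolyBounded.accuseSize hnM hnM.codeLength)).add
      (PolyBounded.const 5)
  obtain ⟨a, ha, hle⟩ := eventually_poly_le hp hn hsz
  obtain ⟨ε, q, hε, hq, hsec⟩ := hsecure a ha
  obtain ⟨R, hR, hratio⟩ := exists_ratio hp hn
  have hhalf : Tendsto (fun κ : ℕ => κ / 2) atTop atTop :=
    Nat.tendsto_div_const_atTop (n := 2) (by norm_num)
  have hinf := tendsto_users hp hn
  have hε' : (fun κ => ε (κ / 2)) =o[atTop] (fun κ => 1 / (n κ : ℝ)) := by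
    refine ((hε.comp_tendsto hhalf).trans_isBigO ?_).trans (isLittleO_inv_sq_inv hinf)
    refine IsBigO.of_bound (R ^ 2) ?_
    filter_upwards [hratio, hinf.eventually_gt_atTop 0,
      (hinf.comp hhalf).eventually_gt_atTop 0] with κ h1 h2 h3
    simp only [Function.comp_apply] at h3 ⊢
    rw [Real.norm_of_nonneg (by positivity), Real.norm_of_nonneg (by positivity), mul_one_div,
      div_le_div_iff₀ (by positivity) (by positivity), one_mul, ← mul_pow]
    exact pow_le_pow_left₀ h2.le h1.1 2
  have hη' : η =o[atTop] (fun κ => 1 / (n κ : ℝ)) := hη.trans (isLittleO_inv_sq_inv hinf)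
  have hsum := (hη'.norm_left.add (isLittleO_inv_sq_inv hinf)).add hε'.norm_left
  refine (IsBigO.of_bound 1 ?_).trans_isLittleO hsum
  have hq' : ∀ᶠ κ in atTop, codeLength (n κ) ≤ q (κ / 2) := by
    -- The code length is at most `512 n² (2 n)² = 2048 n⁴`, hence at most `2048 R⁴ n (κ / 2) ^ 4`,
    -- which `q (κ / 2)` eventually exceeds.
    have h0 : 0 < 1 / (2048 * R ^ 4) := by positivity
    filter_upwards [hhalf.eventually (hq.bound h0), hratio, hinf.eventually_ge_atTop 1]
      with κ h1 h2 h3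
    simp only [norm_pow, RCLike.norm_natCast] at h1
    have h4 : (codeLength (n κ) : ℝ) ≤ 512 * n κ ^ 2 * (n κ + 1) ^ 2 := by
      exact_mod_cast codeLength_le (n κ)
    have h5 : (512 * n κ ^ 2 * (n κ + 1) ^ 2 : ℝ) ≤ 512 * n κ ^ 2 * (n κ + n κ) ^ 2 := by gcongr
    have h6 : (n κ : ℝ) ^ 4 ≤ (R * n (κ / 2)) ^ 4 := pow_le_pow_left₀ (by positivity) h2.1 4
    rw [one_div_mul_eq_div, le_div_iff₀ (by positivity)] at h1
    have : (codeLength (n κ) : ℝ) ≤ q (κ / 2) := by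
      rw [mul_pow] at h6
      linarith
    exact_mod_cast this
  filter_upwards [hI, hle, hq'] with κ h1 h2 h3
  have hfail := h1 (S κ) (hS κ) (P κ (S κ)) (η κ) (ε (κ / 2)) (q (κ / 2)) (n (κ / 2) ^ a)
    (fun sk c' hc' => hav κ sk (S κ) (hS κ) c' hc') h3 (fun A hA b b' => hsec (κ / 2) A hA b b')
    (le_trans (Nat.add_le_add_right (Nat.add_le_add_right (hc κ (S κ) (hS κ)) _) _) h2)
  rw [one_mul, Real.norm_of_nonneg (prob_nonneg _), Real.norm_of_nonneg (by positivity)]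
  refine hfail.trans (max_le (by positivity) ?_)
  rw [Real.norm_eq_abs, Real.norm_eq_abs]
  linarith [le_abs_self (η κ), le_abs_self (ε (κ / 2))]

end TraitorTracing

/-! ### The final assembly over all security parameters. -/

theorem corollary5p7
    (n : ℕ → ℕ) (p : Polynomial ℝ) (hp : 0 < p.natDegree)
    (hn : ∀ κ : ℕ, (n κ : ℝ) = p.eval (κ : ℝ))
    (h : ℕ) (E : TraitorTracing.EncScheme) (hcorrect : E.Correct)
    (hsecure : ∀ a : ℕ, 0 < a → ∃ (ε : ℕ → ℝ) (q : ℕ → ℕ),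
      ε =o[atTop] (fun κ => 1 / (n κ : ℝ) ^ 2) ∧
      (fun κ => (n κ : ℝ) ^ 4) =o[atTop] (fun κ => (q κ : ℝ)) ∧
      E.Secure ε q (fun κ _ => n κ ^ a))
    (hdec : ∃ s : ℕ → ℕ, TraitorTracing.PolyBounded s (fun κ => κ) ∧
      TraitorTracing.HasCircuits E.decFamily s h) :
    ∃ k : ℕ → ℕ,
      (∃ c : ℕ, (fun κ => (k κ : ℝ)) =O[atTop]
        (fun κ => (n κ : ℝ) ^ 2 * Real.log (n κ : ℝ) ^ c)) ∧
      ∃ TT : TraitorTracing.TTScheme n k, TT.Correct ∧ TT.Secure ∧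
        ∃ s : ℕ → ℕ,
          (∃ c : ℕ, (fun κ => (s κ : ℝ)) =O[atTop]
            (fun κ => (n κ : ℝ) * Real.log (n κ : ℝ) ^ c * (κ : ℝ) ^ c)) ∧
          TraitorTracing.HasCircuits TT.decFamily s (h + 2) := by
  open TraitorTracing in
  obtain ⟨s, hs, hcirc⟩ := hdec
  have hn3 : ∀ᶠ κ in atTop, 3 ≤ n κ := by
    filter_upwards [(tendsto_users hp hn).eventually_ge_atTop 3] with κ hκ
    exact_mod_cast hκ
  have hpow := eventually_le_two_pow hp hn
  choose I hI1 hI2 hI3 using fun κ =>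
    exists_instance hcorrect (n κ) κ (s (κ / 2)) h (hcirc (κ / 2))
  have hu : PolyBounded (fun κ => (I κ).userSize) (fun κ => κ + n κ) := by
    refine (PolyBounded.userBound E (M := fun κ => κ + n κ) (fun κ => Nat.le_add_right _ _)
      (PolyBounded.of_le fun κ => Nat.le_add_left _ _)).of_eventually_le ?_
    filter_upwards [hn3, hpow] with κ h1 h2
    exact (hI3 κ (by omega) h2).1
  have ht : PolyBounded (fun κ => (I κ).traceSize) (fun κ => κ + n κ + codeLength (n κ)) := by
    refine (PolyBounded.traceBound E (n := n) (M := fun κ => κ + n κ + codeLength (n κ))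
      (fun κ => by omega) (PolyBounded.of_le fun κ => by omega)).of_eventually_le ?_
    filter_upwards [hn3, hpow] with κ h1 h2
    exact (hI3 κ (by omega) h2).2.1
  refine ⟨fun κ => codeLength (n κ), ⟨2, IsBigO.of_bound 4608 ?_⟩,
    TTScheme.ofInstances I hu ht, ?_, ?_, fun κ => n κ * (s (κ / 2) + 3 * κ + 3) + 3,
    isBigO_familySize hn3 hs, ?_⟩
  · filter_upwards [hn3] with κ h1
    rw [Real.norm_of_nonneg (by positivity), Real.norm_of_nonneg (by positivity)]
    exact codeLength_le_log h1
  · intro b κ i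
    exact prob_eq_one_of_forall fun ω => hI1 κ b i ω.1 ω.2
  · refine secure_ofInstances hp hn hsecure I ?_ hu ht
    filter_upwards [hn3, hpow] with κ h1 h2
    exact (hI3 κ (by omega) h2).2.2
  · rintro κ _ ⟨c, hc, rfl⟩
    exact hI2 κ c hc
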